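/- **Definitions.** Cells are unit cubes of $\mathbb{Z}^3$; a polyomino is a finite nonempty set of cells connected through common faces. It is inscribed in a $b\times k\times h$ prism if it is contained in the prism and touches its six faces, and it is minimal if it has the smallest volume among the polyominoes inscribed in that prism. For a family of polyominoes its generating function is $\sum_{b,k,h}(\text{number of members in the } b\times k\times h \text{ prism})\,x^by^kz^h$, over all $b,k,h\ge1$. * A *stair* is the set of cells of a path from a corner cell of a prism to the opposite corner cell with unit steps in the three directions leading from the first to the second; $Stair$ counts those from one fixed corner. * A *corner-polyomino* is a minimal inscribed polyomino containing a given corner cell of the prism. $Tripod$ counts those whose corner cell has degree (number of face neighbours in the polyomino) $3$; $Deg2$ counts those whose corner cell has degree $2$, in prisms with all sides $\ge2$; $2Dhook$ counts the *2D hooks*: in a prism with one side equal to $1$ and the two others $\ge 2$, the two perpendicular full rows of cells meeting at the given corner. A *hook* is any of these three. * A *diagonal polyomino* along a given diagonal of the prism is a minimal inscribed polyomino that is the union of a stair, from a cell $p$ to a cell $q$ in the direction of the diagonal, of a hook with corner cell $p$ inscribed in the box spanned by $p$ and the first end of the diagonal, and of a hook with corner cell $q$ inscribed in the box spanned by $q$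 and the second end; either hook may be absent, and then the stair reaches that end of the diagonal. $1Diag$ counts these for one fixed diagonal. $diag(b,k,h)$ is the number of minimal polyominoes that are diagonal along at least one of the four diagonals, and $Diag=\sum_{b,k,h\ge2}diag(b,k,h)x^by^kz^h$. * Given two diagonals with the same projection along the $z$ axis, the *generic form on two diagonals* is a minimal inscribed polyomino that is the union of two 2D corner-polyominoes in one slice perpendicular to $z$, sharing their corner cell $c$ and inscribed in the two rectangles that $c$ spans with the ends of the projected diagonal, and of the full row of cells through $c$ in direction $z$ (the full pillar); similarly for $x$, $y$. * A *3D cross*, in a prism with all sides $\ge2$, is a minimal inscribed polyomino consisting of the three full rows of cells through one cell; $3Dcross$ counts them. **Proposition.** As elements of the field of fractions of $\mathbb{Q}[[x,y,z]]$: 1. $Stair=\frac{xyz}{1-x-y-z}$, $Tripod=\frac{x^2y^2z^2}{(1-x)(1-y)(1-z)}$, $2Dhook=\frac{x^2y^2z}{(1-x)(1-y)}+\frac{x^2yz^2}{(1-x)(1-z)}+\frac{xy^2z^2}{(1-z)(1-y)}$, $Deg2=\left[\frac{2yz}{1-y-z}-\frac{2yz}{(1-y)(1-z)}\right]\frac{x^2}{1-x}+\left[\frac{2xz}{1-x-z}-\frac{2xz}{(1-x)(1-z)}\right]\frac{y^2}{1-y}+\left[\frac{2xy}{1-x-y}-\frac{2xy}{(1-x)(1-y)}\right]\frac{z^2}{1-z}$,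 and $3Dcross=\frac{x^2(2-x)y^2(2-y)z^2(2-z)}{(1-x)^2(1-y)^2(1-z)^2}$. The generating function of the corner-polyominoes in $b\times k\times1$ prisms is $z\,P_c(x,y)$ with $P_c(x,y)=\frac{2xy}{1-x-y}-\frac{xy}{(1-x)(1-y)}$ (the 2D corner generating function), and similarly for the other two directions. 2. For each of the four diagonals, $$1Diag=Stair\cdot\left[1+\frac{Tripod+Deg2+2Dhook}{xyz}\right]^2 .$$ 3. Put $2diag_z=\frac1{xy}P_c(x,y)^2\frac{z}{(1-z)^2}$, and similarly $2diag_x$, $2diag_y$. For any two diagonals with the same projection along $z$, every generic form for this pair is a diagonal polyomino along both of them, and for $h\ge2$ and $b\ge 2$ or $k\ge2$ the number of generic forms in the $b\times k\times h$ prism is the coefficient of $x^by^kz^h$ in $2diag_z$; similarly for $x$ and $y$. Every 3D cross is diagonal along all four diagonals. 4. For all $b,k,h\ge2$, the number $diag(b,k,h)$ is the coefficient of $x^by^kz^h$ in $$4\cdot 1Diag-2\,(2diag_x+2diag_y+2diag_z)+3\cdot 3Dcross .$$ -/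

import Mathlib

namespace Polycube

/-- A unit cubic cell, named by its integer position. -/
abbrev Cell := Fin 3 → ℤ

/-- Two cells are adjacent when they share a face. -/
def cellGraph : SimpleGraph Cell where
  Adj c d := ∑ i, |c i - d i| = 1
  symm := ⟨fun c d h => by simpa only [abs_sub_comm] using h⟩
  loopless := ⟨fun c h => by simp at h⟩

instance : DecidableRel cellGraph.Adj := fun c d =>
  inferInstanceAs (Decidable (∑ i, |c i - d i| = 1))

/-- `P` is a polyomino (a 6-connected set of cells) inscribed in the box of cells `[lo, hi]`:
it is contained in the box and touches each of its six faces. -/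
structure Inscribed (lo hi : Cell) (P : Finset Cell) : Prop where
  subset : ∀ c ∈ P, c ∈ Set.Icc lo hi
  connected : (cellGraph.induce (P : Set Cell)).Connected
  touches_lo : ∀ i, ∃ c ∈ P, c i = lo i
  touches_hi : ∀ i, ∃ c ∈ P, c i = hi i

/-- `P` is inscribed in the box `[lo, hi]` and has minimal volume under this condition. -/
def MinimalInscribed (lo hi : Cell) (P : Finset Cell) : Prop :=
  Inscribed lo hi P ∧ ∀ Q, Inscribed lo hi Q → P.card ≤ Q.card

/-- The degree of the cell `c` in `P`: the number of cells of `P` having a face in contact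
with `c`. -/
def degree (P : Finset Cell) (c : Cell) : ℕ := (P.filter (fun d => cellGraph.Adj c d)).card

/-- `v` is one of the corner cells of the box `[lo, hi]`. -/
def IsVertex (lo hi v : Cell) : Prop := ∀ i, v i = lo i ∨ v i = hi i

/-- A corner-polyomino: a minimal inscribed polyomino containing the given corner cell `v` of
the box. When the box has thickness one this is a 2D corner-polyomino. -/
def IsCornerPoly (lo hi v : Cell) (P : Finset Cell) : Prop :=
  IsVertex lo hi v ∧ MinimalInscribed lo hi P ∧ v ∈ P

/-- A tripod: a corner-polyomino whose corner cell has degree three. -/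
def IsTripod (lo hi v : Cell) (P : Finset Cell) : Prop :=
  IsCornerPoly lo hi v P ∧ degree P v = 3

/-- A properly three-dimensional corner-polyomino (all sides of the box at least two) whose
corner cell has degree two. -/
def IsDegTwo (lo hi v : Cell) (P : Finset Cell) : Prop :=
  (∀ i, lo i < hi i) ∧ IsCornerPoly lo hi v P ∧ degree P v = 2

/-- A 2D hook: in a box of thickness one in direction `a` and of both other sides at least two,
the two perpendicular full rows of cells that meet at the corner cell `v`. -/
def IsTwoDHook (lo hi v : Cell) (P : Finset Cell) : Prop :=
  IsVertex lo hi v ∧ ∃ a, lo a = hi a ∧ (∀ i, i ≠ a → lo i < hi i) ∧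
    ∀ c, c ∈ P ↔ c ∈ Set.Icc lo hi ∧ ∃ i, i ≠ a ∧ ∀ j, j ≠ i → c j = v j

/-- A hook: a corner-polyomino with corner of degree three or two, or a 2D hook. -/
def IsHook (lo hi v : Cell) (P : Finset Cell) : Prop :=
  IsTripod lo hi v P ∨ IsDegTwo lo hi v P ∨ IsTwoDHook lo hi v P

/-- A 3D stair from `p` to `q`: the cells of a path with unit steps in the three positive
coordinate directions. -/
def IsStair (p q : Cell) (S : Finset Cell) : Prop :=
  ∃ (n : ℕ) (f : ℕ → Cell), f 0 = p ∧ f n = q ∧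
    (∀ m < n, ∃ i, f (m + 1) = f m + Pi.single i 1) ∧ S = (Finset.range (n + 1)).image f

/-- The last cell of the prism with side lengths `s`; its cells are those of the box
`[0, top s]`. -/
def top (s : Fin 3 → ℕ) : Cell := fun i => (s i : ℤ) - 1

/-- `P` is a diagonal polyomino along the diagonal from `0` to `top s` of the prism: a minimal
inscribed polyomino made of a hook at each end of the diagonal and a stair joining their corner
cells `p` and `q`. The hook at an end touches the three faces of the prism at that end, and is
possibly absent, in which case the stair reaches the corner of the prism. -/
def IsMainDiagonal (s : Fin 3 → ℕ) (P : Finset Cell) : Prop :=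
  MinimalInscribed 0 (top s) P ∧ ∃ (p q : Cell) (H S H' : Finset Cell),
    ((p = 0 ∧ H = ∅) ∨ IsHook 0 p p H) ∧ IsStair p q S ∧
    ((q = top s ∧ H' = ∅) ∨ IsHook q (top s) q H') ∧ P = H ∪ S ∪ H'

/-- The symmetry of the prism that reverses the coordinates `i` with `ε i = true`. -/
def reflect (s : Fin 3 → ℕ) (ε : Fin 3 → Bool) (c : Cell) : Cell :=
  fun i => if ε i then (s i : ℤ) - 1 - c i else c i

/-- Diagonal polyominoes along the diagonal of the prism that joins `reflect s ε 0` to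
`reflect s ε (top s)`. As `ε` varies, each of the four diagonals occurs twice, once for each
orientation. -/
def IsDiagonalAlong (s : Fin 3 → ℕ) (ε : Fin 3 → Bool) (P : Finset Cell) : Prop :=
  IsMainDiagonal s (P.image (reflect s ε))

/-- Diagonal polyominoes: those along at least one of the diagonals. -/
def IsDiagonal (s : Fin 3 → ℕ) (P : Finset Cell) : Prop := ∃ ε, IsDiagonalAlong s ε P

/-- The diagonal which, with the diagonal `ε`, spans a plane parallel to the axis `a`: the two
have the same projection along `a`. -/
def flip (a : Fin 3) (ε : Fin 3 → Bool) : Fin 3 → Bool := Function.update ε a (!ε a)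

/-- The generic form of a polyomino on two diagonals with the same projection along `a`: two 2D
corner-polyominoes in one slice perpendicular to `a`, in opposite position and sharing their
corner cell `c`, together with the full pillar through `c` in direction `a`. -/
def IsMainTwoDiag (s : Fin 3 → ℕ) (a : Fin 3) (P : Finset Cell) : Prop :=
  MinimalInscribed 0 (top s) P ∧ ∃ (c : Cell) (L U V : Finset Cell),
    c ∈ Set.Icc 0 (top s) ∧
    IsCornerPoly (Function.update 0 a (c a)) c c L ∧
    IsCornerPoly c (Function.update (top s) a (c a)) c U ∧
    (∀ d, d ∈ V ↔ d ∈ Set.Icc 0 (top s) ∧ ∀ i, i ≠ a → d i = c i) ∧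
    P = L ∪ U ∪ V

/-- The generic form for the pair of diagonals `ε` and `flip a ε`. -/
def IsTwoDiagAlong (s : Fin 3 → ℕ) (a : Fin 3) (ε : Fin 3 → Bool) (P : Finset Cell) : Prop :=
  IsMainTwoDiag s a (P.image (reflect s ε))

/-- 3D crosses, in a prism with all sides at least two: minimal inscribed polyominoes made only
of pillars (rows of cells reaching a face of the prism) that meet at one common cell `c`. -/
def IsCross (s : Fin 3 → ℕ) (P : Finset Cell) : Prop :=
  (∀ i, 2 ≤ s i) ∧ MinimalInscribed 0 (top s) P ∧ ∃ c ∈ Set.Icc 0 (top s),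
    ∀ d, d ∈ P ↔ d ∈ Set.Icc 0 (top s) ∧ ∃ i, ∀ j, j ≠ i → d j = c j

/-- The generating function `∑ |F(b,k,h)| x^b y^k z^h` of a family of sets of cells that depends
on the sides of a prism. -/
noncomputable def series (F : (Fin 3 → ℕ) → Set (Finset Cell)) : MvPowerSeries (Fin 3) ℚ :=
  fun n => ((F n).ncard : ℚ)

/-- The field of fractions of the ring of power series in `x, y, z`, where rational expressions
in `x, y, z` are formed. -/
abbrev GF := FractionRing (MvPowerSeries (Fin 3) ℚ)

/-- A power series as an element of the field of fractions. -/
noncomputable def toGF (f : MvPowerSeries (Fin 3) ℚ) : GF := algebraMap _ GF f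

/-- The variables `x = var 0`, `y = var 1`, `z = var 2`. -/
noncomputable def var (i : Fin 3) : GF := toGF (MvPowerSeries.X i)

noncomputable def Stair : GF := toGF (series fun s => {P | IsStair 0 (top s) P})

noncomputable def Tripod : GF := toGF (series fun s => {P | IsTripod 0 (top s) 0 P})

noncomputable def Deg2 : GF := toGF (series fun s => {P | IsDegTwo 0 (top s) 0 P})

noncomputable def TwoDHook : GF := toGF (series fun s => {P | IsTwoDHook 0 (top s) 0 P})

/-- The generating function of the corner-polyominoes inscribed in prisms of thickness one in
direction `a`. -/
noncomputable def FlatCorner (a : Fin 3) : GF :=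
  toGF (series fun s => {P | s a = 1 ∧ IsCornerPoly 0 (top s) 0 P})

noncomputable def OneDiag (ε : Fin 3 → Bool) : GF :=
  toGF (series fun s => {P | IsDiagonalAlong s ε P})

noncomputable def Cross : GF := toGF (series fun s => {P | IsCross s P})

/-- The 2D corner generating function in the variables `var i`, `var j`. -/
noncomputable def cornerGF (i j : Fin 3) : GF :=
  2 * var i * var j / (1 - var i - var j) - var i * var j / ((1 - var i) * (1 - var j))

/-- The generating function of the generic forms with pillar in direction `a`, where `i`, `j`
are the other two axes. -/
noncomputable def twoDiagGF (a i j : Fin 3) : GF :=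
  1 / (var i * var j) * cornerGF i j ^ 2 * (var a / (1 - var a) ^ 2)

/-- The rational expression `r` is a power series whose coefficients at all exponents in `E`
are those of `f`. -/
def AgreeOn (E : Set (Fin 3 →₀ ℕ)) (f : MvPowerSeries (Fin 3) ℚ) (r : GF) : Prop :=
  ∃ g, toGF g = r ∧ ∀ n ∈ E, MvPowerSeries.coeff n f = MvPowerSeries.coeff n g

end Polycube

open Polycube

namespace Polycube

/-! Minimality is first turned into geometry. Adding an adjacent cell to a connected set enlarges
its bounding box by at most one unit, in one direction, so an inscribed polyomino has at least `span
lo hi` cells, and three rows through one cell attain this bound. In a minimal polyomino, built cell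
by cell, each new cell therefore lies beyond all earlier ones in some direction. Two properties
survive every such step (`Inscribed.structure_aux`): cells are joined by shortest paths
(`Geodesic`), and two planes in different directions never cut the polyomino into four nonempty
quadrants (`Laminar`).

With these, each class becomes the existence of a centre. A minimal polyomino is diagonal exactly
when it has a cell comparable with all its cells in the order of the diagonal (`isMainDiagonal_iff`,
`isDiagonalAlong_iff`). It is a generic form on two diagonals exactly when one cell is central for
both (`isTwoDiagAlong_iff`), and a cross when all cells lie in the three rows through one cell
(`isCross_iff`).

For the last formula, fix a minimal polyomino and let its diagonals be the vertices of a graph, two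
being joined when they have a common central cell. Parallel pillars coincide, and three pillars in
different directions meet in one cell, so two opposite edges or a triangle force a cross; for a
cross the graph is complete on four vertices. Otherwise the graph has no cycle, and it is connected
by `linked`. A nonempty tree has one vertex more than it has edges, and the complete graph gives 4 -
6 + 3 = 1, whence the correction by three crosses. Summing over all polyominoes gives
`ncard_isDiagonal`; each axis accounts for two opposite edges.

The generating functions come from cutting at canonical cells. A corner cell of degree one can be
removed, so the series C of corner-polyominoes and H of hooks, both divided by xyz, satisfy (1 - x -
y - z) C = 1 + H. A diagonal polyomino is cut at its last central cell into a corner-polyomino and a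
hook or nothing, which gives C (1 + H), that is (1 + H)² / (1 - x - y - z). A generic form is cut at
its centre into two flat corner-polyominoes and a pillar, a hook of degree two into a row and a flat
corner-polyomino, and a cross is given by its centre. -/

theorem adj_iff (c d : Cell) :
    cellGraph.Adj c d ↔ ∃ i, d = c + Pi.single i 1 ∨ d = c - Pi.single i 1 := by
  change ∑ i, |c i - d i| = 1 ↔ _
  simp only [Fin.sum_univ_three, Fin.exists_fin_succ, funext_iff, Fin.forall_fin_succ]
  simp
  rcases abs_cases (c 0 - d 0) with h0 | h0 <;> rcases abs_cases (c 1 - d 1) with h1 | h1 <;>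
    rcases abs_cases (c 2 - d 2) with h2 | h2 <;> omega

/-! ### The size and the shape of minimal polyominoes -/

/-- Every two cells of `P` are joined inside `P` by a shortest path. -/
def Geodesic (P : Finset Cell) : Prop :=
  ∀ u ∈ P, ∀ v ∈ P, u ≠ v →
    ∃ i, (u i < v i ∧ u + Pi.single i 1 ∈ P) ∨ (v i < u i ∧ u - Pi.single i 1 ∈ P)

/-- Of the four parts into which two cutting planes in different directions divide `P`,
at least one is empty. -/
def Laminar (P : Finset Cell) : Prop :=
  ∀ i j, i ≠ j → ∀ a b : ℤ, ∀ w ∈ P, ∀ x ∈ P, ∀ y ∈ P, ∀ z ∈ P,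
    w i ≤ a → w j ≤ b → x i ≤ a → b < x j → a < y i → y j ≤ b → a < z i → b < z j → False

/-- The number of cells of a minimal polyomino inscribed in the box `[lo, hi]`. -/
def span (lo hi : Cell) : ℤ := ∑ i, (hi i - lo i) + 1

theorem span_single (c : Cell) : span c c = 1 := by simp [span]

theorem exists_box {P : Finset Cell} (h : (cellGraph.induce (P : Set Cell)).Connected) :
    ∃ lo hi, Inscribed lo hi P := by
  have hne : P.Nonempty := by
    obtain ⟨⟨x, hx⟩⟩ := h.nonempty
    exact ⟨x, hx⟩
  choose f hf hf' using fun i : Fin 3 => P.exists_min_image (fun c => c i) hne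
  choose g hg hg' using fun i : Fin 3 => P.exists_max_image (fun c => c i) hne
  exact ⟨fun i => f i i, fun i => g i i, fun c hc => ⟨fun i => hf' i c hc, fun i => hg' i c hc⟩, h,
    fun i => ⟨f i, hf i, rfl⟩, fun i => ⟨g i, hg i, rfl⟩⟩

theorem Inscribed.lo_le {lo hi : Cell} {P : Finset Cell} (h : Inscribed lo hi P) {c : Cell}
    (hc : c ∈ P) (i : Fin 3) : lo i ≤ c i := (h.subset c hc).1 i

theorem Inscribed.le_hi {lo hi : Cell} {P : Finset Cell} (h : Inscribed lo hi P) {c : Cell}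
    (hc : c ∈ P) (i : Fin 3) : c i ≤ hi i := (h.subset c hc).2 i

theorem Inscribed.le {lo hi : Cell} {P : Finset Cell} (h : Inscribed lo hi P) : lo ≤ hi := by
  obtain ⟨c, hc, -⟩ := h.touches_lo 0
  exact (h.subset c hc).1.trans (h.subset c hc).2

/-- A finite connected graph has a vertex that does not separate it, for instance a leaf of a
spanning tree. This is what permits induction on the number of cells. -/
theorem exists_erase_connected {P : Finset Cell}
    (h : (cellGraph.induce (P : Set Cell)).Connected) (hP : 2 ≤ P.card) :
    ∃ v ∈ P, (cellGraph.induce (P.erase v : Set Cell)).Connected ∧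
      ∃ w ∈ P.erase v, cellGraph.Adj w v := by
  have : Nontrivial (P : Set Cell) := by
    rw [Set.nontrivial_coe_sort]
    exact Finset.one_lt_card_iff_nontrivial.mp hP
  obtain ⟨⟨v, hv⟩, hc⟩ := h.exists_connected_induce_compl_singleton_of_finite_nontrivial
  refine ⟨v, hv, ?_, ?_⟩
  · refine hc.map ⟨fun x => ⟨x.1.1, ?_⟩, ?_⟩ ?_
    · have h1 : x.1 ≠ ⟨v, hv⟩ := x.2
      have h2 := x.1.2
      simp only [Finset.coe_erase, Set.mem_sdiff, Set.mem_singleton_iff]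
      exact ⟨h2, fun h3 => h1 (Subtype.ext h3)⟩
    · intro a b hab
      exact hab
    · rintro ⟨x, hx⟩
      simp only [Finset.coe_erase, Set.mem_sdiff, Set.mem_singleton_iff] at hx
      exact ⟨⟨⟨x, hx.1⟩, fun h3 => hx.2 (congrArg Subtype.val h3)⟩, rfl⟩
  · obtain ⟨⟨w, hw⟩, hvw⟩ := h.preconnected.exists_adj_of_nontrivial ⟨v, hv⟩
    have hvw : cellGraph.Adj v w := hvw
    exact ⟨w, Finset.mem_erase.mpr ⟨hvw.ne', hw⟩, hvw.symm⟩

/-- All of `P` is on the near side of `w`, so the step from `v` to `w` approaches every cell of `P`.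
Conversely a step towards `w` is also a step towards `v`, which differs from `w` only by lying
further out in direction `i`. -/
theorem Geodesic.insert {P : Finset Cell} (hP : Geodesic P) {v w : Cell} (hw : w ∈ P) (i : Fin 3)
    (h : (v = w + Pi.single i 1 ∧ ∀ d ∈ P, d i ≤ w i) ∨
      (v = w - Pi.single i 1 ∧ ∀ d ∈ P, w i ≤ d i)) : Geodesic (insert v P) := by
  intro x hx y hy hxy
  rw [Finset.mem_insert] at hx hy
  rcases hx with rfl | hx <;> rcases hy with rfl | hy
  · exact absurd rfl hxy
  · refine ⟨i, ?_⟩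
    rcases h with ⟨rfl, h⟩ | ⟨rfl, h⟩
    · right
      have := h y hy
      simp only [Pi.add_apply, Pi.single_eq_same, add_sub_cancel_right]
      exact ⟨by omega, Finset.mem_insert_of_mem hw⟩
    · left
      have := h y hy
      simp only [Pi.sub_apply, Pi.single_eq_same, sub_add_cancel]
      exact ⟨by omega, Finset.mem_insert_of_mem hw⟩
  · by_cases hxw : x = w
    · subst hxw
      refine ⟨i, ?_⟩
      rcases h with ⟨rfl, h⟩ | ⟨rfl, h⟩
      · left; simp
      · right; simp
    · obtain ⟨j, hj⟩ := hP x hx w hw hxw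
      refine ⟨j, ?_⟩
      have h1 : y j = w j ∨ j = i := by
        rcases h with ⟨rfl, h⟩ | ⟨rfl, h⟩ <;> by_cases hji : j = i <;> simp [hji]
      rcases h1 with h1 | rfl
      · rw [h1]
        rcases hj with hj | hj
        · exact Or.inl ⟨hj.1, Finset.mem_insert_of_mem hj.2⟩
        · exact Or.inr ⟨hj.1, Finset.mem_insert_of_mem hj.2⟩
      · rcases h with ⟨rfl, h⟩ | ⟨rfl, h⟩ <;> have := h x hx <;> rcases hj with hj | hj
        · exact Or.inl ⟨by simp; omega, Finset.mem_insert_of_mem hj.2⟩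
        · omega
        · omega
        · exact Or.inr ⟨by simp; omega, Finset.mem_insert_of_mem hj.2⟩
  · obtain ⟨j, hj⟩ := hP x hx y hy hxy
    refine ⟨j, ?_⟩
    rcases hj with hj | hj
    · exact Or.inl ⟨hj.1, Finset.mem_insert_of_mem hj.2⟩
    · exact Or.inr ⟨hj.1, Finset.mem_insert_of_mem hj.2⟩

/-- If the plane perpendicular to `k` does not separate `v` from `w`, replacing `v` by `w` keeps
every cell in its quadrant. If it does, `v` is alone on its side and cannot occupy the two quadrants
there. -/
theorem Laminar.insert {P : Finset Cell} (hP : Laminar P) {v w : Cell} (hw : w ∈ P) (k : Fin 3)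
    (h : (v = w + Pi.single k 1 ∧ ∀ d ∈ P, d k ≤ w k) ∨
      (v = w - Pi.single k 1 ∧ ∀ d ∈ P, w k ≤ d k)) : Laminar (Insert.insert v P) := by
  have hvj : ∀ j, j ≠ k → w j = v j := by
    intro j hj
    rcases h with ⟨rfl, h⟩ | ⟨rfl, h⟩ <;> simp [hj]
  have hvk : (v k = w k + 1 ∧ ∀ d ∈ P, d k ≤ w k) ∨ (v k = w k - 1 ∧ ∀ d ∈ P, w k ≤ d k) := by
    rcases h with ⟨rfl, h⟩ | ⟨rfl, h⟩
    · left; simpa using h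
    · right; simpa using h
  have rep : ∀ x ∈ Insert.insert v P, ∃ x' ∈ P, (∀ j, j ≠ k → x' j = x j) ∧
      (x' k = x k ∨ (x = v ∧ x' = w)) := by
    intro x hx
    rcases Finset.mem_insert.mp hx with rfl | hx
    · exact ⟨w, hw, hvj, Or.inr ⟨rfl, rfl⟩⟩
    · exact ⟨x, hx, fun _ _ => rfl, Or.inl rfl⟩
  have main : ∀ j, j ≠ k → ∀ a b : ℤ, ∀ x1 ∈ Insert.insert v P, ∀ x2 ∈ Insert.insert v P,
      ∀ x3 ∈ Insert.insert v P, ∀ x4 ∈ Insert.insert v P,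
      x1 k ≤ a → x1 j ≤ b → x2 k ≤ a → b < x2 j → a < x3 k → x3 j ≤ b → a < x4 k →
      b < x4 j → False := by
    intro j hj a b x1 h1 x2 h2 x3 h3 x4 h4 a1 b1 a2 b2 a3 b3 a4 b4
    have big : ∀ x ∈ Insert.insert v P, x = v ∨ x ∈ P := fun x hx => Finset.mem_insert.mp hx
    by_cases hc : (v k ≤ a ↔ w k ≤ a)
    · obtain ⟨y1, g1, f1, e1⟩ := rep x1 h1
      obtain ⟨y2, g2, f2, e2⟩ := rep x2 h2
      obtain ⟨y3, g3, f3, e3⟩ := rep x3 h3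
      obtain ⟨y4, g4, f4, e4⟩ := rep x4 h4
      refine hP k j hj.symm a b y1 g1 y2 g2 y3 g3 y4 g4 ?_ ?_ ?_ ?_ ?_ ?_ ?_ ?_
      · rcases e1 with e | ⟨rfl, rfl⟩ <;> omega
      · rw [f1 j hj]; exact b1
      · rcases e2 with e | ⟨rfl, rfl⟩ <;> omega
      · rw [f2 j hj]; exact b2
      · rcases e3 with e | ⟨rfl, rfl⟩ <;> omega
      · rw [f3 j hj]; exact b3
      · rcases e4 with e | ⟨rfl, rfl⟩ <;> omega
      · rw [f4 j hj]; exact b4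
    · rcases hvk with ⟨e, hm⟩ | ⟨e, hm⟩
      · have l3 : x3 = v := (big x3 h3).resolve_right fun g => by have := hm x3 g; omega
        have l4 : x4 = v := (big x4 h4).resolve_right fun g => by have := hm x4 g; omega
        subst l3; subst l4; omega
      · have l3 : x1 = v := (big x1 h1).resolve_right fun g => by have := hm x1 g; omega
        have l4 : x2 = v := (big x2 h2).resolve_right fun g => by have := hm x2 g; omega
        subst l3; subst l4; omega
  intro i j hij a b x1 h1 x2 h2 x3 h3 x4 h4 a1 b1 a2 b2 a3 b3 a4 b4
  by_cases hi : i = k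
  · subst hi
    exact main j hij.symm a b x1 h1 x2 h2 x3 h3 x4 h4 a1 b1 a2 b2 a3 b3 a4 b4
  by_cases hj : j = k
  · subst hj
    exact main i hi b a x1 h1 x3 h3 x2 h2 x4 h4 b1 a1 b3 a3 b2 a2 b4 a4
  obtain ⟨y1, g1, f1, -⟩ := rep x1 h1
  obtain ⟨y2, g2, f2, -⟩ := rep x2 h2
  obtain ⟨y3, g3, f3, -⟩ := rep x3 h3
  obtain ⟨y4, g4, f4, -⟩ := rep x4 h4
  rw [← f1 i hi] at a1
  rw [← f1 j hj] at b1
  rw [← f2 i hi] at a2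
  rw [← f2 j hj] at b2
  rw [← f3 i hi] at a3
  rw [← f3 j hj] at b3
  rw [← f4 i hi] at a4
  rw [← f4 j hj] at b4
  exact hP i j hij a b y1 g1 y2 g2 y3 g3 y4 g4 a1 b1 a2 b2 a3 b3 a4 b4

/-- Remove a cell `v` that does not separate `P` and is adjacent to a remaining cell `w`. The
bounding box shrinks only in the direction `k` of the step from `w` to `v`, and by at most one. When
the bound is attained, the box must shrink by exactly one, so `v` lies beyond all other cells in
direction `k`, and the rest attains the bound too. -/
theorem Inscribed.structure_aux (n : ℕ) : ∀ (P : Finset Cell) (lo hi : Cell), P.card = n →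
    Inscribed lo hi P → span lo hi ≤ n ∧ (span lo hi = n → Geodesic P ∧ Laminar P) := by
  induction n with
  | zero =>
    intro P lo hi hn h
    obtain ⟨c, hc, -⟩ := h.touches_lo 0
    rw [Finset.card_eq_zero.mp hn] at hc
    exact absurd hc (Finset.notMem_empty c)
  | succ n ih =>
    intro P lo hi hn h
    rcases Nat.eq_zero_or_pos n with rfl | hpos
    · obtain ⟨c, rfl⟩ := Finset.card_eq_one.mp hn
      have e1 : lo = c := by
        funext i
        obtain ⟨d, hd, e⟩ := h.touches_lo i
        rw [Finset.mem_singleton.mp hd] at e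
        exact e.symm
      have e2 : hi = c := by
        funext i
        obtain ⟨d, hd, e⟩ := h.touches_hi i
        rw [Finset.mem_singleton.mp hd] at e
        exact e.symm
      subst e1; subst e2
      refine ⟨by simp [span_single], fun _ => ⟨?_, ?_⟩⟩
      · intro u hu v hv huv
        rw [Finset.mem_singleton] at hu hv
        exact absurd (hu.trans hv.symm) huv
      · intro i j _ a b w hw x hx y hy z hz h1 h2 h3 h4
        rw [Finset.mem_singleton] at hw hx
        subst hw; subst hx
        omega
    · obtain ⟨v, hv, hc, w, hw, hadj⟩ := exists_erase_connected h.connected (by omega)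
      have hc' : (cellGraph.induce ((P.erase v : Finset Cell) : Set Cell)).Connected := hc
      obtain ⟨lo', hi', h'⟩ := exists_box hc'
      have hcard : (P.erase v).card = n := by rw [Finset.card_erase_of_mem hv]; omega
      obtain ⟨ih1, ih2⟩ := ih _ lo' hi' hcard h'
      have hP : Insert.insert v (P.erase v) = P := Finset.insert_erase hv
      have mem : ∀ c ∈ P, c = v ∨ c ∈ P.erase v := fun c hc => by
        rwa [← Finset.mem_insert, hP]
      have sub : ∀ c ∈ P.erase v, c ∈ P := fun c hc => Finset.mem_of_mem_erase hc
      have lo_le : ∀ i, lo i ≤ lo' i ∧ lo i ≤ v i ∧ (lo i = lo' i ∨ lo i = v i) := by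
        intro i
        obtain ⟨d, hd, e⟩ := h'.touches_lo i
        obtain ⟨d', hd', e'⟩ := h.touches_lo i
        have := h.lo_le (sub d hd) i
        have := h.lo_le hv i
        rcases mem d' hd' with rfl | hm
        · omega
        · have := h'.lo_le hm i
          omega
      have hi_le : ∀ i, hi' i ≤ hi i ∧ v i ≤ hi i ∧ (hi i = hi' i ∨ hi i = v i) := by
        intro i
        obtain ⟨d, hd, e⟩ := h'.touches_hi i
        obtain ⟨d', hd', e'⟩ := h.touches_hi i
        have := h.le_hi (sub d hd) i
        have := h.le_hi hv i
        rcases mem d' hd' with rfl | hm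
        · omega
        · have := h'.le_hi hm i
          omega
      obtain ⟨k, hk⟩ := (adj_iff w v).mp hadj
      have hj : ∀ j, j ≠ k → hi j = hi' j ∧ lo j = lo' j := by
        intro j hj
        have e : v j = w j := by rcases hk with rfl | rfl <;> simp [hj]
        have := lo_le j
        have := hi_le j
        have := h'.lo_le hw j
        have := h'.le_hi hw j
        omega
      have hspan : span lo hi - span lo' hi' = (hi k - lo k) - (hi' k - lo' k) := by
        rw [span, span, add_sub_add_right_eq_sub, ← Finset.sum_sub_distrib]
        refine (Finset.sum_eq_single k ?_ ?_)
        · intro j _ hjk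
          obtain ⟨e1, e2⟩ := hj j hjk
          omega
        · simp
      have := lo_le k
      have := hi_le k
      have := h'.lo_le hw k
      have := h'.le_hi hw k
      have ek : v k = w k + 1 ∨ v k = w k - 1 := by rcases hk with rfl | rfl <;> simp
      refine ⟨by push_cast; omega, fun heq => ?_⟩
      push_cast at heq
      obtain ⟨g1, g2⟩ := ih2 (by omega)
      -- The box really shrinks here, so `w` lies on the face of the smaller box from which `v`
      -- protrudes.
      have hyp : (v = w + Pi.single k 1 ∧ ∀ d ∈ P.erase v, d k ≤ w k) ∨
          (v = w - Pi.single k 1 ∧ ∀ d ∈ P.erase v, w k ≤ d k) := by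
        rcases hk with e | e
        · have : v k = w k + 1 := by simp [e]
          exact Or.inl ⟨e, fun d hd => by have := h'.le_hi hd k; omega⟩
        · have : v k = w k - 1 := by simp [e]
          exact Or.inr ⟨e, fun d hd => by have := h'.lo_le hd k; omega⟩
      rw [← hP]
      exact ⟨g1.insert hw k hyp, g2.insert hw k hyp⟩

theorem Inscribed.span_le {lo hi : Cell} {P : Finset Cell} (h : Inscribed lo hi P) :
    span lo hi ≤ P.card := (h.structure_aux _ P lo hi rfl).1

/-- Induction on the taxicab distance to `r`, which each of the given steps lowers by one. -/
theorem connected_of_root {P : Finset Cell} {r : Cell} (hr : r ∈ P)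
    (h : ∀ u ∈ P, u ≠ r →
      ∃ i, (u i < r i ∧ u + Pi.single i 1 ∈ P) ∨ (r i < u i ∧ u - Pi.single i 1 ∈ P)) :
    (cellGraph.induce (P : Set Cell)).Connected := by
  rw [SimpleGraph.connected_iff_exists_forall_reachable]
  refine ⟨⟨r, hr⟩, ?_⟩
  have main : ∀ (n : ℕ) (u : Cell) (hu : u ∈ P), ∑ i, |u i - r i| = n →
      (cellGraph.induce (P : Set Cell)).Reachable ⟨r, hr⟩ ⟨u, hu⟩ := by
    intro n
    induction n with
    | zero =>
      intro u hu h0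
      have : u = r := by
        funext i
        have := (Finset.sum_eq_zero_iff_of_nonneg (fun i _ => abs_nonneg (u i - r i))).mp
          (by exact_mod_cast h0) i (Finset.mem_univ i)
        have := abs_eq_zero.mp this
        omega
      subst this
      exact SimpleGraph.Reachable.refl _
    | succ n ih =>
      intro u hu hn
      have hne : u ≠ r := by
        rintro rfl
        simp at hn
        omega
      have step : ∀ (v : Cell) (hv : v ∈ P) (i : Fin 3), cellGraph.Adj v u →
          (∀ j, j ≠ i → v j = u j) → |v i - r i| = |u i - r i| - 1 →
          (cellGraph.induce (P : Set Cell)).Reachable ⟨r, hr⟩ ⟨u, hu⟩ := by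
        intro v hv i hadj hj hi
        have hsum : ∑ j, |v j - r j| = n := by
          have : ∑ j, |u j - r j| - ∑ j, |v j - r j| = 1 := by
            rw [← Finset.sum_sub_distrib, Finset.sum_eq_single i]
            · rw [hi]; ring
            · intro j _ hji
              rw [hj j hji, sub_self]
            · simp
          push_cast at hn
          omega
        refine (ih v hv hsum).trans (SimpleGraph.Adj.reachable ?_)
        exact hadj
      obtain ⟨i, ⟨h1, h2⟩ | ⟨h1, h2⟩⟩ := h u hu hne
      · refine step _ h2 i (((adj_iff _ _).mpr ⟨i, Or.inl rfl⟩).symm) (fun j hj => by simp [hj]) ?_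
        simp only [Pi.add_apply, Pi.single_eq_same]
        rw [abs_of_nonpos (by omega), abs_of_neg (by omega)]
        ring
      · refine step _ h2 i (((adj_iff _ _).mpr ⟨i, Or.inr rfl⟩).symm) (fun j hj => by simp [hj]) ?_
        simp only [Pi.sub_apply, Pi.single_eq_same]
        rw [abs_of_nonneg (by omega), abs_of_pos (by omega)]
        ring
  intro ⟨u, hu⟩
  refine main (∑ i, |u i - r i|).toNat u hu ?_
  rw [Int.toNat_of_nonneg (Finset.sum_nonneg fun i _ => abs_nonneg _)]

/-- An inscribed polyomino with the least possible number of cells. -/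
def Tight (lo hi : Cell) (P : Finset Cell) : Prop :=
  Inscribed lo hi P ∧ (P.card : ℤ) ≤ span lo hi

theorem Tight.card {lo hi : Cell} {P : Finset Cell} (h : Tight lo hi P) :
    (P.card : ℤ) = span lo hi := le_antisymm h.2 h.1.span_le

theorem Tight.geodesic {lo hi : Cell} {P : Finset Cell} (h : Tight lo hi P) : Geodesic P :=
  ((h.1.structure_aux _ P lo hi rfl).2 h.card.symm).1

theorem Tight.laminar {lo hi : Cell} {P : Finset Cell} (h : Tight lo hi P) : Laminar P :=
  ((h.1.structure_aux _ P lo hi rfl).2 h.card.symm).2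

theorem Tight.minimalInscribed {lo hi : Cell} {P : Finset Cell} (h : Tight lo hi P) :
    MinimalInscribed lo hi P :=
  ⟨h.1, fun Q hQ => by have := h.card; have := hQ.span_le; omega⟩

/-- Two tight polyominoes that share a cell and extend in disjoint sets of unit steps. -/
theorem Tight.union {lo₁ hi₁ lo₂ hi₂ lo hi c : Cell} {P Q : Finset Cell} (hP : Tight lo₁ hi₁ P)
    (hQ : Tight lo₂ hi₂ Q) (cP : c ∈ P) (cQ : c ∈ Q)
    (h : ∀ i, lo i = min (lo₁ i) (lo₂ i) ∧ hi i = max (hi₁ i) (hi₂ i) ∧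
      hi i - lo i = (hi₁ i - lo₁ i) + (hi₂ i - lo₂ i)) : Tight lo hi (P ∪ Q) := by
  refine ⟨⟨?_, ?_, ?_, ?_⟩, ?_⟩
  · intro d hd
    refine ⟨fun i => (?_ : lo i ≤ d i), fun i => (?_ : d i ≤ hi i)⟩ <;>
    · have := h i
      rcases Finset.mem_union.mp hd with hd | hd
      · have := hP.1.lo_le hd i
        have := hP.1.le_hi hd i
        omega
      · have := hQ.1.lo_le hd i
        have := hQ.1.le_hi hd i
        omega
  · rw [Finset.coe_union]
    exact SimpleGraph.induce_union_connected hP.1.connected.preconnected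
      hQ.1.connected.preconnected ⟨c, cP, cQ⟩
  · intro i
    rcases le_total (lo₁ i) (lo₂ i) with e | e <;> have := h i
    · obtain ⟨d, hd, hd'⟩ := hP.1.touches_lo i
      exact ⟨d, Finset.mem_union_left _ hd, by omega⟩
    · obtain ⟨d, hd, hd'⟩ := hQ.1.touches_lo i
      exact ⟨d, Finset.mem_union_right _ hd, by omega⟩
  · intro i
    rcases le_total (hi₁ i) (hi₂ i) with e | e <;> have := h i
    · obtain ⟨d, hd, hd'⟩ := hQ.1.touches_hi i
      exact ⟨d, Finset.mem_union_right _ hd, by omega⟩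
    · obtain ⟨d, hd, hd'⟩ := hP.1.touches_hi i
      exact ⟨d, Finset.mem_union_left _ hd, by omega⟩
  · have h1 := Finset.card_union_add_card_inter P Q
    -- The common cell is counted twice; this offsets the extra summand one in the two spans.
    have h2 : 1 ≤ (P ∩ Q).card := Finset.card_pos.mpr ⟨c, Finset.mem_inter.mpr ⟨cP, cQ⟩⟩
    have h3 := hP.card
    have h4 := hQ.card
    have h5 : span lo hi = span lo₁ hi₁ + span lo₂ hi₂ - 1 := by
      have : ∀ i, hi i - lo i = (hi₁ i - lo₁ i) + (hi₂ i - lo₂ i) := fun i => (h i).2.2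
      simp only [span, this, Finset.sum_add_distrib]
      ring
    omega

/-! ### Rows and crosses: the lower bound is attained -/

/-- The row of cells through `c` in direction `i`, inside the box `[lo, hi]`. -/
noncomputable def row (lo hi c : Cell) (i : Fin 3) : Finset Cell :=
  Finset.Icc (Function.update c i (lo i)) (Function.update c i (hi i))

theorem mem_row {lo hi c d : Cell} {i : Fin 3} :
    d ∈ row lo hi c i ↔ lo i ≤ d i ∧ d i ≤ hi i ∧ ∀ j, j ≠ i → d j = c j := by
  rw [row, Finset.mem_Icc, Pi.le_def, Pi.le_def]
  constructor
  · rintro ⟨h1, h2⟩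
    refine ⟨by simpa using h1 i, by simpa using h2 i, fun j hj => ?_⟩
    have h1 := h1 j
    have h2 := h2 j
    simp only [Function.update_of_ne hj] at h1 h2
    omega
  · rintro ⟨h1, h2, h3⟩
    refine ⟨fun j => ?_, fun j => ?_⟩ <;> by_cases hj : j = i
    · subst hj; simpa using h1
    · simp [hj, h3 j hj]
    · subst hj; simpa using h2
    · simp [hj, h3 j hj]

theorem tight_row {lo hi c : Cell} (h : lo ≤ hi) (i : Fin 3) :
    Tight (Function.update c i (lo i)) (Function.update c i (hi i)) (row lo hi c i) := by
  have hi1 : lo i ≤ hi i := h i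
  have r1 : Function.update c i (lo i) ∈ row lo hi c i :=
    mem_row.mpr ⟨by simp, by simpa using hi1, fun j hj => by simp [hj]⟩
  have r2 : Function.update c i (hi i) ∈ row lo hi c i :=
    mem_row.mpr ⟨by simpa using hi1, by simp, fun j hj => by simp [hj]⟩
  refine ⟨⟨fun d hd => Finset.mem_Icc.mp hd, ?_, fun j => ⟨_, r1, rfl⟩, fun j => ⟨_, r2, rfl⟩⟩, ?_⟩
  · refine connected_of_root r1 fun u hu hne => ⟨i, Or.inr ?_⟩
    obtain ⟨h1, h2, h3⟩ := mem_row.mp hu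
    have h4 : lo i < u i := by
      refine lt_of_le_of_ne h1 fun h4 => hne (funext fun j => ?_)
      by_cases hj : j = i
      · subst hj; simp [h4]
      · simp [hj, h3 j hj]
    refine ⟨by simpa using h4, mem_row.mpr ⟨by simp; omega, by simp; omega, fun j hj => ?_⟩⟩
    simp [hj, h3 j hj]
  · have e : span (Function.update c i (lo i)) (Function.update c i (hi i)) = hi i - lo i + 1 := by
      rw [span, Finset.sum_eq_single i]
      · simp
      · intro j _ hj
        simp [hj]
      · simp
    rw [e, row, Pi.card_Icc, Finset.prod_eq_single i]
    · simp only [Function.update_self, Int.card_Icc]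
      rw [Int.toNat_of_nonneg (by omega)]
      omega
    · intro j _ hj
      simp [hj]
    · simp

theorem self_mem_row {lo hi c : Cell} (h : c ∈ Set.Icc lo hi) (i : Fin 3) : c ∈ row lo hi c i :=
  mem_row.mpr ⟨h.1 i, h.2 i, fun _ _ => rfl⟩

theorem tight_row_union_row {lo hi c : Cell} (h : c ∈ Set.Icc lo hi) {i j : Fin 3} (hij : i ≠ j) :
    Tight (Function.update (Function.update c i (lo i)) j (lo j))
      (Function.update (Function.update c i (hi i)) j (hi j)) (row lo hi c i ∪ row lo hi c j) := by
  have hle : lo ≤ hi := h.1.trans h.2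
  refine (tight_row hle i).union (tight_row hle j) (self_mem_row h i) (self_mem_row h j)
    fun k => ?_
  have h1 : lo k ≤ c k := h.1 k
  have h2 : c k ≤ hi k := h.2 k
  by_cases hkj : k = j
  · subst hkj
    simp only [Function.update_self, Function.update_of_ne hij.symm]
    omega
  · by_cases hki : k = i
    · subst hki
      simp only [Function.update_self, Function.update_of_ne hkj]
      omega
    · simp only [Function.update_of_ne hkj, Function.update_of_ne hki]
      omega

/-- The rows are glued at `c` one after another, each extending the box in a new direction. Every
box thus contains an inscribed polyomino with exactly `span lo hi` cells. -/
theorem tight_cross {lo hi c : Cell} (h : c ∈ Set.Icc lo hi) {a i j : Fin 3} (hai : a ≠ i)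
    (haj : a ≠ j) (hij : i ≠ j) :
    Tight lo hi (row lo hi c i ∪ row lo hi c j ∪ row lo hi c a) := by
  have hle : lo ≤ hi := h.1.trans h.2
  refine (tight_row_union_row h hij).union (tight_row hle a)
    (Finset.mem_union_left _ (self_mem_row h i)) (self_mem_row h a) fun k => ?_
  have h1 : lo k ≤ c k := h.1 k
  have h2 : c k ≤ hi k := h.2 k
  by_cases hka : k = a
  · subst hka
    simp only [Function.update_self, Function.update_of_ne hai, Function.update_of_ne haj]
    omega
  · by_cases hkj : k = j
    · subst hkj
      simp only [Function.update_self, Function.update_of_ne hka]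
      omega
    · have hki : k = i := by omega
      subst hki
      simp only [Function.update_self, Function.update_of_ne hka, Function.update_of_ne hkj]
      omega

/-- Comparison with the cross through the corner `lo` bounds the size of a minimal polyomino from
above; `Inscribed.span_le` bounds that of any competitor from below. -/
theorem minimalInscribed_iff {lo hi : Cell} {P : Finset Cell} :
    MinimalInscribed lo hi P ↔ Tight lo hi P := by
  refine ⟨fun h => ⟨h.1, ?_⟩, Tight.minimalInscribed⟩
  have h1 := tight_cross (Set.left_mem_Icc.mpr h.1.le)
    (by decide : (2 : Fin 3) ≠ 0) (by decide : (2 : Fin 3) ≠ 1) (by decide)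
  have := h.2 _ h1.1
  have := h1.card
  omega

/-! ### Reflections -/

/-- The map that reverses the coordinates `i` with `ε i = true`, by `c i ↦ τ i - c i`. -/
def mirror (τ : Cell) (ε : Fin 3 → Bool) (c : Cell) : Cell :=
  fun i => if ε i then τ i - c i else c i

theorem reflect_eq_mirror (s : Fin 3 → ℕ) (ε : Fin 3 → Bool) : reflect s ε = mirror (top s) ε := rfl

theorem mirror_mirror (τ : Cell) (ε : Fin 3 → Bool) (c : Cell) : mirror τ ε (mirror τ ε c) = c := by
  funext i
  simp only [mirror]
  split_ifs <;> omega

theorem mirror_injective (τ : Cell) (ε : Fin 3 → Bool) : Function.Injective (mirror τ ε) :=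
  (show Function.Involutive (mirror τ ε) from mirror_mirror τ ε).injective

theorem adj_mirror (τ : Cell) (ε : Fin 3 → Bool) (c d : Cell) :
    cellGraph.Adj (mirror τ ε c) (mirror τ ε d) ↔ cellGraph.Adj c d := by
  change ∑ i, |mirror τ ε c i - mirror τ ε d i| = 1 ↔ ∑ i, |c i - d i| = 1
  have : ∀ i, |mirror τ ε c i - mirror τ ε d i| = |c i - d i| := by
    intro i
    simp only [mirror]
    split_ifs
    · rw [abs_sub_comm]
      congr 1
      ring
    · rfl
  simp only [this]

/-- The image of a set of cells under `mirror`. -/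
def mirrorSet (τ : Cell) (ε : Fin 3 → Bool) (P : Finset Cell) : Finset Cell :=
  P.image (mirror τ ε)

theorem mem_mirrorSet {τ : Cell} {ε : Fin 3 → Bool} {P : Finset Cell} {c : Cell} :
    c ∈ mirrorSet τ ε P ↔ mirror τ ε c ∈ P := by
  rw [mirrorSet, Finset.mem_image]
  constructor
  · rintro ⟨d, hd, rfl⟩
    rwa [mirror_mirror]
  · exact fun h => ⟨_, h, mirror_mirror τ ε c⟩

theorem mirror_mem_mirrorSet {τ : Cell} {ε : Fin 3 → Bool} {P : Finset Cell} {c : Cell} :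
    mirror τ ε c ∈ mirrorSet τ ε P ↔ c ∈ P := by
  rw [mem_mirrorSet, mirror_mirror]

theorem mirrorSet_mirrorSet (τ : Cell) (ε : Fin 3 → Bool) (P : Finset Cell) :
    mirrorSet τ ε (mirrorSet τ ε P) = P := by
  ext c
  rw [mem_mirrorSet, mirror_mem_mirrorSet]

theorem degree_mirrorSet (τ : Cell) (ε : Fin 3 → Bool) (P : Finset Cell) (c : Cell) :
    degree (mirrorSet τ ε P) (mirror τ ε c) = degree P c := by
  rw [degree, degree, mirrorSet, Finset.filter_image, Finset.card_image_of_injective _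
    (mirror_injective τ ε)]
  simp only [adj_mirror]

theorem Tight.mirror {lo hi lo' hi' : Cell} {P : Finset Cell} (h : Tight lo hi P) (τ : Cell)
    (ε : Fin 3 → Bool) (hb : ∀ i, (ε i = true ∧ lo' i = τ i - hi i ∧ hi' i = τ i - lo i) ∨
      (ε i = false ∧ lo' i = lo i ∧ hi' i = hi i)) :
    Tight lo' hi' (mirrorSet τ ε P) := by
  refine ⟨⟨?_, ?_, ?_, ?_⟩, ?_⟩
  · intro c hc
    rw [mem_mirrorSet] at hc
    refine ⟨fun i => (?_ : lo' i ≤ c i), fun i => (?_ : c i ≤ hi' i)⟩ <;>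
    · have h1 := h.1.lo_le hc i
      have h2 := h.1.le_hi hc i
      simp only [Polycube.mirror] at h1 h2
      rcases hb i with ⟨e, e1, e2⟩ | ⟨e, e1, e2⟩ <;> simp only [e, if_true, Bool.false_eq_true,
        if_false] at h1 h2 <;> omega
  · refine h.1.connected.map ⟨fun x => ⟨Polycube.mirror τ ε x.1, ?_⟩, ?_⟩ ?_
    · exact mirror_mem_mirrorSet.mpr x.2
    · intro a b hab
      exact (adj_mirror τ ε a.1 b.1).mpr hab
    · rintro ⟨x, hx⟩
      exact ⟨⟨Polycube.mirror τ ε x, mem_mirrorSet.mp hx⟩, Subtype.ext (mirror_mirror τ ε x)⟩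
  · intro i
    rcases hb i with ⟨e, e1, e2⟩ | ⟨e, e1, e2⟩
    · obtain ⟨d, hd, hd'⟩ := h.1.touches_hi i
      exact ⟨Polycube.mirror τ ε d, mirror_mem_mirrorSet.mpr hd, by simp [Polycube.mirror, e]; omega⟩
    · obtain ⟨d, hd, hd'⟩ := h.1.touches_lo i
      exact ⟨Polycube.mirror τ ε d, mirror_mem_mirrorSet.mpr hd, by simp [Polycube.mirror, e]; omega⟩
  · intro i
    rcases hb i with ⟨e, e1, e2⟩ | ⟨e, e1, e2⟩
    · obtain ⟨d, hd, hd'⟩ := h.1.touches_lo i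
      exact ⟨Polycube.mirror τ ε d, mirror_mem_mirrorSet.mpr hd, by simp [Polycube.mirror, e]; omega⟩
    · obtain ⟨d, hd, hd'⟩ := h.1.touches_hi i
      exact ⟨Polycube.mirror τ ε d, mirror_mem_mirrorSet.mpr hd, by simp [Polycube.mirror, e]; omega⟩
  · rw [mirrorSet, Finset.card_image_of_injective _ (mirror_injective τ ε), h.card, span, span]
    have : ∀ i, hi' i - lo' i = hi i - lo i := fun i => by have := hb i; omega
    simp only [this]
    exact le_refl _

theorem tight_mirrorSet_iff {lo hi lo' hi' : Cell} {P : Finset Cell} (τ : Cell)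
    (ε : Fin 3 → Bool) (hb : ∀ i, (ε i = true ∧ lo' i = τ i - hi i ∧ hi' i = τ i - lo i) ∨
      (ε i = false ∧ lo' i = lo i ∧ hi' i = hi i)) :
    Tight lo' hi' (mirrorSet τ ε P) ↔ Tight lo hi P := by
  refine ⟨fun h => ?_, fun h => h.mirror τ ε hb⟩
  rw [← mirrorSet_mirrorSet τ ε P]
  refine h.mirror τ ε fun i => ?_
  rcases hb i with ⟨e, e1, e2⟩ | ⟨e, e1, e2⟩
  · exact Or.inl ⟨e, by omega, by omega⟩
  · exact Or.inr ⟨e, e1.symm, e2.symm⟩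

theorem tight_mirrorSet_prism {T : Cell} {P : Finset Cell} (ε : Fin 3 → Bool) :
    Tight 0 T (mirrorSet T ε P) ↔ Tight 0 T P := by
  refine tight_mirrorSet_iff T ε fun i => ?_
  cases h : ε i <;> simp

/-! ### Corner cells and hooks -/

/-- `Laminar` prescribes the quadrant of each of the four cells. Here only their relative position
is given, and the four cases rename the cells accordingly. -/
theorem Laminar.exclude {P : Finset Cell} (hP : Laminar P) {i j : Fin 3} (hij : i ≠ j) (a b : ℤ)
    {w x y z : Cell} (hw : w ∈ P) (hx : x ∈ P) (hy : y ∈ P) (hz : z ∈ P)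
    (h1 : w i ≤ a ↔ x i ≤ a) (h2 : y i ≤ a ↔ z i ≤ a) (h3 : ¬(w i ≤ a ↔ y i ≤ a))
    (h4 : w j ≤ b ↔ y j ≤ b) (h5 : x j ≤ b ↔ z j ≤ b) (h6 : ¬(w j ≤ b ↔ x j ≤ b)) : False := by
  by_cases ha : w i ≤ a <;> by_cases hb : w j ≤ b
  · exact hP i j hij a b w hw x hx y hy z hz (by omega) (by omega) (by omega) (by omega)
      (by omega) (by omega) (by omega) (by omega)
  · exact hP i j hij a b x hx w hw z hz y hy (by omega) (by omega) (by omega) (by omega)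
      (by omega) (by omega) (by omega) (by omega)
  · exact hP i j hij a b y hy z hz w hw x hx (by omega) (by omega) (by omega) (by omega)
      (by omega) (by omega) (by omega) (by omega)
  · exact hP i j hij a b z hz y hy x hx w hw (by omega) (by omega) (by omega) (by omega)
      (by omega) (by omega) (by omega) (by omega)

/-- The neighbour in direction `i`, towards the interior of the box with lower end `lo`, of a
corner `v` of that box. -/
def inward (lo v : Cell) (i : Fin 3) : Cell :=
  if v i = lo i then v + Pi.single i 1 else v - Pi.single i 1

theorem inward_of_ne {lo v : Cell} {i j : Fin 3} (h : j ≠ i) : inward lo v i j = v j := by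
  rw [inward]
  split_ifs <;> simp [h]

theorem inward_self (lo v : Cell) (i : Fin 3) :
    inward lo v i i = if v i = lo i then v i + 1 else v i - 1 := by
  rw [inward]
  split_ifs <;> simp

theorem inward_lo (v : Cell) (i : Fin 3) : inward v v i = v + Pi.single i 1 := by simp [inward]

theorem inward_injective (lo v : Cell) : Function.Injective (inward lo v) := by
  intro i j h
  by_contra hij
  have h1 := congrFun h i
  rw [inward_self, inward_of_ne hij] at h1
  split_ifs at h1 <;> omega

/-- At a corner of the box at most one of the two neighbours in each direction can lie in the box,
and it is then the inward one. -/
theorem degree_eq {lo hi v : Cell} {P : Finset Cell} (h : ∀ c ∈ P, c ∈ Set.Icc lo hi)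
    (hv : IsVertex lo hi v) :
    degree P v = (Finset.univ.filter fun i => inward lo v i ∈ P).card := by
  rw [degree, ← Finset.card_image_of_injective _ (inward_injective lo v)]
  congr 1
  ext d
  simp only [Finset.mem_filter, Finset.mem_image, Finset.mem_univ, true_and]
  constructor
  · rintro ⟨hd, hadj⟩
    obtain ⟨i, hi'⟩ := (adj_iff v d).mp hadj
    have h1 : lo i ≤ d i := (h d hd).1 i
    have h2 : d i ≤ hi i := (h d hd).2 i
    have hvi := hv i
    have e : inward lo v i = d := by
      rw [inward]
      rcases hi' with rfl | rfl
      · simp only [Pi.add_apply, Pi.single_eq_same] at h1 h2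
        rw [if_pos (by omega)]
      · simp only [Pi.sub_apply, Pi.single_eq_same] at h1 h2
        rw [if_neg (by omega)]
    exact ⟨i, by rwa [e], e⟩
  · rintro ⟨i, hi', rfl⟩
    refine ⟨hi', (adj_iff _ _).mpr ⟨i, ?_⟩⟩
    rw [inward]
    split_ifs <;> simp

theorem two_le_degree_iff {lo hi v : Cell} {P : Finset Cell} (h : ∀ c ∈ P, c ∈ Set.Icc lo hi)
    (hv : IsVertex lo hi v) :
    2 ≤ degree P v ↔ ∃ i j, i ≠ j ∧ inward lo v i ∈ P ∧ inward lo v j ∈ P := by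
  rw [degree_eq h hv]
  constructor
  · intro h2
    obtain ⟨i, hi, j, hj, hij⟩ := Finset.one_lt_card.mp h2
    exact ⟨i, j, hij, (Finset.mem_filter.mp hi).2, (Finset.mem_filter.mp hj).2⟩
  · rintro ⟨i, j, hij, h1, h2⟩
    exact Finset.one_lt_card.mpr ⟨i, by simpa using h1, j, by simpa using h2, hij⟩

theorem degree_le_three {lo hi v : Cell} {P : Finset Cell} (h : ∀ c ∈ P, c ∈ Set.Icc lo hi)
    (hv : IsVertex lo hi v) : degree P v ≤ 3 := by
  rw [degree_eq h hv]
  exact (Finset.card_le_univ _).trans (by simp)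

theorem degree_eq_three_iff {lo hi v : Cell} {P : Finset Cell} (h : ∀ c ∈ P, c ∈ Set.Icc lo hi)
    (hv : IsVertex lo hi v) : degree P v = 3 ↔ ∀ i, inward lo v i ∈ P := by
  rw [degree_eq h hv]
  constructor
  · intro h3 i
    have := Finset.eq_univ_of_card (Finset.univ.filter fun i => inward lo v i ∈ P) (by simpa using h3)
    have hm := Finset.mem_univ i
    rw [← this] at hm
    exact (Finset.mem_filter.mp hm).2
  · intro h3
    rw [Finset.filter_true_of_mem fun i _ => h3 i]
    simp

theorem lt_of_inward_mem {lo hi v : Cell} {P : Finset Cell} (h : ∀ c ∈ P, c ∈ Set.Icc lo hi)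
    (hv : IsVertex lo hi v) {i : Fin 3} (hi' : inward lo v i ∈ P) : lo i < hi i := by
  have h1 : lo i ≤ inward lo v i i := (h _ hi').1 i
  have h2 : inward lo v i i ≤ hi i := (h _ hi').2 i
  have := hv i
  rw [inward_self] at h1 h2
  split_ifs at h1 h2 <;> omega

/-- If a corner cell has neighbours in two directions, every other cell agrees with the corner
in one of these directions. -/
theorem Laminar.corner {lo hi v : Cell} {P : Finset Cell} (hP : Laminar P)
    (h : ∀ c ∈ P, c ∈ Set.Icc lo hi) (hv : IsVertex lo hi v) (hvP : v ∈ P) {i j : Fin 3}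
    (hij : i ≠ j) (hi' : inward lo v i ∈ P) (hj' : inward lo v j ∈ P) {c : Cell} (hc : c ∈ P) :
    c i = v i ∨ c j = v j := by
  by_contra! hne
  have h1 : lo i ≤ c i := (h c hc).1 i
  have h2 : c i ≤ hi i := (h c hc).2 i
  have h3 : lo j ≤ c j := (h c hc).1 j
  have h4 : c j ≤ hi j := (h c hc).2 j
  have vi := hv i
  have vj := hv j
  have e1 := inward_self lo v i
  have e2 := inward_self lo v j
  have e3 := inward_of_ne (lo := lo) (v := v) hij
  have e4 := inward_of_ne (lo := lo) (v := v) hij.symm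
  -- The planes cut between the corner and its two neighbours, so that the corner, the neighbours
  -- and `c` would fill all four quadrants.
  refine hP.exclude hij (if v i = lo i then v i else v i - 1) (if v j = lo j then v j else v j - 1)
    hvP hj' hi' hc ?_ ?_ ?_ ?_ ?_ ?_ <;> split_ifs at * <;> omega

theorem Tight.eq_of_subset {lo hi : Cell} {P Q : Finset Cell} (hP : Tight lo hi P)
    (hQ : Tight lo hi Q) (h : P ⊆ Q) : P = Q :=
  Finset.eq_of_subset_of_card_le h (by have := hP.card; have := hQ.card; omega)

theorem IsVertex.mem_Icc {lo hi v : Cell} (hv : IsVertex lo hi v) (h : lo ≤ hi) :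
    v ∈ Set.Icc lo hi := by
  refine ⟨fun i => (?_ : lo i ≤ v i), fun i => (?_ : v i ≤ hi i)⟩ <;>
  · have := hv i
    have : lo i ≤ hi i := h i
    omega

theorem exists_other_two (a : Fin 3) : ∃ i j : Fin 3, a ≠ i ∧ a ≠ j ∧ i ≠ j := by
  fin_cases a
  · exact ⟨1, 2, by decide⟩
  · exact ⟨0, 2, by decide⟩
  · exact ⟨0, 1, by decide⟩

theorem tight_flat {lo hi c : Cell} (h : c ∈ Set.Icc lo hi) {a i j : Fin 3} (hai : a ≠ i)
    (haj : a ≠ j) (hij : i ≠ j) (ha : lo a = hi a) :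
    Tight lo hi (row lo hi c i ∪ row lo hi c j) := by
  have h1 : lo a ≤ c a := h.1 a
  have h2 : c a ≤ hi a := h.2 a
  convert tight_row_union_row h hij using 1 <;>
  · funext k
    by_cases hkj : k = j
    · subst hkj; simp
    · by_cases hki : k = i
      · subst hki; simp [hkj]
      · have : k = a := by omega
        subst this
        simp [hkj, hki]
        omega

theorem isTwoDHook_iff {lo hi v : Cell} {P : Finset Cell} (hle : lo ≤ hi) :
    IsTwoDHook lo hi v P ↔ IsVertex lo hi v ∧ ∃ a i j : Fin 3, a ≠ i ∧ a ≠ j ∧ i ≠ j ∧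
      lo a = hi a ∧ lo i < hi i ∧ lo j < hi j ∧ P = row lo hi v i ∪ row lo hi v j := by
  have key : ∀ a i j : Fin 3, a ≠ i → a ≠ j → i ≠ j → lo a = hi a → IsVertex lo hi v →
      ∀ c, c ∈ row lo hi v i ∪ row lo hi v j ↔
        c ∈ Set.Icc lo hi ∧ ∃ i, i ≠ a ∧ ∀ j, j ≠ i → c j = v j := by
    intro a i j hai haj hij ha hv c
    have hvI := hv.mem_Icc hle
    rw [Finset.mem_union, mem_row, mem_row]
    constructor
    · have aux : ∀ k, k ≠ a → lo k ≤ c k ∧ c k ≤ hi k ∧ (∀ l, l ≠ k → c l = v l) →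
          c ∈ Set.Icc lo hi ∧ ∃ i, i ≠ a ∧ ∀ j, j ≠ i → c j = v j := by
        rintro k hk ⟨h1, h2, h3⟩
        refine ⟨⟨fun l => ?_, fun l => ?_⟩, k, hk, h3⟩ <;> by_cases hl : l = k
        · subst hl; exact h1
        · rw [h3 l hl]; exact hvI.1 l
        · subst hl; exact h2
        · rw [h3 l hl]; exact hvI.2 l
      rintro (h | h)
      · exact aux i hai.symm h
      · exact aux j haj.symm h
    · rintro ⟨⟨h1, h2⟩, k, hk, h3⟩
      have : k = i ∨ k = j := by omega
      rcases this with rfl | rfl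
      · exact Or.inl ⟨h1 k, h2 k, h3⟩
      · exact Or.inr ⟨h1 k, h2 k, h3⟩
  constructor
  · rintro ⟨hv, a, ha, hlt, hP⟩
    obtain ⟨i, j, hai, haj, hij⟩ := exists_other_two a
    refine ⟨hv, a, i, j, hai, haj, hij, ha, hlt i hai.symm, hlt j haj.symm, ?_⟩
    ext c
    rw [hP, key a i j hai haj hij ha hv]
  · rintro ⟨hv, a, i, j, hai, haj, hij, ha, hi', hj', rfl⟩
    refine ⟨hv, a, ha, fun k hk => ?_, key a i j hai haj hij ha hv⟩
    have : k = i ∨ k = j := by omega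
    rcases this with rfl | rfl <;> assumption

theorem inward_mem_row {lo hi v : Cell} (hv : IsVertex lo hi v) {i : Fin 3} (h : lo i < hi i) :
    inward lo v i ∈ row lo hi v i := by
  have := hv i
  refine mem_row.mpr ⟨?_, ?_, fun j hj => inward_of_ne hj⟩ <;> rw [inward_self] <;> split_ifs <;>
    omega

theorem isCornerPoly_iff {lo hi v : Cell} {P : Finset Cell} :
    IsCornerPoly lo hi v P ↔ IsVertex lo hi v ∧ Tight lo hi P ∧ v ∈ P := by
  rw [IsCornerPoly, minimalInscribed_iff]

theorem IsTwoDHook.isCornerPoly {lo hi v : Cell} {P : Finset Cell} (hle : lo ≤ hi)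
    (h : IsTwoDHook lo hi v P) : IsCornerPoly lo hi v P ∧ 2 ≤ degree P v := by
  obtain ⟨hv, a, i, j, hai, haj, hij, ha, hi', hj', rfl⟩ := (isTwoDHook_iff hle).mp h
  have hvI := hv.mem_Icc hle
  have ht := tight_flat hvI hai haj hij ha
  refine ⟨isCornerPoly_iff.mpr ⟨hv, ht, Finset.mem_union_left _ (self_mem_row hvI i)⟩, ?_⟩
  exact (two_le_degree_iff ht.1.subset hv).mpr ⟨i, j, hij,
    Finset.mem_union_left _ (inward_mem_row hv hi'), Finset.mem_union_right _ (inward_mem_row hv hj')⟩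

/-- In a flat box, a corner-polyomino with corner of degree two consists of two rows. -/
theorem Tight.eq_rows_of_flat {lo hi v : Cell} {P : Finset Cell} (h : Tight lo hi P)
    (hv : IsVertex lo hi v) (hvP : v ∈ P) {a i j : Fin 3} (hai : a ≠ i) (haj : a ≠ j) (hij : i ≠ j)
    (ha : lo a = hi a) (hi' : inward lo v i ∈ P) (hj' : inward lo v j ∈ P) :
    P = row lo hi v i ∪ row lo hi v j := by
  have hvI := hv.mem_Icc h.1.le
  refine h.eq_of_subset (tight_flat hvI hai haj hij ha) fun c hc => ?_
  have h1 := h.laminar.corner h.1.subset hv hvP hij hi' hj' hc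
  have hca : c a = v a := by
    have := h.1.lo_le hc a
    have := h.1.le_hi hc a
    have := hv a
    omega
  rw [Finset.mem_union, mem_row, mem_row]
  rcases h1 with h1 | h1
  · refine Or.inr ⟨h.1.lo_le hc j, h.1.le_hi hc j, fun k hk => ?_⟩
    have : k = a ∨ k = i := by omega
    rcases this with rfl | rfl <;> assumption
  · refine Or.inl ⟨h.1.lo_le hc i, h.1.le_hi hc i, fun k hk => ?_⟩
    have : k = a ∨ k = j := by omega
    rcases this with rfl | rfl <;> assumption

/-- The three kinds of hook are one class. The degree of a corner is at most three, and three means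
a tripod. If the degree is two and the box is flat in some direction, both neighbours lie in the
other two directions, and laminarity leaves nothing but the two rows. -/
theorem isHook_iff {lo hi v : Cell} {P : Finset Cell} (hle : lo ≤ hi) :
    IsHook lo hi v P ↔ IsVertex lo hi v ∧ Tight lo hi P ∧ v ∈ P ∧ 2 ≤ degree P v := by
  constructor
  · intro h
    have : IsCornerPoly lo hi v P ∧ 2 ≤ degree P v := by
      rcases h with h | h | h
      · exact ⟨h.1, by rw [h.2]; omega⟩
      · exact ⟨h.2.1, h.2.2.ge⟩
      · exact h.isCornerPoly hle
    obtain ⟨h1, h2, h3⟩ := isCornerPoly_iff.mp this.1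
    exact ⟨h1, h2, h3, this.2⟩
  · rintro ⟨hv, ht, hvP, h2⟩
    have hc := isCornerPoly_iff.mpr ⟨hv, ht, hvP⟩
    by_cases h3 : degree P v = 3
    · exact Or.inl ⟨hc, h3⟩
    have hd : degree P v = 2 := by
      have := degree_le_three ht.1.subset hv
      omega
    by_cases hall : ∀ i, lo i < hi i
    · exact Or.inr (Or.inl ⟨hall, hc, hd⟩)
    · push Not at hall
      obtain ⟨a, ha⟩ := hall
      obtain ⟨i, j, hij, hi', hj'⟩ := (two_le_degree_iff ht.1.subset hv).mp h2
      have li := lt_of_inward_mem ht.1.subset hv hi'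
      have lj := lt_of_inward_mem ht.1.subset hv hj'
      have hai : a ≠ i := by rintro rfl; omega
      have haj : a ≠ j := by rintro rfl; omega
      have hle' : lo a ≤ hi a := hle a
      have ha' : lo a = hi a := le_antisymm hle' ha
      exact Or.inr (Or.inr ((isTwoDHook_iff hle).mpr ⟨hv, a, i, j, hai, haj, hij, ha', li, lj,
        ht.eq_rows_of_flat hv hvP hai haj hij ha' hi' hj'⟩))

/-! ### Central cells and diagonal polyominoes -/

/-- The cells of `P` that lie in the box `[lo, hi]`. -/
noncomputable def part (P : Finset Cell) (lo hi : Cell) : Finset Cell := by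
  classical exact P.filter (· ∈ Set.Icc lo hi)

theorem mem_part {P : Finset Cell} {lo hi c : Cell} :
    c ∈ part P lo hi ↔ c ∈ P ∧ lo ≤ c ∧ c ≤ hi := by
  simp [part]

/-- Boxes are convex for shortest paths: a step towards `c` moves one coordinate towards that of
`c`, which keeps it between the bounds. -/
theorem Geodesic.connected_part {P : Finset Cell} (hP : Geodesic P) {lo hi c : Cell}
    (hcP : c ∈ part P lo hi) : (cellGraph.induce (part P lo hi : Set Cell)).Connected := by
  obtain ⟨hc, hcb⟩ := mem_part.mp hcP
  refine connected_of_root hcP fun u hu hne => ?_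
  obtain ⟨hu, hub⟩ := mem_part.mp hu
  obtain ⟨i, hi'⟩ := hP u hu c hc hne
  refine ⟨i, ?_⟩
  have h1 : lo i ≤ c i := hcb.1 i
  have h2 : c i ≤ hi i := hcb.2 i
  rcases hi' with ⟨h, hm⟩ | ⟨h, hm⟩
  · refine Or.inl ⟨h, mem_part.mpr ⟨hm, fun j => ?_, fun j => ?_⟩⟩ <;>
    · have h3 : lo j ≤ u j := hub.1 j
      have h4 : u j ≤ hi j := hub.2 j
      by_cases hj : j = i
      · subst hj; simp; omega
      · simpa [hj]
  · refine Or.inr ⟨h, mem_part.mpr ⟨hm, fun j => ?_, fun j => ?_⟩⟩ <;>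
    · have h3 : lo j ≤ u j := hub.1 j
      have h4 : u j ≤ hi j := hub.2 j
      by_cases hj : j = i
      · subst hj; simp; omega
      · simpa [hj]

/-- A cell of `P` that is comparable with all cells of `P`. -/
def Central (P : Finset Cell) (c : Cell) : Prop := c ∈ P ∧ ∀ d ∈ P, d ≤ c ∨ c ≤ d

/-- A cell on a lower face of the box is either below `c` and thus in this part, or above `c`, and
then `c` itself lies on that face. -/
theorem Central.inscribed_lower {lo hi c : Cell} {P : Finset Cell} (h : Tight lo hi P)
    (hc : Central P c) : Inscribed lo c (part P lo c) := by
  have hm : c ∈ part P lo c := mem_part.mpr ⟨hc.1, (h.1.subset c hc.1).1, le_rfl⟩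
  refine ⟨fun d hd => (mem_part.mp hd).2, h.geodesic.connected_part hm, fun i => ?_,
    fun i => ⟨c, hm, rfl⟩⟩
  obtain ⟨d, hd, e⟩ := h.1.touches_lo i
  rcases hc.2 d hd with h1 | h1
  · exact ⟨d, mem_part.mpr ⟨hd, (h.1.subset d hd).1, h1⟩, e⟩
  · have h2 : c i ≤ d i := h1 i
    have h3 := h.1.lo_le hc.1 i
    exact ⟨c, hm, by omega⟩

theorem Central.inscribed_upper {lo hi c : Cell} {P : Finset Cell} (h : Tight lo hi P)
    (hc : Central P c) : Inscribed c hi (part P c hi) := by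
  have hm : c ∈ part P c hi := mem_part.mpr ⟨hc.1, le_rfl, (h.1.subset c hc.1).2⟩
  refine ⟨fun d hd => (mem_part.mp hd).2, h.geodesic.connected_part hm, fun i => ⟨c, hm, rfl⟩,
    fun i => ?_⟩
  obtain ⟨d, hd, e⟩ := h.1.touches_hi i
  rcases hc.2 d hd with h1 | h1
  · have h2 : d i ≤ c i := h1 i
    have h3 := h.1.le_hi hc.1 i
    exact ⟨c, hm, by omega⟩
  · exact ⟨d, mem_part.mpr ⟨hd, h1, (h.1.subset d hd).2⟩, e⟩

theorem span_add_span (lo c hi : Cell) : span lo c + span c hi = span lo hi + 1 := by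
  have : ∀ i, hi i - lo i = (c i - lo i) + (hi i - c i) := fun i => by ring
  simp only [span, this, Finset.sum_add_distrib]
  ring

/-- Both parts are inscribed in their boxes, which bounds their sizes from below. They share only
`c`, and their spans sum to `span lo hi + 1`, so neither bound has any slack. -/
theorem Central.tight {lo hi c : Cell} {P : Finset Cell} (h : Tight lo hi P) (hc : Central P c) :
    Tight lo c (part P lo c) ∧ Tight c hi (part P c hi) := by
  have h1 := Central.inscribed_lower h hc
  have h2 := Central.inscribed_upper h hc
  have h3 := Finset.card_union_add_card_inter (part P lo c) (part P c hi)
  have h4 : part P lo c ∪ part P c hi ⊆ P := by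
    intro d hd
    rcases Finset.mem_union.mp hd with hd | hd <;> exact (mem_part.mp hd).1
  have h5 : part P lo c ∩ part P c hi ⊆ {c} := by
    intro d hd
    obtain ⟨hd1, hd2⟩ := Finset.mem_inter.mp hd
    rw [Finset.mem_singleton]
    exact le_antisymm (mem_part.mp hd1).2.2 (mem_part.mp hd2).2.1
  have h6 := Finset.card_le_card h4
  have h7 := Finset.card_le_card h5
  rw [Finset.card_singleton] at h7
  have h8 := h.card
  have h9 := span_add_span lo c hi
  have := h1.span_le
  have := h2.span_le
  exact ⟨⟨h1, by omega⟩, ⟨h2, by omega⟩⟩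

theorem IsStair.refl (p : Cell) : IsStair p p {p} :=
  ⟨0, fun _ => p, rfl, rfl, fun m hm => absurd hm (Nat.not_lt_zero m), by simp⟩

theorem IsStair.cons {p q : Cell} {S : Finset Cell} (i : Fin 3)
    (h : IsStair (p + Pi.single i 1) q S) : IsStair p q (insert p S) := by
  obtain ⟨n, f, h0, hn, hs, rfl⟩ := h
  refine ⟨n + 1, fun m => if m = 0 then p else f (m - 1), by simp, by simpa using hn, ?_, ?_⟩
  · intro m hm
    rcases Nat.eq_zero_or_pos m with rfl | hm0
    · exact ⟨i, by simpa using h0⟩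
    · obtain ⟨k, rfl⟩ := Nat.exists_eq_add_of_lt hm0
      obtain ⟨j, hj⟩ := hs k (by omega)
      refine ⟨j, ?_⟩
      simpa using hj
  · ext d
    simp only [Finset.mem_insert, Finset.mem_image, Finset.mem_range]
    constructor
    · rintro (rfl | ⟨m, hm, rfl⟩)
      · exact ⟨0, by omega, by simp⟩
      · exact ⟨m + 1, by omega, by simp⟩
    · rintro ⟨m, hm, rfl⟩
      rcases Nat.eq_zero_or_pos m with rfl | hm0
      · simp
      · exact Or.inr ⟨m - 1, by omega, by rw [if_neg (by omega)]⟩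

theorem IsStair.mem {p q : Cell} {S : Finset Cell} (h : IsStair p q S) :
    p ∈ S ∧ q ∈ S ∧ ∀ d ∈ S, p ≤ d ∧ d ≤ q := by
  obtain ⟨n, f, h0, hn, hs, rfl⟩ := h
  have mono : ∀ k m, m + k ≤ n → f m ≤ f (m + k) := by
    intro k
    induction k with
    | zero => intro m _; exact le_rfl
    | succ k ih =>
      intro m hm
      refine (ih m (by omega)).trans ?_
      obtain ⟨i, hi⟩ := hs (m + k) (by omega)
      rw [← add_assoc, hi]
      exact le_add_of_nonneg_right (Pi.single_nonneg.mpr zero_le_one)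
  refine ⟨Finset.mem_image.mpr ⟨0, by simp, h0⟩, Finset.mem_image.mpr ⟨n, by simp, hn⟩, ?_⟩
  intro d hd
  obtain ⟨m, hm, rfl⟩ := Finset.mem_image.mp hd
  rw [Finset.mem_range] at hm
  constructor
  · have := mono m 0 (by omega)
    rwa [h0, zero_add] at this
  · have := mono (n - m) m (by omega)
    rwa [show m + (n - m) = n by omega, hn] at this

/-- A shortest path between comparable cells takes upward steps only. -/
theorem lt_of_ne_of_le {c d : Cell} (h : c ≤ d) (hne : c ≠ d) {P : Finset Cell} (hP : Geodesic P)
    (hc : c ∈ P) (hd : d ∈ P) : ∃ i, c + Pi.single i 1 ∈ P ∧ c + Pi.single i 1 ≤ d := by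
  obtain ⟨i, ⟨h1, h2⟩ | ⟨h1, h2⟩⟩ := hP c hc d hd hne
  · refine ⟨i, h2, fun j => ?_⟩
    have : c j ≤ d j := h j
    by_cases hj : j = i
    · subst hj; simp; omega
    · simpa [hj]
  · have : c i ≤ d i := h i
    omega

/-- Climb from `c` as long as there is only one upward neighbour. That neighbour lies below every
cell above `c`, so it is central again, and the cells passed form a stair. The climb ends at `hi` or
at a cell with two upward neighbours, where a hook begins. -/
theorem Central.exists_last {lo hi : Cell} {P : Finset Cell} (h : Tight lo hi P) (n : ℕ) :
    ∀ c, Central P c → ∑ i, (hi i - c i) = n →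
    ∃ q, Central P q ∧ c ≤ q ∧
      (q = hi ∨ ∃ i j, i ≠ j ∧ q + Pi.single i 1 ∈ P ∧ q + Pi.single j 1 ∈ P) ∧
      IsStair c q (part P c q) := by
  induction n with
  | zero =>
    intro c hc h0
    have e : c = hi := by
      funext i
      have h1 : hi i - c i = 0 := (Finset.sum_eq_zero_iff_of_nonneg
        (fun i _ => sub_nonneg.mpr (h.1.le_hi hc.1 i))).mp h0 i (Finset.mem_univ i)
      omega
    refine ⟨c, hc, le_rfl, Or.inl e, ?_⟩
    convert IsStair.refl c using 1
    ext d
    rw [mem_part, Finset.mem_singleton]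
    exact ⟨fun hd => le_antisymm hd.2.2 hd.2.1, by rintro rfl; exact ⟨hc.1, le_rfl, le_rfl⟩⟩
  | succ n ih =>
    intro c hc hn
    by_cases htwo : ∃ i j, i ≠ j ∧ c + Pi.single i 1 ∈ P ∧ c + Pi.single j 1 ∈ P
    · refine ⟨c, hc, le_rfl, Or.inr htwo, ?_⟩
      convert IsStair.refl c using 1
      ext d
      rw [mem_part, Finset.mem_singleton]
      exact ⟨fun hd => le_antisymm hd.2.2 hd.2.1, by rintro rfl; exact ⟨hc.1, le_rfl, le_rfl⟩⟩
    have hex : ∃ i, c i < hi i := by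
      by_contra! hall
      have : ∑ i, (hi i - c i) ≤ 0 := Finset.sum_nonpos fun i _ => by have := hall i; omega
      push_cast at hn
      omega
    obtain ⟨k, hk⟩ := hex
    obtain ⟨d, hd, hdk⟩ := h.1.touches_hi k
    have hcd : c ≤ d := (hc.2 d hd).resolve_left fun hle => by
      have : d k ≤ c k := hle k
      omega
    obtain ⟨i, hi1, -⟩ := lt_of_ne_of_le hcd (by rintro rfl; omega) h.geodesic hc.1 hd
    -- Every shortest path that leaves `c` upwards begins with the only available step, in direction
    -- `i`.
    have huniq : ∀ d ∈ P, c ≤ d → c ≠ d → c + Pi.single i 1 ≤ d := by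
      intro d hd hcd hne
      obtain ⟨j, hj1, hj2⟩ := lt_of_ne_of_le hcd hne h.geodesic hc.1 hd
      have : i = j := by
        by_contra hij
        exact htwo ⟨i, j, hij, hi1, hj1⟩
      rwa [this]
    have hlt : c ≤ c + Pi.single i 1 := le_add_of_nonneg_right (Pi.single_nonneg.mpr zero_le_one)
    have hc' : Central P (c + Pi.single i 1) := by
      refine ⟨hi1, fun d hd => ?_⟩
      by_cases hne : c = d
      · subst hne; exact Or.inl hlt
      rcases hc.2 d hd with h1 | h1
      · exact Or.inl (h1.trans hlt)
      · exact Or.inr (huniq d hd h1 hne)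
    obtain ⟨q, hq, hcq, hend, hst⟩ := ih _ hc' (by
      have e : ∑ j, (hi j - (c + Pi.single i 1 : Cell) j) = ∑ j, (hi j - c j) - 1 := by
        have : ∀ j, hi j - (c + Pi.single i 1 : Cell) j = (hi j - c j) - (Pi.single i 1 : Cell) j :=
          fun j => by simp only [Pi.add_apply]; ring
        simp only [this, Finset.sum_sub_distrib, Finset.sum_pi_single', Finset.mem_univ, if_true]
      rw [e, hn]
      push_cast
      ring)
    refine ⟨q, hq, hlt.trans hcq, hend, ?_⟩
    convert hst.cons using 1
    ext d
    rw [Finset.mem_insert, mem_part, mem_part]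
    constructor
    · rintro ⟨h1, h2, h3⟩
      by_cases hne : c = d
      · exact Or.inl hne.symm
      · exact Or.inr ⟨h1, huniq d h1 h2 hne, h3⟩
    · rintro (rfl | ⟨h1, h2, h3⟩)
      · exact ⟨hc.1, le_rfl, hlt.trans hcq⟩
      · exact ⟨h1, hlt.trans h2, h3⟩

theorem Central.exists_up {lo hi : Cell} {P : Finset Cell} (h : Tight lo hi P) {c : Cell}
    (hc : Central P c) : ∃ q, Central P q ∧ c ≤ q ∧
      (q = hi ∨ ∃ i j, i ≠ j ∧ q + Pi.single i 1 ∈ P ∧ q + Pi.single j 1 ∈ P) ∧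
      IsStair c q (part P c q) := by
  refine Central.exists_last h (∑ i, (hi i - c i)).toNat c hc ?_
  rw [Int.toNat_of_nonneg]
  exact Finset.sum_nonneg fun i _ => by have := h.1.le_hi hc.1 i; omega

/-- All coordinates are reversed. -/
abbrev allTrue : Fin 3 → Bool := fun _ => true

theorem mirror_allTrue (τ c : Cell) : mirror τ allTrue c = τ - c := rfl

theorem Central.mirror_allTrue {P : Finset Cell} {c : Cell} (hc : Central P c) (τ : Cell) :
    Central (mirrorSet τ allTrue P) (τ - c) := by
  refine ⟨mirror_mem_mirrorSet.mpr hc.1, fun d hd => ?_⟩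
  rw [mem_mirrorSet, Polycube.mirror_allTrue] at hd
  rcases hc.2 _ hd with h | h
  · exact Or.inr (sub_le_comm.mp h)
  · exact Or.inl (le_sub_comm.mp h)

theorem tight_mirrorSet_allTrue {lo hi τ : Cell} {P : Finset Cell} :
    Tight (τ - hi) (τ - lo) (mirrorSet τ allTrue P) ↔ Tight lo hi P :=
  tight_mirrorSet_iff τ allTrue fun _ => Or.inl ⟨rfl, rfl, rfl⟩

theorem Central.exists_down {lo hi : Cell} {P : Finset Cell} (h : Tight lo hi P) {c : Cell}
    (hc : Central P c) : ∃ p, Central P p ∧ p ≤ c ∧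
      (p = lo ∨ ∃ i j, i ≠ j ∧ p - Pi.single i 1 ∈ P ∧ p - Pi.single j 1 ∈ P) := by
  -- The point reflection at the origin exchanges up and down.
  obtain ⟨q, hq, hcq, hend, -⟩ := Central.exists_up
    (tight_mirrorSet_allTrue (τ := 0).mpr h) (hc.mirror_allTrue 0)
  refine ⟨0 - q, ?_, sub_le_comm.mp hcq, ?_⟩
  · have := hq.mirror_allTrue 0
    rwa [mirrorSet_mirrorSet] at this
  · rcases hend with rfl | ⟨i, j, hij, h1, h2⟩
    · exact Or.inl (by simp)
    · rw [mem_mirrorSet, Polycube.mirror_allTrue] at h1 h2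
      exact Or.inr ⟨i, j, hij, by rwa [sub_sub], by rwa [sub_sub]⟩

theorem isVertex_lo (lo hi : Cell) : IsVertex lo hi lo := fun _ => Or.inl rfl

theorem isVertex_hi (lo hi : Cell) : IsVertex lo hi hi := fun _ => Or.inr rfl

theorem two_le_degree_lo {lo hi : Cell} {P : Finset Cell} (h : ∀ c ∈ P, c ∈ Set.Icc lo hi) :
    2 ≤ degree P lo ↔ ∃ i j, i ≠ j ∧ lo + Pi.single i 1 ∈ P ∧ lo + Pi.single j 1 ∈ P := by
  simp only [two_le_degree_iff h (isVertex_lo lo hi), inward_lo]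

/-- In a direction of thickness one `inward` points upwards even at `hi`; this is harmless, because
then neither of the two cells lies in the box. -/
theorem inward_hi_mem {lo hi : Cell} {P : Finset Cell} (h : ∀ c ∈ P, c ∈ Set.Icc lo hi)
    (i : Fin 3) : inward lo hi i ∈ P ↔ hi - Pi.single i 1 ∈ P := by
  by_cases e : hi i = lo i
  · constructor
    · intro hm
      have h2 : inward lo hi i i ≤ hi i := (h _ hm).2 i
      rw [inward_self, if_pos e] at h2
      omega
    · intro hm
      have h2 : lo i ≤ (hi - Pi.single i 1 : Cell) i := (h _ hm).1 i
      simp only [Pi.sub_apply, Pi.single_eq_same] at h2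
      omega
  · rw [inward, if_neg e]

theorem two_le_degree_hi {lo hi : Cell} {P : Finset Cell} (h : ∀ c ∈ P, c ∈ Set.Icc lo hi) :
    2 ≤ degree P hi ↔ ∃ i j, i ≠ j ∧ hi - Pi.single i 1 ∈ P ∧ hi - Pi.single j 1 ∈ P := by
  simp only [two_le_degree_iff h (isVertex_hi lo hi), inward_hi_mem h]

/-- The corner `p` of the first hook is above that hook and below everything else, hence central.
Conversely, descend from a central cell to a `p` and climb from there to a `q`, each at an end of
the prism or with two further neighbours outwards. By `Central.tight` the parts below `p` and above
`q` are minimal, and two neighbours at their corners make them hooks. -/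
theorem isMainDiagonal_iff {s : Fin 3 → ℕ} {P : Finset Cell} :
    IsMainDiagonal s P ↔ Tight 0 (top s) P ∧ ∃ c, Central P c := by
  rw [IsMainDiagonal, minimalInscribed_iff]
  refine and_congr_right fun ht => ?_
  constructor
  · rintro ⟨p, q, H, S, H', hH, hS, hH', rfl⟩
    obtain ⟨hp, hq, hpq⟩ := hS.mem
    have hp0 : (0 : Cell) ≤ p := (ht.1.subset p (by simp [hp])).1
    have hq1 : q ≤ top s := (ht.1.subset q (by simp [hq])).2
    refine ⟨p, by simp [hp], fun d hd => ?_⟩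
    simp only [Finset.mem_union] at hd
    rcases hd with (hd | hd) | hd
    · rcases hH with ⟨-, rfl⟩ | hH
      · exact absurd hd (Finset.notMem_empty d)
      · exact Or.inl (((isHook_iff hp0).mp hH).2.1.1.subset d hd).2
    · exact Or.inr (hpq d hd).1
    · rcases hH' with ⟨-, rfl⟩ | hH'
      · exact absurd hd (Finset.notMem_empty d)
      · exact Or.inr ((hpq q hq).1.trans (((isHook_iff hq1).mp hH').2.1.1.subset d hd).1)
  · rintro ⟨c, hc⟩
    obtain ⟨p, hp, -, hpend⟩ := Central.exists_down ht hc
    -- The climb starts anew at `p` rather than at `c`, so that the stair comprises all cells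
    -- between the two hooks.
    obtain ⟨q, hq, hpq, hqend, hst⟩ := Central.exists_up ht hp
    have tp := (Central.tight ht hp).1
    have tq := (Central.tight ht hq).2
    have mp : p ∈ part P 0 p := mem_part.mpr ⟨hp.1, (ht.1.subset p hp.1).1, le_rfl⟩
    have mq : q ∈ part P q (top s) := mem_part.mpr ⟨hq.1, le_rfl, (ht.1.subset q hq.1).2⟩
    classical
    refine ⟨p, q, if p = 0 then ∅ else part P 0 p, part P p q,
      if q = top s then ∅ else part P q (top s), ?_, hst, ?_, ?_⟩
    · by_cases e : p = 0
      · exact Or.inl ⟨e, if_pos e⟩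
      · rw [if_neg e]
        refine Or.inr ((isHook_iff tp.1.le).mpr ⟨isVertex_hi _ _, tp, mp, ?_⟩)
        obtain ⟨i, j, hij, h1, h2⟩ := hpend.resolve_left e
        refine (two_le_degree_hi tp.1.subset).mpr ⟨i, j, hij, ?_, ?_⟩
        · exact mem_part.mpr ⟨h1, (ht.1.subset _ h1).1,
            sub_le_self _ (Pi.single_nonneg.mpr zero_le_one)⟩
        · exact mem_part.mpr ⟨h2, (ht.1.subset _ h2).1,
            sub_le_self _ (Pi.single_nonneg.mpr zero_le_one)⟩
    · by_cases e : q = top s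
      · exact Or.inl ⟨e, if_pos e⟩
      · rw [if_neg e]
        refine Or.inr ((isHook_iff tq.1.le).mpr ⟨isVertex_lo _ _, tq, mq, ?_⟩)
        obtain ⟨i, j, hij, h1, h2⟩ := hqend.resolve_left e
        refine (two_le_degree_lo tq.1.subset).mpr ⟨i, j, hij, ?_, ?_⟩
        · exact mem_part.mpr ⟨h1, le_add_of_nonneg_right (Pi.single_nonneg.mpr zero_le_one),
            (ht.1.subset _ h1).2⟩
        · exact mem_part.mpr ⟨h2, le_add_of_nonneg_right (Pi.single_nonneg.mpr zero_le_one),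
            (ht.1.subset _ h2).2⟩
    · ext d
      simp only [Finset.mem_union]
      constructor
      · intro hd
        have hb := ht.1.subset d hd
        rcases hp.2 d hd with h1 | h1
        · left
          by_cases e : p = 0
          · exact Or.inr (mem_part.mpr ⟨hd, by rw [e]; exact hb.1, h1.trans hpq⟩)
          · rw [if_neg e]
            exact Or.inl (mem_part.mpr ⟨hd, hb.1, h1⟩)
        · rcases hq.2 d hd with h2 | h2
          · exact Or.inl (Or.inr (mem_part.mpr ⟨hd, h1, h2⟩))
          · by_cases e : q = top s
            · exact Or.inl (Or.inr (mem_part.mpr ⟨hd, h1, by rw [e]; exact hb.2⟩))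
            · rw [if_neg e]
              exact Or.inr (mem_part.mpr ⟨hd, h2, hb.2⟩)
      · rintro ((hd | hd) | hd)
        · split_ifs at hd
          · exact absurd hd (Finset.notMem_empty d)
          · exact (mem_part.mp hd).1
        · exact (mem_part.mp hd).1
        · split_ifs at hd
          · exact absurd hd (Finset.notMem_empty d)
          · exact (mem_part.mp hd).1

/-! ### Generic forms on two diagonals -/

/-- The lower end of the slice of the box `[0, T]` through `c` perpendicular to `a`. -/
noncomputable abbrev sliceLo (a : Fin 3) (c : Cell) : Cell := Function.update 0 a (c a)

/-- The upper end of the slice of the box `[0, T]` through `c` perpendicular to `a`. -/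
noncomputable abbrev sliceHi (T : Cell) (a : Fin 3) (c : Cell) : Cell := Function.update T a (c a)

/-- `c` is the centre of a generic form on two diagonals: every cell of `P` lies in the pillar
through `c`, or in the slice of `c` and is there comparable with `c`. -/
def TwoCentral (a : Fin 3) (P : Finset Cell) (c : Cell) : Prop :=
  c ∈ P ∧ ∀ d ∈ P, (∀ i, i ≠ a → d i = c i) ∨ (d a = c a ∧ (d ≤ c ∨ c ≤ d))

theorem mem_part_sliceLo {T c d : Cell} {a : Fin 3} {P : Finset Cell} (hP : ∀ c ∈ P, c ∈ Set.Icc 0 T)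
    : d ∈ part P (sliceLo a c) c ↔ d ∈ P ∧ d a = c a ∧ d ≤ c := by
  rw [mem_part]
  refine and_congr_right fun hd => ?_
  constructor
  · rintro ⟨h1, h2⟩
    have h3 : sliceLo a c a ≤ d a := h1 a
    have h4 : d a ≤ c a := h2 a
    simp only [Function.update_self] at h3
    exact ⟨by omega, h2⟩
  · rintro ⟨h1, h2⟩
    refine ⟨fun i => ?_, h2⟩
    by_cases hi : i = a
    · subst hi; simp [h1]
    · simp only [Function.update_of_ne hi]; exact (hP d hd).1 i

theorem mem_part_sliceHi {T c d : Cell} {a : Fin 3} {P : Finset Cell} (hP : ∀ c ∈ P, c ∈ Set.Icc 0 T)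
    : d ∈ part P c (sliceHi T a c) ↔ d ∈ P ∧ d a = c a ∧ c ≤ d := by
  rw [mem_part]
  refine and_congr_right fun hd => ?_
  constructor
  · rintro ⟨h1, h2⟩
    have h3 : d a ≤ sliceHi T a c a := h2 a
    have h4 : c a ≤ d a := h1 a
    simp only [Function.update_self] at h3
    exact ⟨by omega, h1⟩
  · rintro ⟨h1, h2⟩
    refine ⟨h2, fun i => ?_⟩
    by_cases hi : i = a
    · subst hi; simp [h1]
    · simp only [Function.update_of_ne hi]; exact (hP d hd).2 i

theorem span_slices (T c : Cell) (a : Fin 3) :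
    span (sliceLo a c) c + span c (sliceHi T a c) +
      span (Function.update c a ((0 : Cell) a)) (Function.update c a (T a)) = span 0 T + 2 := by
  fin_cases a <;> simp [span, Fin.sum_univ_three] <;> ring

/-- The two slice parts and the pillar part are inscribed in their boxes, and overlap only in `c`.
By `span_slices` their spans sum to `span 0 T + 2`, exactly what two overlaps of one cell allow, so
all three are minimal. The pillar part is then a minimal polyomino inside the full row, hence equal
to it. -/
theorem TwoCentral.tight {T c : Cell} {a : Fin 3} {P : Finset Cell} (h : Tight 0 T P)
    (hc : TwoCentral a P c) : Tight (sliceLo a c) c (part P (sliceLo a c) c) ∧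
      Tight c (sliceHi T a c) (part P c (sliceHi T a c)) ∧ row 0 T c a ⊆ P := by
  have hsub := h.1.subset
  have hcT := hsub c hc.1
  have hmem : ∀ {lo hi : Cell} {d : Cell}, d ∈ part P lo hi → d ∈ P := fun h => (mem_part.mp h).1
  have m1 : c ∈ part P (sliceLo a c) c := (mem_part_sliceLo hsub).mpr ⟨hc.1, rfl, le_rfl⟩
  have m2 : c ∈ part P c (sliceHi T a c) := (mem_part_sliceHi hsub).mpr ⟨hc.1, rfl, le_rfl⟩
  set lo := Function.update c a ((0 : Cell) a) with hlo
  set hi := Function.update c a (T a) with hhi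
  have hrow : ∀ d, d ∈ part P lo hi ↔ d ∈ P ∧ ∀ i, i ≠ a → d i = c i := by
    intro d
    have : d ∈ part P lo hi ↔ d ∈ P ∧ d ∈ row 0 T c a := by
      rw [mem_part, row, Finset.mem_Icc]
    rw [this, mem_row]
    exact and_congr_right fun hd => ⟨fun h => h.2.2, fun h => ⟨(hsub d hd).1 a, (hsub d hd).2 a, h⟩⟩
  have m3 : c ∈ part P lo hi := (hrow c).mpr ⟨hc.1, fun _ _ => rfl⟩
  have i1 : Inscribed (sliceLo a c) c (part P (sliceLo a c) c) := by
    refine ⟨fun d hd => (mem_part.mp hd).2, h.geodesic.connected_part m1, fun i => ?_,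
      fun i => ⟨c, m1, rfl⟩⟩
    by_cases hi' : i = a
    · subst hi'; exact ⟨c, m1, by simp⟩
    obtain ⟨d, hd, e⟩ := h.1.touches_lo i
    have h0 : (0 : Cell) i ≤ c i := hcT.1 i
    rcases hc.2 d hd with h1 | ⟨h1, h2 | h2⟩
    · exact ⟨c, m1, by simp only [Function.update_of_ne hi']; rw [← e, h1 i hi']⟩
    · exact ⟨d, (mem_part_sliceLo hsub).mpr ⟨hd, h1, h2⟩, by simpa only [Function.update_of_ne hi']⟩
    · have h3 : c i ≤ d i := h2 i
      exact ⟨c, m1, by simp only [Function.update_of_ne hi']; omega⟩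
  have i2 : Inscribed c (sliceHi T a c) (part P c (sliceHi T a c)) := by
    refine ⟨fun d hd => (mem_part.mp hd).2, h.geodesic.connected_part m2, fun i => ⟨c, m2, rfl⟩,
      fun i => ?_⟩
    by_cases hi' : i = a
    · subst hi'; exact ⟨c, m2, by simp⟩
    obtain ⟨d, hd, e⟩ := h.1.touches_hi i
    have h0 : c i ≤ T i := hcT.2 i
    rcases hc.2 d hd with h1 | ⟨h1, h2 | h2⟩
    · exact ⟨c, m2, by simp only [Function.update_of_ne hi']; rw [← e, h1 i hi']⟩
    · have h3 : d i ≤ c i := h2 i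
      exact ⟨c, m2, by simp only [Function.update_of_ne hi']; omega⟩
    · exact ⟨d, (mem_part_sliceHi hsub).mpr ⟨hd, h1, h2⟩, by simpa only [Function.update_of_ne hi']⟩
  have i3 : Inscribed lo hi (part P lo hi) := by
    refine ⟨fun d hd => (mem_part.mp hd).2, h.geodesic.connected_part m3, fun i => ?_, fun i => ?_⟩
    · by_cases hi' : i = a
      · subst hi'
        obtain ⟨d, hd, e⟩ := h.1.touches_lo i
        rcases hc.2 d hd with h1 | ⟨h1, -⟩
        · exact ⟨d, (hrow d).mpr ⟨hd, h1⟩, by simpa [hlo] using e⟩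
        · exact ⟨c, m3, by rw [hlo, Function.update_self, ← h1, e]⟩
      · exact ⟨c, m3, by rw [hlo, Function.update_of_ne hi']⟩
    · by_cases hi' : i = a
      · subst hi'
        obtain ⟨d, hd, e⟩ := h.1.touches_hi i
        rcases hc.2 d hd with h1 | ⟨h1, -⟩
        · exact ⟨d, (hrow d).mpr ⟨hd, h1⟩, by simpa [hhi] using e⟩
        · exact ⟨c, m3, by rw [hhi, Function.update_self, ← h1, e]⟩
      · exact ⟨c, m3, by rw [hhi, Function.update_of_ne hi']⟩
  have c1 := Finset.card_union_add_card_inter (part P (sliceLo a c) c) (part P c (sliceHi T a c))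
  have c2 := Finset.card_union_add_card_inter
    (part P (sliceLo a c) c ∪ part P c (sliceHi T a c)) (part P lo hi)
  have s1 : part P (sliceLo a c) c ∩ part P c (sliceHi T a c) ⊆ {c} := by
    intro d hd
    obtain ⟨hd1, hd2⟩ := Finset.mem_inter.mp hd
    exact Finset.mem_singleton.mpr (le_antisymm (mem_part.mp hd1).2.2 (mem_part.mp hd2).2.1)
  have s2 : (part P (sliceLo a c) c ∪ part P c (sliceHi T a c)) ∩ part P lo hi ⊆ {c} := by
    intro d hd
    obtain ⟨hd1, hd2⟩ := Finset.mem_inter.mp hd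
    have e : d a = c a := by
      rcases Finset.mem_union.mp hd1 with h1 | h1
      · exact ((mem_part_sliceLo hsub).mp h1).2.1
      · exact ((mem_part_sliceHi hsub).mp h1).2.1
    refine Finset.mem_singleton.mpr (funext fun i => ?_)
    by_cases hi' : i = a
    · rw [hi', e]
    · exact ((hrow d).mp hd2).2 i hi'
  have s3 : part P (sliceLo a c) c ∪ part P c (sliceHi T a c) ∪ part P lo hi ⊆ P := by
    intro d hd
    simp only [Finset.mem_union] at hd
    rcases hd with (hd | hd) | hd <;> exact hmem hd
  have s1 := Finset.card_le_card s1
  have s2 := Finset.card_le_card s2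
  have s3 := Finset.card_le_card s3
  rw [Finset.card_singleton] at s1 s2
  have e := span_slices T c a
  rw [← hlo, ← hhi] at e
  have e1 := i1.span_le
  have e2 := i2.span_le
  have e3 := i3.span_le
  have e4 := h.card
  refine ⟨⟨i1, by omega⟩, ⟨i2, by omega⟩, ?_⟩
  have t3 : Tight lo hi (part P lo hi) := ⟨i3, by omega⟩
  have : part P lo hi = row 0 T c a := by
    refine t3.eq_of_subset (tight_row h.1.le a) fun d hd => ?_
    have := (hrow d).mp hd
    exact mem_row.mpr ⟨(hsub d this.1).1 a, (hsub d this.1).2 a, this.2⟩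
  rw [← this]
  exact fun d hd => hmem hd

/-- A generic form on two diagonals is the union of its three components. -/
theorem TwoCentral.eq_union {T c : Cell} {a : Fin 3} {P : Finset Cell} (h : Tight 0 T P)
    (hc : TwoCentral a P c) :
    P = part P (sliceLo a c) c ∪ part P c (sliceHi T a c) ∪ row 0 T c a := by
  have hsub := h.1.subset
  have ht := hc.tight h
  ext d
  simp only [Finset.mem_union]
  constructor
  · intro hd
    rcases hc.2 d hd with h1 | ⟨h1, h2 | h2⟩
    · exact Or.inr (mem_row.mpr ⟨(hsub d hd).1 a, (hsub d hd).2 a, h1⟩)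
    · exact Or.inl (Or.inl ((mem_part_sliceLo hsub).mpr ⟨hd, h1, h2⟩))
    · exact Or.inl (Or.inr ((mem_part_sliceHi hsub).mpr ⟨hd, h1, h2⟩))
  · rintro ((hd | hd) | hd)
    · exact (mem_part.mp hd).1
    · exact (mem_part.mp hd).1
    · exact ht.2.2 hd

/-- Only the position of the cells relative to `c` has to be known: minimality of the whole makes
both slice parts minimal and the pillar full. -/
theorem isMainTwoDiag_iff {s : Fin 3 → ℕ} {a : Fin 3} {P : Finset Cell} :
    IsMainTwoDiag s a P ↔ Tight 0 (top s) P ∧ ∃ c, TwoCentral a P c := by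
  rw [IsMainTwoDiag, minimalInscribed_iff]
  refine and_congr_right fun ht => ?_
  constructor
  · rintro ⟨c, L, U, V, hc, hL, hU, hV, rfl⟩
    rw [isCornerPoly_iff] at hL hU
    refine ⟨c, by simp [hL.2.2], fun d hd => ?_⟩
    simp only [Finset.mem_union] at hd
    rcases hd with (hd | hd) | hd
    · have h1 := hL.2.1.1.lo_le hd a
      have h2 := hL.2.1.1.le_hi hd a
      simp only [Function.update_self] at h1
      exact Or.inr ⟨by omega, Or.inl (hL.2.1.1.subset d hd).2⟩
    · have h1 := hU.2.1.1.lo_le hd a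
      have h2 := hU.2.1.1.le_hi hd a
      simp only [Function.update_self] at h2
      exact Or.inr ⟨by omega, Or.inr (hU.2.1.1.subset d hd).1⟩
    · exact Or.inl ((hV d).mp hd).2
  · rintro ⟨c, hc⟩
    have hsub := ht.1.subset
    obtain ⟨t1, t2, -⟩ := hc.tight ht
    refine ⟨c, part P (sliceLo a c) c, part P c (sliceHi (top s) a c), row 0 (top s) c a,
      hsub c hc.1, isCornerPoly_iff.mpr ⟨isVertex_hi _ _, t1, ?_⟩,
      isCornerPoly_iff.mpr ⟨isVertex_lo _ _, t2, ?_⟩, fun d => ?_, hc.eq_union ht⟩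
    · exact (mem_part_sliceLo hsub).mpr ⟨hc.1, rfl, le_rfl⟩
    · exact (mem_part_sliceHi hsub).mpr ⟨hc.1, rfl, le_rfl⟩
    · rw [mem_row]
      have hcI := hsub c hc.1
      constructor
      · rintro ⟨h1, h2, h3⟩
        refine ⟨⟨fun i => ?_, fun i => ?_⟩, h3⟩ <;> by_cases hi' : i = a
        · subst hi'; exact h1
        · rw [h3 i hi']; exact hcI.1 i
        · subst hi'; exact h2
        · rw [h3 i hi']; exact hcI.2 i
      · rintro ⟨⟨h1, h2⟩, h3⟩
        exact ⟨h1 a, h2 a, h3⟩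

/-! ### Crosses -/

/-- All cells of `P` lie in the three rows through `c`. -/
def CrossCentral (P : Finset Cell) (c : Cell) : Prop :=
  c ∈ P ∧ ∀ d ∈ P, ∃ i, ∀ j, j ≠ i → d j = c j

/-- The union of the three rows of cells through `c` in the box `[lo, hi]`. -/
noncomputable def cross (lo hi c : Cell) : Finset Cell :=
  row lo hi c 0 ∪ row lo hi c 1 ∪ row lo hi c 2

theorem mem_cross {lo hi c d : Cell} (h : c ∈ Set.Icc lo hi) :
    d ∈ cross lo hi c ↔ d ∈ Set.Icc lo hi ∧ ∃ i, ∀ j, j ≠ i → d j = c j := by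
  have : d ∈ cross lo hi c ↔ ∃ i, d ∈ row lo hi c i := by
    simp [cross, Fin.exists_fin_succ]
  rw [this]
  simp only [mem_row]
  constructor
  · rintro ⟨i, h1, h2, h3⟩
    refine ⟨⟨fun k => ?_, fun k => ?_⟩, i, h3⟩ <;> by_cases hk : k = i
    · subst hk; exact h1
    · rw [h3 k hk]; exact h.1 k
    · subst hk; exact h2
    · rw [h3 k hk]; exact h.2 k
  · rintro ⟨⟨h1, h2⟩, i, h3⟩
    exact ⟨i, h1 i, h2 i, h3⟩

theorem tight_cross' {lo hi c : Cell} (h : c ∈ Set.Icc lo hi) : Tight lo hi (cross lo hi c) :=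
  tight_cross h (by decide) (by decide) (by decide)

/-- `P` is contained in the cross through `c` and has as many cells. -/
theorem CrossCentral.eq_cross {lo hi c : Cell} {P : Finset Cell} (h : Tight lo hi P)
    (hc : CrossCentral P c) : P = cross lo hi c := by
  have hcI := h.1.subset c hc.1
  exact h.eq_of_subset (tight_cross' hcI) fun d hd =>
    (mem_cross hcI).mpr ⟨h.1.subset d hd, hc.2 d hd⟩

theorem crossCentral_cross {lo hi c : Cell} (h : c ∈ Set.Icc lo hi) :
    CrossCentral (cross lo hi c) c :=
  ⟨(mem_cross h).mpr ⟨h, 0, fun _ _ => rfl⟩, fun _ hd => ((mem_cross h).mp hd).2⟩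

theorem isCross_iff {s : Fin 3 → ℕ} {P : Finset Cell} :
    IsCross s P ↔ (∀ i, 2 ≤ s i) ∧ Tight 0 (top s) P ∧ ∃ c, CrossCentral P c := by
  rw [IsCross, minimalInscribed_iff]
  refine and_congr_right fun _ => and_congr_right fun ht => ?_
  constructor
  · rintro ⟨c, hc, hP⟩
    exact ⟨c, (hP c).mpr ⟨hc, 0, fun _ _ => rfl⟩, fun d hd => ((hP d).mp hd).2⟩
  · rintro ⟨c, hc⟩
    have hcI := ht.1.subset c hc.1
    refine ⟨c, hcI, fun d => ?_⟩
    rw [← mem_cross hcI, ← hc.eq_cross ht]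

/-! ### Central cells along an arbitrary diagonal -/

/-- `d` is comparable with `c` in the order in which the coordinates `i` with `ε i = true` are
reversed. -/
def Comparable (ε : Fin 3 → Bool) (c d : Cell) : Prop :=
  (∀ i, if ε i then c i ≤ d i else d i ≤ c i) ∨ (∀ i, if ε i then d i ≤ c i else c i ≤ d i)

/-- `c` is a cell of `P` comparable with all cells of `P` in the order of the diagonal `ε`. -/
def CentralAlong (ε : Fin 3 → Bool) (P : Finset Cell) (c : Cell) : Prop :=
  c ∈ P ∧ ∀ d ∈ P, Comparable ε c d

theorem comparable_mirror (τ : Cell) (ε δ : Fin 3 → Bool) (c d : Cell) :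
    Comparable δ (mirror τ ε c) (mirror τ ε d) ↔ Comparable (fun i => xor (ε i) (δ i)) c d := by
  rw [Comparable, Comparable]
  refine or_congr (forall_congr' fun i => ?_) (forall_congr' fun i => ?_) <;>
  · simp only [mirror]
    cases ε i <;> cases δ i <;> simp <;> omega

theorem centralAlong_mirrorSet {τ : Cell} {ε δ : Fin 3 → Bool} {P : Finset Cell} {c : Cell} :
    CentralAlong δ (mirrorSet τ ε P) (mirror τ ε c) ↔
      CentralAlong (fun i => xor (ε i) (δ i)) P c := by
  rw [CentralAlong, CentralAlong, mirror_mem_mirrorSet]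
  refine and_congr_right fun _ => ⟨fun h d hd => ?_, fun h d hd => ?_⟩
  · exact (comparable_mirror τ ε δ c d).mp (h _ (mirror_mem_mirrorSet.mpr hd))
  · rw [← mirror_mirror τ ε d]
    exact (comparable_mirror τ ε δ c _).mpr (h _ (mem_mirrorSet.mp hd))

/-- Reversing all coordinates exchanges the two alternatives in `Comparable`; `ε` and its complement
are the two orientations of one diagonal. -/
theorem comparable_not (ε : Fin 3 → Bool) (c d : Cell) :
    Comparable (fun i => !ε i) c d ↔ Comparable ε c d := by
  rw [Comparable, Comparable, or_comm]
  refine or_congr (forall_congr' fun i => ?_) (forall_congr' fun i => ?_) <;>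
    cases ε i <;> simp

theorem centralAlong_not {ε : Fin 3 → Bool} {P : Finset Cell} {c : Cell} :
    CentralAlong (fun i => !ε i) P c ↔ CentralAlong ε P c := by
  simp only [CentralAlong, comparable_not]

/-- The diagonal that starts at the first cell of the prism. -/
abbrev allFalse : Fin 3 → Bool := fun _ => false

theorem centralAlong_allFalse {P : Finset Cell} {c : Cell} :
    CentralAlong allFalse P c ↔ Central P c := by
  simp [CentralAlong, Central, Comparable, Pi.le_def]

theorem central_mirrorSet {τ : Cell} {ε : Fin 3 → Bool} {P : Finset Cell} {c : Cell} :
    Central (mirrorSet τ ε P) (mirror τ ε c) ↔ CentralAlong ε P c := by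
  rw [← centralAlong_allFalse, centralAlong_mirrorSet]
  simp

theorem exists_mirror {τ : Cell} {ε : Fin 3 → Bool} {p : Cell → Prop} :
    (∃ c, p c) ↔ ∃ c, p (mirror τ ε c) :=
  ⟨fun ⟨c, h⟩ => ⟨mirror τ ε c, by rwa [mirror_mirror]⟩, fun ⟨c, h⟩ => ⟨_, h⟩⟩

theorem isDiagonalAlong_iff {s : Fin 3 → ℕ} {ε : Fin 3 → Bool} {P : Finset Cell} :
    IsDiagonalAlong s ε P ↔ Tight 0 (top s) P ∧ ∃ c, CentralAlong ε P c := by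
  rw [IsDiagonalAlong, reflect_eq_mirror, ← mirrorSet, isMainDiagonal_iff, tight_mirrorSet_prism,
    exists_mirror (τ := top s) (ε := ε)]
  simp only [central_mirrorSet]

/-- The two orders differ in the sign of coordinate `a` alone. If `d` is on the same side of `c` in
both, then `d a = c a`; if it is on opposite sides, all other coordinates agree. -/
theorem twoCentral_iff {a : Fin 3} {P : Finset Cell} {c : Cell} :
    TwoCentral a P c ↔ CentralAlong allFalse P c ∧ CentralAlong (flip a allFalse) P c := by
  rw [TwoCentral, CentralAlong, CentralAlong]
  have key : ∀ d, ((∀ i, i ≠ a → d i = c i) ∨ (d a = c a ∧ (d ≤ c ∨ c ≤ d))) ↔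
      Comparable allFalse c d ∧ Comparable (flip a allFalse) c d := by
    intro d
    simp only [Comparable, Pi.le_def, Polycube.flip, Fin.forall_fin_succ]
    fin_cases a <;> simp <;> omega
  simp only [key]
  exact ⟨fun h => ⟨⟨h.1, fun d hd => (h.2 d hd).1⟩, h.1, fun d hd => (h.2 d hd).2⟩,
    fun h => ⟨h.1.1, fun d hd => ⟨h.1.2 d hd, h.2.2 d hd⟩⟩⟩

theorem xor_flip (a : Fin 3) (ε δ : Fin 3 → Bool) :
    (fun i => xor (ε i) (Polycube.flip a δ i)) = Polycube.flip a (fun i => xor (ε i) (δ i)) := by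
  funext i
  by_cases h : i = a
  · subst h; simp [Polycube.flip]
  · simp [Polycube.flip, h]

theorem twoCentral_mirrorSet {τ : Cell} {a : Fin 3} {ε : Fin 3 → Bool} {P : Finset Cell}
    {c : Cell} : TwoCentral a (mirrorSet τ ε P) (mirror τ ε c) ↔
      CentralAlong ε P c ∧ CentralAlong (flip a ε) P c := by
  rw [twoCentral_iff, centralAlong_mirrorSet, centralAlong_mirrorSet, xor_flip]
  simp

theorem isTwoDiagAlong_iff {s : Fin 3 → ℕ} {a : Fin 3} {ε : Fin 3 → Bool} {P : Finset Cell} :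
    IsTwoDiagAlong s a ε P ↔ Tight 0 (top s) P ∧
      ∃ c, CentralAlong ε P c ∧ CentralAlong (flip a ε) P c := by
  rw [IsTwoDiagAlong, reflect_eq_mirror, ← mirrorSet, isMainTwoDiag_iff, tight_mirrorSet_prism,
    exists_mirror (τ := top s) (ε := ε)]
  simp only [twoCentral_mirrorSet]

/-- A cell that differs from `c` in a single coordinate is comparable with `c` in each of the
orders. -/
theorem CrossCentral.centralAlong {P : Finset Cell} {c : Cell} (h : CrossCentral P c)
    (ε : Fin 3 → Bool) : CentralAlong ε P c := by
  refine ⟨h.1, fun d hd => ?_⟩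
  obtain ⟨i, hi⟩ := h.2 d hd
  rcases le_total (c i) (d i) with hle | hle <;> cases hb : ε i
  · right; intro j
    by_cases hj : j = i
    · subst hj; simpa [hb]
    · simp [hi j hj]
  · left; intro j
    by_cases hj : j = i
    · subst hj; simpa [hb]
    · simp [hi j hj]
  · left; intro j
    by_cases hj : j = i
    · subst hj; simpa [hb]
    · simp [hi j hj]
  · right; intro j
    by_cases hj : j = i
    · subst hj; simpa [hb]
    · simp [hi j hj]

theorem IsTwoDiagAlong.isDiagonalAlong {s : Fin 3 → ℕ} {a : Fin 3} {ε : Fin 3 → Bool}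
    {P : Finset Cell} (h : IsTwoDiagAlong s a ε P) :
    IsDiagonalAlong s ε P ∧ IsDiagonalAlong s (flip a ε) P := by
  obtain ⟨ht, c, h1, h2⟩ := isTwoDiagAlong_iff.mp h
  exact ⟨isDiagonalAlong_iff.mpr ⟨ht, c, h1⟩, isDiagonalAlong_iff.mpr ⟨ht, c, h2⟩⟩

theorem IsCross.isDiagonalAlong {s : Fin 3 → ℕ} {P : Finset Cell} (h : IsCross s P)
    (ε : Fin 3 → Bool) : IsDiagonalAlong s ε P := by
  obtain ⟨-, ht, c, hc⟩ := isCross_iff.mp h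
  exact isDiagonalAlong_iff.mpr ⟨ht, c, hc.centralAlong ε⟩

/-! ### Two diagonals of one polyomino are linked -/

theorem forall_axes {a i j : Fin 3} (hai : a ≠ i) (haj : a ≠ j) (hij : i ≠ j) {p : Fin 3 → Prop} :
    (∀ k, p k) ↔ p a ∧ p i ∧ p j := by
  refine ⟨fun h => ⟨h a, h i, h j⟩, fun ⟨h1, h2, h3⟩ k => ?_⟩
  have : k = a ∨ k = i ∨ k = j := by omega
  rcases this with rfl | rfl | rfl <;> assumption

theorem flip_apply_self (a : Fin 3) (ε : Fin 3 → Bool) : Polycube.flip a ε a = !ε a := by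
  simp [Polycube.flip]

theorem flip_apply_of_ne {a i : Fin 3} (h : i ≠ a) (ε : Fin 3 → Bool) :
    Polycube.flip a ε i = ε i := by
  simp [Polycube.flip, h]

theorem comparable_flip_iff {a i j : Fin 3} (hai : a ≠ i) (haj : a ≠ j) (hij : i ≠ j)
    {c d : Cell} : Comparable (Polycube.flip a allFalse) c d ↔
      (c a ≤ d a ∧ d i ≤ c i ∧ d j ≤ c j) ∨ (d a ≤ c a ∧ c i ≤ d i ∧ c j ≤ d j) := by
  rw [Comparable, forall_axes hai haj hij, forall_axes hai haj hij, flip_apply_self,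
    flip_apply_of_ne hai.symm, flip_apply_of_ne haj.symm]
  simp

theorem le_iff_axes {a i j : Fin 3} (hai : a ≠ i) (haj : a ≠ j) (hij : i ≠ j) {c d : Cell} :
    c ≤ d ↔ c a ≤ d a ∧ c i ≤ d i ∧ c j ≤ d j := by
  rw [Pi.le_def, forall_axes hai haj hij]

theorem twoCentral_iff_axes {a i j : Fin 3} (hai : a ≠ i) (haj : a ≠ j) (hij : i ≠ j)
    {P : Finset Cell} {c : Cell} : TwoCentral a P c ↔ c ∈ P ∧ ∀ d ∈ P,
      (d i = c i ∧ d j = c j) ∨ (d a = c a ∧ ((d i ≤ c i ∧ d j ≤ c j) ∨ (c i ≤ d i ∧ c j ≤ d j))) := by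
  rw [TwoCentral]
  refine and_congr_right fun _ => forall₂_congr fun d _ => ?_
  rw [le_iff_axes hai haj hij, le_iff_axes hai haj hij,
    forall_axes hai haj hij (p := fun i => i ≠ a → d i = c i)]
  have := hai.symm
  have := haj.symm
  constructor
  · rintro (⟨-, h1, h2⟩ | h)
    · exact Or.inl ⟨h1 hai.symm, h2 haj.symm⟩
    · omega
  · rintro (⟨h1, h2⟩ | h)
    · exact Or.inl ⟨fun h => absurd rfl h, fun _ => h1, fun _ => h2⟩
    · omega

/-- Take a cell on the near side of the plane that is nearest to `v` in taxicab distance. Its first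
step towards `v` comes nearer still, so it must leave the near side, which only a step in direction
`k` from height `t` can do. -/
theorem Geodesic.exists_crossing {P : Finset Cell} (hP : Geodesic P) {u v : Cell} (hu : u ∈ P)
    (hv : v ∈ P) {k : Fin 3} {t : ℤ} (h1 : u k ≤ t) (h2 : t < v k) :
    ∃ w ∈ P, w k = t ∧ w + Pi.single k 1 ∈ P := by
  obtain ⟨w, hw, hmin⟩ := (P.filter (fun w => w k ≤ t)).exists_min_image
    (fun w => ∑ i, |v i - w i|) ⟨u, Finset.mem_filter.mpr ⟨hu, h1⟩⟩
  obtain ⟨hw, hwt⟩ := Finset.mem_filter.mp hw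
  have step : ∀ (w' : Cell) (i : Fin 3), w' ∈ P → (∀ j, j ≠ i → w' j = w j) →
      |v i - w' i| < |v i - w i| → t < w' k := by
    intro w' i hw' hj hi
    by_contra! hle
    have := hmin w' (Finset.mem_filter.mpr ⟨hw', hle⟩)
    refine absurd this (not_le.mpr (Finset.sum_lt_sum (fun j _ => ?_) ⟨i, Finset.mem_univ i, hi⟩))
    by_cases e : j = i
    · subst e; exact hi.le
    · rw [hj j e]
  obtain ⟨i, ⟨h3, h4⟩ | ⟨h3, h4⟩⟩ := hP w hw v hv (by rintro rfl; omega)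
  · have h5 := step _ i h4 (fun j hj => by simp [hj]) (by
      simp only [Pi.add_apply, Pi.single_eq_same]
      rw [abs_of_nonneg (by omega), abs_of_pos (by omega)]
      omega)
    by_cases e : k = i
    · subst e
      simp only [Pi.add_apply, Pi.single_eq_same] at h5
      exact ⟨w, hw, by omega, h4⟩
    · simp only [Pi.add_apply, Pi.single_eq_of_ne e] at h5
      omega
  · have h5 := step _ i h4 (fun j hj => by simp [hj]) (by
      simp only [Pi.sub_apply, Pi.single_eq_same]
      rw [abs_of_nonpos (by omega), abs_of_neg (by omega)]
      omega)
    by_cases e : k = i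
    · subst e
      simp only [Pi.sub_apply, Pi.single_eq_same] at h5
      omega
    · simp only [Pi.sub_apply, Pi.single_eq_of_ne e] at h5
      omega

/-- The only shortest path between cells that differ in one coordinate is the straight segment. -/
theorem Geodesic.update_mem {P : Finset Cell} (hP : Geodesic P) {u v : Cell} (hu : u ∈ P)
    (hv : v ∈ P) {a : Fin 3} (he : ∀ i, i ≠ a → u i = v i) {t : ℤ} (h1 : u a ≤ t) (h2 : t ≤ v a) :
    Function.update u a t ∈ P := by
  have main : ∀ n : ℕ, u a + n ≤ v a → Function.update u a (u a + n) ∈ P := by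
    intro n
    induction n with
    | zero => intro _; simpa using hu
    | succ n ih =>
      intro hn
      push_cast at hn
      obtain ⟨i, hi⟩ := hP _ (ih (by omega)) v hv (by
        intro e
        have := congrFun e a
        simp only [Function.update_self] at this
        omega)
      by_cases hia : i = a
      · subst hia
        simp only [Function.update_self] at hi
        rcases hi with ⟨-, h⟩ | ⟨h, -⟩
        · convert h using 1
          funext j
          by_cases hj : j = i
          · subst hj; simp; ring
          · simp [hj]
        · omega
      · simp only [Function.update_of_ne hia] at hi
        have := he i hia
        omega
  have := main (t - u a).toNat (by omega)
  rwa [Int.toNat_of_nonneg (by omega), add_sub_cancel] at this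

section Linked

variable {T c c' : Cell} {P : Finset Cell} {a i j : Fin 3}

/-- No cell lies lower than `c` in direction `a`: in the other two coordinates it would be at most
`c` and at least `c'`, against `hne`. Hence the slice of `c` is the bottom one, and some cell `w` of
it lies under a cell of `P`. The cell above `w` obeys both orders, which places `w` between `c` and
`c'`, and laminarity makes `w` the required centre. -/
theorem exists_twoCentral_of_slice (ht : Tight 0 T P) (hai : a ≠ i) (haj : a ≠ j) (hij : i ≠ j)
    (hc : Central P c) (hc' : CentralAlong (Polycube.flip a allFalse) P c') (hle : c ≤ c')
    (hT : 0 < T a) (ha : c' a = c a) (hne : c i < c' i ∨ c j < c' j) :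
    ∃ w, TwoCentral a P w := by
  have h1 : ∀ d ∈ P, (d a ≤ c a ∧ d i ≤ c i ∧ d j ≤ c j) ∨ (c a ≤ d a ∧ c i ≤ d i ∧ c j ≤ d j) := by
    intro d hd
    rw [← le_iff_axes hai haj hij, ← le_iff_axes hai haj hij]
    exact hc.2 d hd
  have h2 : ∀ d ∈ P, _ := fun d hd => (comparable_flip_iff hai haj hij).mp (hc'.2 d hd)
  rw [le_iff_axes hai haj hij] at hle
  have hlow : ∀ d ∈ P, c a ≤ d a := fun d hd => by
    have := h1 d hd
    have := h2 d hd
    omega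
  obtain ⟨d0, hd0, e0⟩ := ht.1.touches_lo a
  obtain ⟨d1, hd1, e1⟩ := ht.1.touches_hi a
  have e0 : d0 a = 0 := e0
  have := hlow d0 hd0
  obtain ⟨w, hw, hwa, hw'⟩ := ht.geodesic.exists_crossing hc.1 hd1 (le_refl (c a)) (by omega)
  have w1 := h1 _ hw'
  have w2 := h2 _ hw'
  simp only [Pi.add_apply, Pi.single_eq_same, Pi.single_eq_of_ne hai.symm,
    Pi.single_eq_of_ne haj.symm] at w1 w2
  have va : (w + Pi.single a 1 : Cell) a = w a + 1 := by simp
  have vi : (w + Pi.single a 1 : Cell) i = w i := by simp [hai.symm]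
  have vj : (w + Pi.single a 1 : Cell) j = w j := by simp [haj.symm]
  refine ⟨w, (twoCentral_iff_axes hai haj hij).mpr ⟨hw, fun d hd => ?_⟩⟩
  have d1 := h1 d hd
  have d2 := h2 d hd
  have d3 := hlow d hd
  have lam := ht.laminar
  by_cases hda : d a = c a
  · have n1 : ¬(c i ≤ d i ∧ d i < w i ∧ w j < d j ∧ d j ≤ c' j) := fun h =>
      lam i j hij (d i) (w j) c hc.1 d hd w hw c' hc'.1 (by omega) (by omega) (by omega) (by omega)
        (by omega) (by omega) (by omega) (by omega)
    have n2 : ¬(c j ≤ d j ∧ d j < w j ∧ w i < d i ∧ d i ≤ c' i) := fun h =>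
      lam j i hij.symm (d j) (w i) c hc.1 d hd w hw c' hc'.1 (by omega) (by omega) (by omega)
        (by omega) (by omega) (by omega) (by omega) (by omega)
    omega
  · have n1 : ∀ k, k ≠ a → d k ≤ c' k → ¬ w k < d k := fun k hk hdk h =>
      lam a k hk.symm (c a) (w k) w hw c' hc'.1 _ hw' d hd (by omega) (by omega) (by omega)
        (by omega) (by omega) (by simp [hk]) (by omega) (by omega)
    have n2 : ∀ k, k ≠ a → c k ≤ d k → ¬ d k < w k := fun k hk hdk h =>
      lam a k hk.symm (c a) (d k) c hc.1 w hw d hd _ hw' (by omega) (by omega) (by omega)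
        (by omega) (by omega) (by omega) (by omega) (by simpa [hk] using h)
    have := n1 i hai.symm
    have := n1 j haj.symm
    have := n2 i hai.symm
    have := n2 j haj.symm
    omega

/-- Apart from the line through `c` in direction `a`, laminarity leaves cells in direction `i` only
at the height of `d` and cells in direction `j` only at that of `d'`. The cell of the line at the
first height is then a centre common to the given diagonal and to the one with `i` reversed. The
cell at the second height is common to the latter and to the diagonal with `a` reversed. -/
theorem linked_of_two_heights (ht : Tight 0 T P) (hai : a ≠ i) (haj : a ≠ j) (hij : i ≠ j)
    (hc : c ∈ P) (hc' : c' ∈ P) (ei : c' i = c i) (ej : c' j = c j)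
    (hP : ∀ d ∈ P, (d i = c i ∧ d j = c j) ∨
      (c a ≤ d a ∧ d a ≤ c' a ∧ c i ≤ d i ∧ c j ≤ d j))
    {d d' : Cell} (hd : d ∈ P) (hd' : d' ∈ P) (hdd : d a < d' a) (hdi : c i < d i)
    (hdj : c j < d' j) :
    (∃ w, TwoCentral i P w) ∧ ∃ w, CentralAlong (Polycube.flip a allFalse) P w ∧
      CentralAlong (Polycube.flip i allFalse) P w := by
  have F : ∀ k, k ≠ a → c' k = c k → ∀ x ∈ P, ∀ y ∈ P, ¬(c k < x k ∧ c k < y k ∧ c a ≤ x a ∧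
      y a ≤ c' a ∧ x a < y a) := fun k hk ek x hx y hy ⟨h1, h2, h3, h4, h5⟩ =>
    ht.laminar a k hk.symm (x a) (c k) c hc x hx c' hc' y hy (by omega) (by omega) (by omega)
      (by omega) (by omega) (by omega) (by omega) (by omega)
  have hd1 : c a ≤ d a ∧ d a ≤ c' a := by have := hP d hd; omega
  have hd2 : c a ≤ d' a ∧ d' a ≤ c' a := by have := hP d' hd'; omega
  have cls : ∀ e ∈ P, (e i = c i ∧ e j = c j) ∨ (e a = d a ∧ c i ≤ e i ∧ e j = c j) ∨
      (e a = d' a ∧ e i = c i ∧ c j ≤ e j) := by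
    intro e he
    rcases hP e he with h0 | ⟨h1, h2, h3, h4⟩
    · exact Or.inl h0
    have hi : c i < e i → e a = d a := fun h => le_antisymm
      (not_lt.mp fun h' => F i hai.symm ei d hd e he ⟨hdi, h, hd1.1, h2, h'⟩)
      (not_lt.mp fun h' => F i hai.symm ei e he d hd ⟨h, hdi, h1, hd1.2, h'⟩)
    have hj : c j < e j → e a = d' a := fun h => le_antisymm
      (not_lt.mp fun h' => F j haj.symm ej d' hd' e he ⟨hdj, h, hd2.1, h2, h'⟩)
      (not_lt.mp fun h' => F j haj.symm ej e he d' hd' ⟨h, hdj, h1, hd2.2, h'⟩)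
    rcases h3.lt_or_eq with h5 | h5 <;> rcases h4.lt_or_eq with h6 | h6
    · have := hi h5
      have := hj h6
      omega
    · exact Or.inr (Or.inl ⟨hi h5, h3, h6.symm⟩)
    · exact Or.inr (Or.inr ⟨hj h6, h5.symm, h4⟩)
    · exact Or.inl ⟨h5.symm, h6.symm⟩
  have m : ∀ t, c a ≤ t → t ≤ c' a → Function.update c a t ∈ P := fun t h1 h2 =>
    ht.geodesic.update_mem hc hc' (fun k hk => by
      have : k = i ∨ k = j := by omega
      rcases this with rfl | rfl
      · exact ei.symm
      · exact ej.symm) h1 h2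
  have m1 := m (d a) (by omega) (by omega)
  have m2 := m (d' a) (by omega) (by omega)
  refine ⟨⟨_, (twoCentral_iff_axes hai.symm hij haj).mpr ⟨m1, fun e he => ?_⟩⟩, _, ⟨m2, fun e he =>
    (comparable_flip_iff hai haj hij).mpr ?_⟩, ⟨m2, fun e he =>
    (comparable_flip_iff hai.symm hij haj).mpr ?_⟩⟩ <;>
  · have := cls e he
    simp only [Function.update_self, Function.update_of_ne hai.symm, Function.update_of_ne haj.symm]
    omega

/-- If `c` and `c'` differ in `i` or `j`, comparability forces them into one slice. Otherwise they
lie on one line in direction `a`. When all cells off this line have the same height, the cell of the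
line at this height is a common centre; when two heights occur, a third diagonal links the two. -/
theorem linked_of_le (ht : Tight 0 T P) (hT : 0 < T a)
    (hc : Central P c) (hc' : CentralAlong (Polycube.flip a allFalse) P c') (hle : c ≤ c') :
    (∃ w, TwoCentral a P w) ∨ ∃ b, b ≠ a ∧ (∃ w, TwoCentral b P w) ∧
      ∃ w, CentralAlong (Polycube.flip a allFalse) P w ∧
        CentralAlong (Polycube.flip b allFalse) P w := by
  obtain ⟨i, j, hai, haj, hij⟩ := exists_other_two a
  have h1 : ∀ d ∈ P, (d a ≤ c a ∧ d i ≤ c i ∧ d j ≤ c j) ∨ (c a ≤ d a ∧ c i ≤ d i ∧ c j ≤ d j) := by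
    intro d hd
    rw [← le_iff_axes hai haj hij, ← le_iff_axes hai haj hij]
    exact hc.2 d hd
  have h2 : ∀ d ∈ P, _ := fun d hd => (comparable_flip_iff hai haj hij).mp (hc'.2 d hd)
  have hle' := (le_iff_axes hai haj hij).mp hle
  have h3 := h2 c hc.1
  by_cases hne : c i < c' i ∨ c j < c' j
  · exact Or.inl (exists_twoCentral_of_slice ht hai haj hij hc hc' hle hT (by omega) hne)
  have ei : c' i = c i := by omega
  have ej : c' j = c j := by omega
  by_cases ea : c' a = c a
  · refine Or.inl ⟨c, (twoCentral_iff_axes hai haj hij).mpr ⟨hc.1, fun d hd => ?_⟩⟩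
    have := h1 d hd
    have := h2 d hd
    omega
  have hP : ∀ d ∈ P, (d i = c i ∧ d j = c j) ∨
      (c a ≤ d a ∧ d a ≤ c' a ∧ c i ≤ d i ∧ c j ≤ d j) := by
    intro d hd
    have := h1 d hd
    have := h2 d hd
    omega
  by_cases htwo : ∃ d ∈ P, ∃ d' ∈ P, ¬(d i = c i ∧ d j = c j) ∧ ¬(d' i = c i ∧ d' j = c j) ∧
      d a < d' a
  · obtain ⟨d, hd, d', hd', n1, n2, hdd⟩ := htwo
    have p1 := hP d hd
    have p2 := hP d' hd'
    right
    -- Cells at different heights cannot both leave the line in direction `k`, because `c` and `c'`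
    -- occupy the other two quadrants.
    have F : ∀ k, k ≠ a → c' k = c k → ¬(c k < d k ∧ c k < d' k) := fun k hk ek ⟨h1, h2⟩ =>
      ht.laminar a k hk.symm (d a) (c k) c hc.1 d hd c' hc'.1 d' hd' (by omega) (by omega)
        (by omega) (by omega) (by omega) (by omega) (by omega) (by omega)
    by_cases hdi : c i < d i
    · have := F i hai.symm ei
      exact ⟨i, hai.symm, linked_of_two_heights ht hai haj hij hc.1 hc'.1 ei ej hP hd hd' hdd hdi
        (by omega)⟩
    · have hdj : c j < d j := by omega
      have := F j haj.symm ej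
      exact ⟨j, haj.symm, linked_of_two_heights ht haj hai hij.symm hc.1 hc'.1 ej ei
        (fun e he => by have := hP e he; omega) hd hd' hdd hdj (by omega)⟩
  · left
    push Not at htwo
    have hu : ∃ u, c a ≤ u ∧ u ≤ c' a ∧ ∀ d ∈ P, (d i = c i ∧ d j = c j) ∨ d a = u := by
      by_cases hex : ∃ d ∈ P, ¬(d i = c i ∧ d j = c j)
      · obtain ⟨d, hd, hn⟩ := hex
        have := hP d hd
        refine ⟨d a, by omega, by omega, fun e he => ?_⟩
        by_contra! hcon
        have hn' : ¬(e i = c i ∧ e j = c j) := fun h => hcon.1 h.1 h.2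
        have g1 := htwo d hd e he (fun h h' => hn ⟨h, h'⟩) (fun h h' => hn' ⟨h, h'⟩)
        have g2 := htwo e he d hd (fun h h' => hn' ⟨h, h'⟩) (fun h h' => hn ⟨h, h'⟩)
        omega
      · push Not at hex
        -- If `P` consists of the line alone, any height serves.
        exact ⟨c a, le_rfl, by omega, fun d hd => Or.inl (hex d hd)⟩
    obtain ⟨u, u1, u2, hu⟩ := hu
    refine ⟨Function.update c a u, (twoCentral_iff_axes hai haj hij).mpr
      ⟨ht.geodesic.update_mem hc.1 hc'.1 (fun k hk => ?_) u1 u2, fun e he => ?_⟩⟩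
    · have : k = i ∨ k = j := by omega
      rcases this with rfl | rfl
      · exact ei.symm
      · exact ej.symm
    · have := hP e he
      have := hu e he
      simp only [Function.update_self, Function.update_of_ne hai.symm,
        Function.update_of_ne haj.symm]
      omega

end Linked

theorem flip_not (a : Fin 3) (ε : Fin 3 → Bool) :
    Polycube.flip a (fun i => !ε i) = fun i => !Polycube.flip a ε i := by
  funext i
  by_cases h : i = a
  · subst h; simp [Polycube.flip]
  · simp [Polycube.flip, h]

theorem flip_flip (a : Fin 3) (ε : Fin 3 → Bool) : Polycube.flip a (Polycube.flip a ε) = ε := by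
  funext i
  by_cases h : i = a
  · subst h; simp [Polycube.flip]
  · simp [Polycube.flip, h]

/-- Reversing two axes gives the complement of reversing the third, hence the same diagonal. -/
theorem centralAlong_flip_flip {a i j : Fin 3} (hai : a ≠ i) (haj : a ≠ j) (hij : i ≠ j)
    {ε : Fin 3 → Bool} {P : Finset Cell} {c : Cell} :
    CentralAlong (Polycube.flip a (Polycube.flip i ε)) P c ↔
      CentralAlong (Polycube.flip j ε) P c := by
  rw [← centralAlong_not]
  suffices h : (fun k => !Polycube.flip a (Polycube.flip i ε) k) = Polycube.flip j ε by rw [h]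
  funext k
  have : k = a ∨ k = i ∨ k = j := by omega
  rcases this with rfl | rfl | rfl <;>
    simp [Polycube.flip, hai, haj, hij, hai.symm, haj.symm, hij.symm]

theorem centralAlong_mirror_flip {T c : Cell} {P : Finset Cell} {b : Fin 3} {ε : Fin 3 → Bool} :
    CentralAlong (Polycube.flip b allFalse) (mirrorSet T ε P) (mirror T ε c) ↔
      CentralAlong (Polycube.flip b ε) P c := by
  rw [centralAlong_mirrorSet, xor_flip]
  simp

/-- This is the connectedness of the graph on the diagonals of `P`: two of its vertices are joined
by an edge or through one intermediate vertex. A reflection reduces to the diagonal that starts at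
the first cell. -/
theorem linked {T : Cell} {P : Finset Cell} {a : Fin 3} {ε : Fin 3 → Bool} (ht : Tight 0 T P)
    (hT : 0 < T a) (h : ∃ c, CentralAlong ε P c) (h' : ∃ c, CentralAlong (Polycube.flip a ε) P c) :
    (∃ c, CentralAlong ε P c ∧ CentralAlong (Polycube.flip a ε) P c) ∨ ∃ b, b ≠ a ∧
      (∃ c, CentralAlong ε P c ∧ CentralAlong (Polycube.flip b ε) P c) ∧
      ∃ c, CentralAlong (Polycube.flip a ε) P c ∧ CentralAlong (Polycube.flip b ε) P c := by
  obtain ⟨c, hc⟩ := h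
  obtain ⟨c', hc'⟩ := h'
  have main : ∀ δ : Fin 3 → Bool, CentralAlong δ P c → CentralAlong (Polycube.flip a δ) P c' →
      mirror T δ c ≤ mirror T δ c' →
      (∃ c, CentralAlong δ P c ∧ CentralAlong (Polycube.flip a δ) P c) ∨ ∃ b, b ≠ a ∧
      (∃ c, CentralAlong δ P c ∧ CentralAlong (Polycube.flip b δ) P c) ∧
      ∃ c, CentralAlong (Polycube.flip a δ) P c ∧ CentralAlong (Polycube.flip b δ) P c := by
    intro δ h1 h2 hle
    have := linked_of_le ((tight_mirrorSet_prism δ).mpr ht) hT (central_mirrorSet.mpr h1)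
      (centralAlong_mirror_flip.mpr h2) hle
    rw [exists_mirror (τ := T) (ε := δ)] at this
    rcases this with h | ⟨b, hb, h3, h4⟩
    · simp only [twoCentral_mirrorSet] at h
      exact Or.inl h
    · rw [exists_mirror (τ := T) (ε := δ)] at h3 h4
      simp only [twoCentral_mirrorSet] at h3
      simp only [centralAlong_mirror_flip] at h4
      exact Or.inr ⟨b, hb, h3, h4⟩
  have hcomp : mirror T ε c' ≤ mirror T ε c ∨ mirror T ε c ≤ mirror T ε c' :=
    (central_mirrorSet.mpr hc).2 _ (mirror_mem_mirrorSet.mpr hc'.1)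
  rcases hcomp with hle | hle
  -- If `c'` precedes `c` along `ε`, the orientation of both diagonals is reversed.
  · have e : ∀ d, mirror T (fun i => !ε i) d = T - mirror T ε d := by
      intro d
      funext i
      simp only [mirror, Pi.sub_apply]
      by_cases h : ε i = true <;> simp [h]
    have := main (fun i => !ε i) (centralAlong_not.mpr hc)
      (by rw [flip_not]; exact centralAlong_not.mpr hc')
      (by rw [e, e]; exact sub_le_sub_left hle T)
    simpa only [flip_not, centralAlong_not] using this
  · exact main ε hc hc' hle

/-! ### Pillars of a polyomino -/

/-- The full pillar through `c` in direction `a` belongs to `P`, and all other cells of `P` lie in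
the slice of `c`. -/
def Pillar (T : Cell) (a : Fin 3) (P : Finset Cell) (c : Cell) : Prop :=
  c ∈ P ∧ (∀ d ∈ P, d a ≠ c a → ∀ i, i ≠ a → d i = c i) ∧ row 0 T c a ⊆ P

theorem pillar_of_centralAlong {T c : Cell} {P : Finset Cell} {a : Fin 3} {ε : Fin 3 → Bool}
    (ht : Tight 0 T P) (h : CentralAlong ε P c) (h' : CentralAlong (Polycube.flip a ε) P c) :
    Pillar T a P c := by
  have h2 : TwoCentral a (mirrorSet T ε P) (mirror T ε c) := twoCentral_mirrorSet.mpr ⟨h, h'⟩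
  have mir : ∀ d i, mirror T ε d i = mirror T ε c i ↔ d i = c i := by
    intro d i
    simp only [mirror]
    split_ifs <;> omega
  refine ⟨h.1, fun d hd hda i hi => ?_, fun d hd => ?_⟩
  · rcases h2.2 _ (mirror_mem_mirrorSet.mpr hd) with h3 | ⟨h3, -⟩
    · exact (mir d i).mp (h3 i hi)
    · exact absurd ((mir d a).mp h3) hda
  · have h3 := (h2.tight ((tight_mirrorSet_prism ε).mpr ht)).2.2
    obtain ⟨d1, d2, d3⟩ := mem_row.mp hd
    refine mirror_mem_mirrorSet.mp (h3 (mem_row.mpr ⟨?_, ?_, fun j hj => (mir d j).mpr (d3 j hj)⟩))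
    · simp only [mirror, Pi.zero_apply] at d1 ⊢
      split_ifs <;> omega
    · simp only [mirror, Pi.zero_apply] at d1 ⊢
      split_ifs <;> omega

section Pillars

variable {T c c' : Cell} {P : Finset Cell} {a b : Fin 3}

theorem Pillar.crossCentral (h : Pillar T a P c) (h' : Pillar T b P c) (hab : a ≠ b) :
    CrossCentral P c := by
  refine ⟨h.1, fun d hd => ?_⟩
  by_cases ha : d a = c a
  · by_cases hb : d b = c b
    · obtain ⟨k, hk⟩ : ∃ k, ∀ j : Fin 3, j ≠ k → j = a ∨ j = b := by
        clear * - hab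
        revert a b
        decide
      refine ⟨k, fun j hj => ?_⟩
      rcases hk j hj with rfl | rfl <;> assumption
    · exact ⟨b, fun j hj => h'.2.1 d hd hb j hj⟩
  · exact ⟨a, fun j hj => h.2.1 d hd ha j hj⟩

/-- The pillar through `c` has a cell at a height different from any given one. -/
theorem Pillar.exists_ne (hT : 0 < T a) (h : Pillar T a P c) (t : ℤ) :
    ∃ d ∈ P, d a ≠ t ∧ ∀ i, i ≠ a → d i = c i := by
  have m : ∀ u, 0 ≤ u → u ≤ T a → Function.update c a u ∈ P := fun u h1 h2 =>
    h.2.2 (mem_row.mpr ⟨by simpa using h1, by simpa using h2, fun j hj => by simp [hj]⟩)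
  by_cases ht0 : t = 0
  · exact ⟨_, m (T a) hT.le le_rfl, by simp; omega, fun i hi => by simp [hi]⟩
  · exact ⟨_, m 0 le_rfl hT.le, by simp; omega, fun i hi => by simp [hi]⟩

/-- A cell of the first pillar whose coordinate `a` is not that of `c'` is off the second pillar,
hence in the slice of `c'`. -/
theorem Pillar.apply_eq (hT : 0 < T a) (h : Pillar T a P c)
    (h' : Pillar T b P c') (hab : a ≠ b) : c b = c' b := by
  obtain ⟨d, hd, h1, h2⟩ := h.exists_ne hT (c' a)
  rw [← h2 b hab.symm]
  by_contra hne
  exact h1 (h'.2.1 d hd hne a hab)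

/-- The second direction of positive extent is essential, since in a single row every cell is a
centre. Two centres on one line at different heights would confine all cells to that line, and
centres on different lines are excluded because a pillar leaves the slice of the other centre. -/
theorem Pillar.eq (ht : Tight 0 T P) (hTa : 0 < T a) (hT : ∃ i, a ≠ i ∧ 0 < T i) (h : Pillar T a P c)
    (h' : Pillar T a P c') : c = c' := by
  have hoff : (∀ i, i ≠ a → c i = c' i) → c a = c' a := by
    intro hoff
    by_contra hne
    obtain ⟨i, hai, hTi⟩ := hT
    obtain ⟨d0, hd0, e0⟩ := ht.1.touches_lo i
    obtain ⟨d1, hd1, e1⟩ := ht.1.touches_hi i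
    have all : ∀ d ∈ P, d i = c i := by
      intro d hd
      by_cases hda : d a = c a
      · rw [h'.2.1 d hd (by omega) i hai.symm, hoff i hai.symm]
      · exact h.2.1 d hd hda i hai.symm
    rw [all d0 hd0] at e0
    rw [all d1 hd1] at e1
    have e0 : c i = 0 := e0
    omega
  have off : ∀ i, i ≠ a → c i = c' i := by
    intro i hi
    by_cases hca : c a = c' a
    · obtain ⟨d, hd, h1, h2⟩ := h.exists_ne hTa (c' a)
      rw [← h2 i hi, h'.2.1 d hd h1 i hi]
    · exact h'.2.1 c h.1 hca i hi
  funext i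
  by_cases hi : i = a
  · subst hi; exact hoff off
  · exact off i hi

/-- Perpendicular pillars agree in the coordinates of their own two directions; the third pillar
carries over the remaining coordinate. -/
theorem Pillar.crossCentral_of_three (hT : ∀ i, 0 < T i) {x y z : Cell}
    {a b k : Fin 3} (hab : a ≠ b) (hak : a ≠ k) (hbk : b ≠ k) (hx : Pillar T a P x)
    (hy : Pillar T b P y) (hz : Pillar T k P z) : ∃ c, CrossCentral P c := by
  have e : x = y := by
    funext i
    have : i = a ∨ i = b ∨ i = k := by omega
    rcases this with rfl | rfl | rfl
    · exact (hy.apply_eq (hT b) hx hab.symm).symm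
    · exact hx.apply_eq (hT _) hy hab
    · rw [hx.apply_eq (hT _) hz hak, hy.apply_eq (hT _) hz hbk]
  subst e
  exact ⟨x, hx.crossCentral hy hab⟩

end Pillars

/-! ### Inclusion-exclusion over the four diagonals -/

set_option synthInstance.maxHeartbeats 400000 in
set_option synthInstance.maxSize 4000 in
set_option maxRecDepth 4000 in
/-- Inclusion-exclusion over the vertices of a graph on four vertices that is a tree on the
vertices with property `e`, or complete. -/
theorem four_vertex_count : ∀ e0 e1 e2 e3 g01 g02 g03 g12 g13 g23 X : Bool,
    (X → e0 && e1 && e2 && e3 && g01 && g02 && g03 && g12 && g13 && g23) →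
    (g01 → e0 && e1) → (g02 → e0 && e2) → (g03 → e0 && e3) → (g12 → e1 && e2) →
    (g13 → e1 && e3) → (g23 → e2 && e3) →
    (g01 && g23 → X) → (g02 && g13 → X) → (g03 && g12 → X) →
    (g01 && g02 && g12 → X) → (g01 && g03 && g13 → X) → (g02 && g03 && g23 → X) →
    (g12 && g13 && g23 → X) →
    (e0 && e1 → g01 || (g02 && g12) || (g03 && g13)) →
    (e0 && e2 → g02 || (g01 && g12) || (g03 && g23)) →
    (e0 && e3 → g03 || (g01 && g13) || (g02 && g23)) →
    (e1 && e2 → g12 || (g01 && g02) || (g13 && g23)) →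
    (e1 && e3 → g13 || (g01 && g03) || (g12 && g23)) →
    (e2 && e3 → g23 || (g02 && g03) || (g12 && g13)) →
    (e0 || e1 || e2 || e3).toNat + (g01.toNat + g02.toNat + g03.toNat + g12.toNat + g13.toNat +
      g23.toNat) = e0.toNat + e1.toNat + e2.toNat + e3.toNat + 3 * X.toNat := by
  decide +kernel

theorem toNat_decide (p : Prop) [Decidable p] : (decide p).toNat = if p then 1 else 0 := by
  by_cases h : p <;> simp [h]

/-- The value of a family on one set of cells, as a number. -/
noncomputable def ind (p : Prop) : ℕ := by classical exact if p then 1 else 0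

theorem toNat_decide_eq_ind (p : Prop) [Decidable p] : (decide p).toNat = ind p := by
  rw [ind, toNat_decide]
  congr

theorem four_vertex_ind {E0 E1 E2 E3 G01 G02 G03 G12 G13 G23 X : Prop}
    (all : X → E0 ∧ E1 ∧ E2 ∧ E3 ∧ G01 ∧ G02 ∧ G03 ∧ G12 ∧ G13 ∧ G23)
    (g01 : G01 → E0 ∧ E1) (g02 : G02 → E0 ∧ E2) (g03 : G03 → E0 ∧ E3) (g12 : G12 → E1 ∧ E2)
    (g13 : G13 → E1 ∧ E3) (g23 : G23 → E2 ∧ E3)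
    (opp0 : G01 ∧ G23 → X) (opp1 : G02 ∧ G13 → X) (opp2 : G03 ∧ G12 → X)
    (tri3 : G01 ∧ G02 ∧ G12 → X) (tri2 : G01 ∧ G03 ∧ G13 → X) (tri1 : G02 ∧ G03 ∧ G23 → X)
    (tri0 : G12 ∧ G13 ∧ G23 → X)
    (l01 : E0 ∧ E1 → G01 ∨ (G02 ∧ G12) ∨ (G03 ∧ G13))
    (l02 : E0 ∧ E2 → G02 ∨ (G01 ∧ G12) ∨ (G03 ∧ G23))
    (l03 : E0 ∧ E3 → G03 ∨ (G01 ∧ G13) ∨ (G02 ∧ G23))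
    (l12 : E1 ∧ E2 → G12 ∨ (G01 ∧ G02) ∨ (G13 ∧ G23))
    (l13 : E1 ∧ E3 → G13 ∨ (G01 ∧ G03) ∨ (G12 ∧ G23))
    (l23 : E2 ∧ E3 → G23 ∨ (G02 ∧ G03) ∨ (G12 ∧ G13)) :
    ind (E0 ∨ E1 ∨ E2 ∨ E3) + (ind G01 + ind G02 + ind G03 + ind G12 + ind G13 + ind G23) =
      ind E0 + ind E1 + ind E2 + ind E3 + 3 * ind X := by
  classical
  have key := four_vertex_count (decide E0) (decide E1) (decide E2) (decide E3) (decide G01)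
    (decide G02) (decide G03) (decide G12) (decide G13) (decide G23) (decide X)
  simp only [← Bool.decide_and, ← Bool.decide_or, decide_eq_true_eq, toNat_decide_eq_ind, and_assoc,
    or_assoc] at key
  exact key all g01 g02 g03 g12 g13 g23 opp0 opp1 opp2 tri3 tri2 tri1 tri0 l01 l02 l03 l12 l13 l23

set_option maxHeartbeats 1000000 in
-- Vertex 0 is the diagonal from the first cell, and vertices 1, 2, 3 reverse one of the axes 0, 1,
-- 2. Each edge has the axis of its pillar: the edges 01 and 23 have axis 0, 02 and 13 axis 1, 03
-- and 12 axis 2. Opposite edges have the same axis, and the edges of a triangle have three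
-- different ones.
theorem isDiagonal_count {s : Fin 3 → ℕ} (hs : ∀ i, 2 ≤ s i) (P : Finset Cell) :
    ind (IsDiagonal s P) +
      (ind (IsTwoDiagAlong s 0 allFalse P) + ind (IsTwoDiagAlong s 1 allFalse P) +
        ind (IsTwoDiagAlong s 2 allFalse P) +
        ind (IsTwoDiagAlong s 2 (Polycube.flip 0 allFalse) P) +
        ind (IsTwoDiagAlong s 1 (Polycube.flip 0 allFalse) P) +
        ind (IsTwoDiagAlong s 0 (Polycube.flip 1 allFalse) P)) =
      ind (IsDiagonalAlong s allFalse P) + ind (IsDiagonalAlong s (Polycube.flip 0 allFalse) P) +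
        ind (IsDiagonalAlong s (Polycube.flip 1 allFalse) P) +
        ind (IsDiagonalAlong s (Polycube.flip 2 allFalse) P) + 3 * ind (IsCross s P) := by
  classical
  by_cases ht : Tight 0 (top s) P
  swap
  · have h1 : ¬ IsDiagonal s P := fun ⟨ε, h⟩ => ht (isDiagonalAlong_iff.mp h).1
    simp [ind, h1, isDiagonalAlong_iff, isTwoDiagAlong_iff, isCross_iff, ht]
  have hT : ∀ i, 0 < top s i := fun i => by
    have := hs i
    simp only [top]
    omega
  have hX : IsCross s P ↔ ∃ c, CrossCentral P c := by simp [isCross_iff, hs, ht]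
  -- The eight choices of signs are two orientations of each of the four diagonals.
  have reps : ∀ ε : Fin 3 → Bool, ∃ δ, (δ = allFalse ∨ δ = Polycube.flip 0 allFalse ∨
      δ = Polycube.flip 1 allFalse ∨ δ = Polycube.flip 2 allFalse) ∧
      (ε = δ ∨ ε = fun i => !δ i) := by decide
  have hD : IsDiagonal s P ↔ (∃ c, CentralAlong allFalse P c) ∨
      (∃ c, CentralAlong (Polycube.flip 0 allFalse) P c) ∨
      (∃ c, CentralAlong (Polycube.flip 1 allFalse) P c) ∨
      ∃ c, CentralAlong (Polycube.flip 2 allFalse) P c := by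
    simp only [IsDiagonal, isDiagonalAlong_iff, ht, true_and]
    constructor
    · rintro ⟨ε, c, hc⟩
      obtain ⟨δ, hδ, he⟩ := reps ε
      have hc' : CentralAlong δ P c := by
        rcases he with rfl | rfl
        · exact hc
        · exact centralAlong_not.mp hc
      rcases hδ with rfl | rfl | rfl | rfl
      · exact Or.inl ⟨c, hc'⟩
      · exact Or.inr (Or.inl ⟨c, hc'⟩)
      · exact Or.inr (Or.inr (Or.inl ⟨c, hc'⟩))
      · exact Or.inr (Or.inr (Or.inr ⟨c, hc'⟩))
    · rintro (h | h | h | h)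
      · exact ⟨_, h⟩
      · exact ⟨_, h⟩
      · exact ⟨_, h⟩
      · exact ⟨_, h⟩
  set E0 := ∃ c, CentralAlong allFalse P c with hE0
  set E1 := ∃ c, CentralAlong (Polycube.flip 0 allFalse) P c with hE1
  set E2 := ∃ c, CentralAlong (Polycube.flip 1 allFalse) P c with hE2
  set E3 := ∃ c, CentralAlong (Polycube.flip 2 allFalse) P c with hE3
  set G01 := ∃ c, CentralAlong allFalse P c ∧ CentralAlong (Polycube.flip 0 allFalse) P c with hG01
  set G02 := ∃ c, CentralAlong allFalse P c ∧ CentralAlong (Polycube.flip 1 allFalse) P c with hG02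
  set G03 := ∃ c, CentralAlong allFalse P c ∧ CentralAlong (Polycube.flip 2 allFalse) P c with hG03
  set G12 := ∃ c, CentralAlong (Polycube.flip 0 allFalse) P c ∧
    CentralAlong (Polycube.flip 1 allFalse) P c with hG12
  set G13 := ∃ c, CentralAlong (Polycube.flip 0 allFalse) P c ∧
    CentralAlong (Polycube.flip 2 allFalse) P c with hG13
  set G23 := ∃ c, CentralAlong (Polycube.flip 1 allFalse) P c ∧
    CentralAlong (Polycube.flip 2 allFalse) P c with hG23
  have f20 : ∀ c, CentralAlong (Polycube.flip 2 (Polycube.flip 0 allFalse)) P c ↔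
      CentralAlong (Polycube.flip 1 allFalse) P c :=
    fun c => centralAlong_flip_flip (by decide) (by decide) (by decide)
  have f10 : ∀ c, CentralAlong (Polycube.flip 1 (Polycube.flip 0 allFalse)) P c ↔
      CentralAlong (Polycube.flip 2 allFalse) P c :=
    fun c => centralAlong_flip_flip (by decide) (by decide) (by decide)
  have f01 : ∀ c, CentralAlong (Polycube.flip 0 (Polycube.flip 1 allFalse)) P c ↔
      CentralAlong (Polycube.flip 2 allFalse) P c :=
    fun c => centralAlong_flip_flip (by decide) (by decide) (by decide)
  have f21 : ∀ c, CentralAlong (Polycube.flip 2 (Polycube.flip 1 allFalse)) P c ↔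
      CentralAlong (Polycube.flip 0 allFalse) P c :=
    fun c => centralAlong_flip_flip (by decide) (by decide) (by decide)
  have all : (∃ c, CrossCentral P c) → E0 ∧ E1 ∧ E2 ∧ E3 ∧ G01 ∧ G02 ∧ G03 ∧ G12 ∧ G13 ∧ G23 := by
    rintro ⟨c, hc⟩
    have h := hc.centralAlong
    exact ⟨⟨c, h _⟩, ⟨c, h _⟩, ⟨c, h _⟩, ⟨c, h _⟩, ⟨c, h _, h _⟩, ⟨c, h _, h _⟩, ⟨c, h _, h _⟩,
      ⟨c, h _, h _⟩, ⟨c, h _, h _⟩, ⟨c, h _, h _⟩⟩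
  have p01 : ∀ c, CentralAlong allFalse P c → CentralAlong (Polycube.flip 0 allFalse) P c →
      Pillar (top s) 0 P c := fun c h h' => pillar_of_centralAlong ht h h'
  have p02 : ∀ c, CentralAlong allFalse P c → CentralAlong (Polycube.flip 1 allFalse) P c →
      Pillar (top s) 1 P c := fun c h h' => pillar_of_centralAlong ht h h'
  have p03 : ∀ c, CentralAlong allFalse P c → CentralAlong (Polycube.flip 2 allFalse) P c →
      Pillar (top s) 2 P c := fun c h h' => pillar_of_centralAlong ht h h'
  have p12 : ∀ c, CentralAlong (Polycube.flip 0 allFalse) P c →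
      CentralAlong (Polycube.flip 1 allFalse) P c → Pillar (top s) 2 P c :=
    fun c h h' => pillar_of_centralAlong ht h ((f20 c).mpr h')
  have p13 : ∀ c, CentralAlong (Polycube.flip 0 allFalse) P c →
      CentralAlong (Polycube.flip 2 allFalse) P c → Pillar (top s) 1 P c :=
    fun c h h' => pillar_of_centralAlong ht h ((f10 c).mpr h')
  have p23 : ∀ c, CentralAlong (Polycube.flip 1 allFalse) P c →
      CentralAlong (Polycube.flip 2 allFalse) P c → Pillar (top s) 0 P c :=
    fun c h h' => pillar_of_centralAlong ht h ((f01 c).mpr h')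
  -- Parallel pillars have the same centre, which is then central for all four diagonals and so
  -- carries perpendicular pillars as well.
  have opp0 : G01 ∧ G23 → ∃ c, CrossCentral P c := by
    rintro ⟨⟨c, h0, h1⟩, c', h2, h3⟩
    obtain rfl := (p01 c h0 h1).eq ht (hT 0) ⟨1, by decide, hT 1⟩ (p23 c' h2 h3)
    exact ⟨c, (p01 c h0 h1).crossCentral (p02 c h0 h2) (by decide)⟩
  have opp1 : G02 ∧ G13 → ∃ c, CrossCentral P c := by
    rintro ⟨⟨c, h0, h2⟩, c', h1, h3⟩
    obtain rfl := (p02 c h0 h2).eq ht (hT 1) ⟨0, by decide, hT 0⟩ (p13 c' h1 h3)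
    exact ⟨c, (p01 c h0 h1).crossCentral (p02 c h0 h2) (by decide)⟩
  have opp2 : G03 ∧ G12 → ∃ c, CrossCentral P c := by
    rintro ⟨⟨c, h0, h3⟩, c', h1, h2⟩
    obtain rfl := (p03 c h0 h3).eq ht (hT 2) ⟨0, by decide, hT 0⟩ (p12 c' h1 h2)
    exact ⟨c, (p01 c h0 h1).crossCentral (p02 c h0 h2) (by decide)⟩
  have tri3 : G01 ∧ G02 ∧ G12 → ∃ c, CrossCentral P c := by
    rintro ⟨⟨x, x1, x2⟩, ⟨y, y1, y2⟩, z, z1, z2⟩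
    exact Pillar.crossCentral_of_three hT (by decide) (by decide) (by decide) (p01 x x1 x2)
      (p02 y y1 y2) (p12 z z1 z2)
  have tri2 : G01 ∧ G03 ∧ G13 → ∃ c, CrossCentral P c := by
    rintro ⟨⟨x, x1, x2⟩, ⟨y, y1, y2⟩, z, z1, z2⟩
    exact Pillar.crossCentral_of_three hT (by decide) (by decide) (by decide) (p01 x x1 x2)
      (p03 y y1 y2) (p13 z z1 z2)
  have tri1 : G02 ∧ G03 ∧ G23 → ∃ c, CrossCentral P c := by
    rintro ⟨⟨x, x1, x2⟩, ⟨y, y1, y2⟩, z, z1, z2⟩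
    exact Pillar.crossCentral_of_three hT (by decide) (by decide) (by decide) (p02 x x1 x2)
      (p03 y y1 y2) (p23 z z1 z2)
  have tri0 : G12 ∧ G13 ∧ G23 → ∃ c, CrossCentral P c := by
    rintro ⟨⟨x, x1, x2⟩, ⟨y, y1, y2⟩, z, z1, z2⟩
    exact Pillar.crossCentral_of_three hT (by decide) (by decide) (by decide) (p12 x x1 x2)
      (p13 y y1 y2) (p23 z z1 z2)
  have l01 : E0 ∧ E1 → G01 ∨ (G02 ∧ G12) ∨ (G03 ∧ G13) := by
    rintro ⟨h0, h1⟩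
    rcases linked ht (hT 0) h0 h1 with h | ⟨b, hb, h2, h3⟩
    · exact Or.inl h
    · have : b = 1 ∨ b = 2 := by omega
      rcases this with rfl | rfl
      · exact Or.inr (Or.inl ⟨h2, h3⟩)
      · exact Or.inr (Or.inr ⟨h2, h3⟩)
  have l02 : E0 ∧ E2 → G02 ∨ (G01 ∧ G12) ∨ (G03 ∧ G23) := by
    rintro ⟨h0, h1⟩
    rcases linked ht (hT 1) h0 h1 with h | ⟨b, hb, h2, c, h3, h4⟩
    · exact Or.inl h
    · have : b = 0 ∨ b = 2 := by omega
      rcases this with rfl | rfl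
      · exact Or.inr (Or.inl ⟨h2, c, h4, h3⟩)
      · exact Or.inr (Or.inr ⟨h2, c, h3, h4⟩)
  have l03 : E0 ∧ E3 → G03 ∨ (G01 ∧ G13) ∨ (G02 ∧ G23) := by
    rintro ⟨h0, h1⟩
    rcases linked ht (hT 2) h0 h1 with h | ⟨b, hb, h2, c, h3, h4⟩
    · exact Or.inl h
    · have : b = 0 ∨ b = 1 := by omega
      rcases this with rfl | rfl
      · exact Or.inr (Or.inl ⟨h2, c, h4, h3⟩)
      · exact Or.inr (Or.inr ⟨h2, c, h4, h3⟩)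
  have l12 : E1 ∧ E2 → G12 ∨ (G01 ∧ G02) ∨ (G13 ∧ G23) := by
    rintro ⟨h0, c, h1⟩
    rcases linked ht (hT 2) h0 ⟨c, (f20 c).mpr h1⟩ with ⟨c, h2, h3⟩ | ⟨b, hb, ⟨c, h2, h3⟩, d, h4, h5⟩
    · exact Or.inl ⟨c, h2, (f20 c).mp h3⟩
    · have : b = 0 ∨ b = 1 := by omega
      rcases this with rfl | rfl
      · rw [flip_flip] at h3 h5
        exact Or.inr (Or.inl ⟨⟨c, h3, h2⟩, d, h5, (f20 d).mp h4⟩)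
      · exact Or.inr (Or.inr ⟨⟨c, h2, (f10 c).mp h3⟩, d, (f20 d).mp h4, (f10 d).mp h5⟩)
  have l13 : E1 ∧ E3 → G13 ∨ (G01 ∧ G03) ∨ (G12 ∧ G23) := by
    rintro ⟨h0, c, h1⟩
    rcases linked ht (hT 1) h0 ⟨c, (f10 c).mpr h1⟩ with ⟨c, h2, h3⟩ | ⟨b, hb, ⟨c, h2, h3⟩, d, h4, h5⟩
    · exact Or.inl ⟨c, h2, (f10 c).mp h3⟩
    · have : b = 0 ∨ b = 2 := by omega
      rcases this with rfl | rfl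
      · rw [flip_flip] at h3 h5
        exact Or.inr (Or.inl ⟨⟨c, h3, h2⟩, d, h5, (f10 d).mp h4⟩)
      · exact Or.inr (Or.inr ⟨⟨c, h2, (f20 c).mp h3⟩, d, (f20 d).mp h5, (f10 d).mp h4⟩)
  have l23 : E2 ∧ E3 → G23 ∨ (G02 ∧ G03) ∨ (G12 ∧ G13) := by
    rintro ⟨h0, c, h1⟩
    rcases linked ht (hT 0) h0 ⟨c, (f01 c).mpr h1⟩ with ⟨c, h2, h3⟩ | ⟨b, hb, ⟨c, h2, h3⟩, d, h4, h5⟩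
    · exact Or.inl ⟨c, h2, (f01 c).mp h3⟩
    · have : b = 1 ∨ b = 2 := by omega
      rcases this with rfl | rfl
      · rw [flip_flip] at h3 h5
        exact Or.inr (Or.inl ⟨⟨c, h3, h2⟩, d, h5, (f01 d).mp h4⟩)
      · exact Or.inr (Or.inr ⟨⟨c, (f21 c).mp h3, h2⟩, d, (f21 d).mp h5, (f01 d).mp h4⟩)
  have key := four_vertex_ind all
    (fun ⟨c, h, h'⟩ => ⟨⟨c, h⟩, c, h'⟩) (fun ⟨c, h, h'⟩ => ⟨⟨c, h⟩, c, h'⟩)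
    (fun ⟨c, h, h'⟩ => ⟨⟨c, h⟩, c, h'⟩) (fun ⟨c, h, h'⟩ => ⟨⟨c, h⟩, c, h'⟩)
    (fun ⟨c, h, h'⟩ => ⟨⟨c, h⟩, c, h'⟩) (fun ⟨c, h, h'⟩ => ⟨⟨c, h⟩, c, h'⟩)
    opp0 opp1 opp2 tri3 tri2 tri1 tri0 l01 l02 l03 l12 l13 l23
  simp only [isDiagonalAlong_iff, isTwoDiagAlong_iff, ht, true_and, hX, hD, f20, f10, f01]
  omega

/-! ### Tools for counting -/

theorem ncard_eq_sum {α ι : Type*} {A : Set α} (hA : A.Finite) (S : Finset ι) (R : ι → α → Prop)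
    (h : ∀ a ∈ A, ∃ i ∈ S, R i a ∧ ∀ j ∈ S, R j a → j = i) :
    A.ncard = ∑ i ∈ S, {a | a ∈ A ∧ R i a}.ncard := by
  classical
  have e : ∀ i, {a | a ∈ A ∧ R i a}.ncard = (hA.toFinset.filter (R i)).card := by
    intro i
    rw [← Set.ncard_coe_finset]
    congr 1
    ext a
    simp
  simp only [e]
  rw [Set.ncard_eq_toFinset_card A hA]
  rw [← Finset.card_biUnion]
  · congr 1
    ext a
    simp only [Set.Finite.mem_toFinset, Finset.mem_biUnion, Finset.mem_filter]
    constructor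
    · intro ha
      obtain ⟨i, hi, hR, -⟩ := h a ha
      exact ⟨i, hi, ha, hR⟩
    · rintro ⟨i, hi, ha, -⟩
      exact ha
  · intro i hi j hj hij
    refine Finset.disjoint_left.mpr fun a ha ha' => ?_
    simp only [Set.Finite.mem_toFinset, Finset.mem_filter] at ha ha'
    obtain ⟨k, -, -, hk⟩ := h a ha.1
    exact hij ((hk i hi ha.2).trans (hk j hj ha'.2).symm)

theorem ncard_eq_of_inverse {α β : Type*} {A : Set α} {B : Set β} (f : α → β) (g : β → α)
    (hf : ∀ a ∈ A, f a ∈ B) (hg : ∀ b ∈ B, g b ∈ A) (hgf : ∀ a ∈ A, g (f a) = a)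
    (hfg : ∀ b ∈ B, f (g b) = b) : A.ncard = B.ncard :=
  Set.BijOn.ncard_eq (Set.InvOn.bijOn (f' := g) ⟨fun a ha => hgf a ha, fun b hb => hfg b hb⟩ hf hg)

theorem finite_of_subset_Icc {A : Set (Finset Cell)} (lo hi : Cell)
    (h : ∀ P ∈ A, ∀ c ∈ P, c ∈ Set.Icc lo hi) : A.Finite := by
  refine Set.Finite.subset (Finset.finite_toSet (Finset.Icc lo hi).powerset) fun P hP => ?_
  rw [Finset.mem_coe, Finset.mem_powerset]
  exact fun c hc => Finset.mem_Icc.mpr (h P hP c hc)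

/-- The cell with natural coordinates `n`. -/
def cell (n : Fin 3 →₀ ℕ) : Cell := fun i => (n i : ℤ)

theorem cell_zero : cell 0 = 0 := by
  funext i
  simp [cell]

theorem cell_nonneg (n : Fin 3 →₀ ℕ) : 0 ≤ cell n := fun i => Int.natCast_nonneg (n i)

theorem cell_injective : Function.Injective cell := by
  intro m n h
  ext i
  have := congrFun h i
  simp only [cell] at this
  exact_mod_cast this

theorem exists_cell {c : Cell} (h : 0 ≤ c) : ∃ n, cell n = c := by
  refine ⟨Finsupp.equivFunOnFinite.symm fun i => (c i).toNat, funext fun i => ?_⟩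
  simp only [cell, Finsupp.equivFunOnFinite_symm_apply_apply]
  exact Int.toNat_of_nonneg (h i)

theorem cell_add (m n : Fin 3 →₀ ℕ) : cell (m + n) = cell m + cell n := by
  funext i
  simp [cell]

theorem cell_sub_single {n : Fin 3 →₀ ℕ} {i : Fin 3} (h : n i ≠ 0) :
    cell (n - Finsupp.single i 1) = cell n - Pi.single i 1 := by
  funext j
  by_cases hj : j = i
  · subst hj
    simp [cell]
    omega
  · simp [cell, hj]

/-! ### Recursions for corner-polyominoes and stairs -/

/-- The number of corner-polyominoes with the last cell of the prism as corner. -/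
noncomputable def cornerCount (n : Fin 3 →₀ ℕ) : ℕ :=
  {P | Tight 0 (cell n) P ∧ cell n ∈ P}.ncard

/-- The number of hooks with the last cell of the prism as corner. -/
noncomputable def hookCount (n : Fin 3 →₀ ℕ) : ℕ :=
  {P | Tight 0 (cell n) P ∧ cell n ∈ P ∧ 2 ≤ degree P (cell n)}.ncard

/-- The number of stairs. -/
noncomputable def stairCount (n : Fin 3 →₀ ℕ) : ℕ := {S | IsStair 0 (cell n) S}.ncard

theorem finite_tight (lo hi : Cell) : {P | Tight lo hi P}.Finite :=
  finite_of_subset_Icc lo hi fun _ hP => hP.1.subset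

theorem finite_tight_and (lo hi : Cell) (p : Finset Cell → Prop) :
    {P | Tight lo hi P ∧ p P}.Finite :=
  (finite_tight lo hi).subset fun _ hP => hP.1

theorem tight_self_iff {c : Cell} {P : Finset Cell} : Tight c c P ↔ P = {c} := by
  constructor
  · intro h
    obtain ⟨d, hd, -⟩ := h.1.touches_lo 0
    have all : ∀ d ∈ P, d = c := fun d hd =>
      le_antisymm (h.1.subset d hd).2 (h.1.subset d hd).1
    exact Finset.eq_singleton_iff_unique_mem.mpr ⟨all d hd ▸ hd, all⟩
  · rintro rfl
    have := tight_row (lo := c) (hi := c) (c := c) le_rfl 0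
    simpa [row] using this

theorem Tight.insert_hi {lo hi : Cell} {i : Fin 3} {Q : Finset Cell}
    (h : Tight lo (hi - Pi.single i 1) Q) (hm : hi - Pi.single i 1 ∈ Q) :
    Tight lo hi (insert hi Q) := by
  have hle : hi - Pi.single i 1 ≤ hi := sub_le_self _ (Pi.single_nonneg.mpr zero_le_one)
  have hr := tight_row (c := hi) hle i
  have m : hi - Pi.single i 1 ∈ row (hi - Pi.single i 1) hi hi i :=
    mem_row.mpr ⟨le_rfl, hle i, fun j hj => by simp [hj]⟩
  convert h.union hr hm m (lo := lo) (hi := hi) (fun j => ?_) using 1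
  · ext d
    rw [Finset.mem_insert, Finset.mem_union, or_comm, mem_row]
    constructor
    · rintro (hd | rfl)
      · exact Or.inl hd
      · exact Or.inr ⟨hle i, le_rfl, fun _ _ => rfl⟩
    · rintro (hd | ⟨h1, h2, h3⟩)
      · exact Or.inl hd
      · simp only [Pi.sub_apply, Pi.single_eq_same] at h1
        by_cases e : d i = hi i
        · right
          funext j
          by_cases hj : j = i
          · rw [hj, e]
          · exact h3 j hj
        · left
          convert hm using 1
          funext j
          by_cases hj : j = i
          · subst hj; simp; omega
          · simp [hj, h3 j hj]
  · have h1 : lo j ≤ (hi - Pi.single i 1 : Cell) j := h.1.le j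
    by_cases hj : j = i
    · subst hj
      simp at h1 ⊢
      omega
    · simp [hj] at h1 ⊢
      omega

/-- Every shortest path that leaves the corner passes through its only neighbour. -/
theorem le_sub_single_of_unique {lo hi : Cell} {P : Finset Cell} (h : Tight lo hi P) (hm : hi ∈ P)
    {i : Fin 3} (hu : ∀ j, hi - Pi.single j 1 ∈ P → j = i) {d : Cell} (hd : d ∈ P) (hne : d ≠ hi) :
    d ≤ hi - Pi.single i 1 := by
  have hdle := (h.1.subset d hd).2
  obtain ⟨j, ⟨h1, -⟩ | ⟨h1, h2⟩⟩ := h.geodesic hi hm d hd hne.symm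
  · have : d j ≤ hi j := hdle j
    omega
  · obtain rfl := hu j h2
    intro k
    have : d k ≤ hi k := hdle k
    by_cases hk : k = j
    · subst hk; simp; omega
    · simpa [hk]

theorem cornerCount_zero : cornerCount 0 = 1 := by
  rw [cornerCount]
  have : {P | Tight 0 (cell 0) P ∧ cell 0 ∈ P} = {{0}} := by
    ext P
    simp only [cell_zero, tight_self_iff, Set.mem_ofPred_eq, Set.mem_singleton_iff]
    exact ⟨fun h => h.1, by rintro rfl; simp⟩
  rw [this, Set.ncard_singleton]

theorem hookCount_eq_zero {n : Fin 3 →₀ ℕ} {a i : Fin 3} (hai : a ≠ i) (ha : n a = 0)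
    (hi : n i = 0) : hookCount n = 0 := by
  rw [hookCount, Set.ncard_eq_zero (finite_tight_and _ _ _), Set.eq_empty_iff_forall_notMem]
  rintro P ⟨ht, -, h2⟩
  obtain ⟨j, k, hjk, hj, hk⟩ := (two_le_degree_hi ht.1.subset).mp h2
  have e1 := ht.1.lo_le hj j
  have e2 := ht.1.lo_le hk k
  simp only [Pi.sub_apply, Pi.single_eq_same, cell, Pi.zero_apply] at e1 e2
  have : j ≠ a := by rintro rfl; omega
  have : k ≠ a := by rintro rfl; omega
  have : j ≠ i := by rintro rfl; omega
  have : k ≠ i := by rintro rfl; omega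
  omega

/-- When the corner has degree one, its neighbour is a central cell. Erasing the corner leaves the
part below this neighbour, a corner-polyomino of the smaller box, and inserting the corner again is
the inverse. -/
theorem cornerCount_step {n : Fin 3 →₀ ℕ} (i : Fin 3) :
    {P | (Tight 0 (cell n) P ∧ cell n ∈ P ∧ ¬ 2 ≤ degree P (cell n)) ∧
      cell n - Pi.single i 1 ∈ P}.ncard =
      if n i = 0 then 0 else cornerCount (n - Finsupp.single i 1) := by
  split_ifs with hn
  · rw [Set.ncard_eq_zero ((finite_tight 0 (cell n)).subset fun P h => h.1.1),
      Set.eq_empty_iff_forall_notMem]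
    rintro P ⟨⟨ht, -, -⟩, hm⟩
    have := ht.1.lo_le hm i
    simp [cell, hn] at this
  · rw [cornerCount, cell_sub_single hn]
    have hne : cell n - Pi.single i 1 ≠ cell n := fun h => by
      have := congrFun h i
      simp at this
    have hle : cell n - Pi.single i 1 ≤ cell n :=
      sub_le_self _ (Pi.single_nonneg.mpr zero_le_one)
    refine ncard_eq_of_inverse (fun P => P.erase (cell n)) (fun Q => insert (cell n) Q) ?_ ?_ ?_ ?_
    · rintro P ⟨⟨ht, hm, hd⟩, hmi⟩
      have hu : ∀ j, cell n - Pi.single j 1 ∈ P → j = i := by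
        intro j hj
        by_contra hji
        exact hd ((two_le_degree_hi ht.1.subset).mpr ⟨j, i, hji, hj, hmi⟩)
      have hc : Central P (cell n - Pi.single i 1) := by
        refine ⟨hmi, fun d hd => ?_⟩
        by_cases e : d = cell n
        · exact Or.inr (e ▸ hle)
        · exact Or.inl (le_sub_single_of_unique ht hm hu hd e)
      have e : P.erase (cell n) = part P 0 (cell n - Pi.single i 1) := by
        ext d
        rw [Finset.mem_erase, mem_part]
        constructor
        · rintro ⟨h1, h2⟩
          exact ⟨h2, (ht.1.subset d h2).1, le_sub_single_of_unique ht hm hu h2 h1⟩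
        · rintro ⟨h1, -, h2⟩
          refine ⟨?_, h1⟩
          rintro rfl
          exact hne (le_antisymm hle h2)
      refine ⟨?_, Finset.mem_erase.mpr ⟨hne, hmi⟩⟩
      simp only [e]
      exact (Central.tight ht hc).1
    · rintro Q ⟨ht, hm⟩
      have ht' := ht.insert_hi hm
      refine ⟨⟨ht', Finset.mem_insert_self _ _, fun hd => ?_⟩, Finset.mem_insert_of_mem hm⟩
      obtain ⟨j, k, hjk, hj, hk⟩ := (two_le_degree_hi ht'.1.subset).mp hd
      have key : ∀ j, cell n - Pi.single j 1 ∈ insert (cell n) Q → j = i := by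
        intro j hj
        rcases Finset.mem_insert.mp hj with h | h
        · have := congrFun h j
          simp at this
        · by_contra hji
          have := ht.1.le_hi h i
          simp [Ne.symm hji] at this
      exact hjk ((key j hj).trans (key k hk).symm)
    · rintro P ⟨⟨-, hm, -⟩, -⟩
      exact Finset.insert_erase hm
    · rintro Q ⟨ht, -⟩
      refine Finset.erase_insert fun h => ?_
      exact hne (le_antisymm hle (ht.1.subset _ h).2)

/-- The three terms are the possible degrees of the corner: at least two for a hook, zero for a
single cell, and one, where the corner is removed and the sum runs over the direction of its
neighbour. -/
theorem cornerCount_eq (n : Fin 3 →₀ ℕ) : cornerCount n = hookCount n + (if n = 0 then 1 else 0) +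
    ∑ i, if n i = 0 then 0 else cornerCount (n - Finsupp.single i 1) := by
  by_cases h0 : n = 0
  · subst h0
    rw [cornerCount_zero, hookCount_eq_zero (show (0 : Fin 3) ≠ 1 by decide) rfl rfl]
    simp
  rw [if_neg h0, add_zero]
  have hsplit : {P | Tight 0 (cell n) P ∧ cell n ∈ P} =
      {P | Tight 0 (cell n) P ∧ cell n ∈ P ∧ 2 ≤ degree P (cell n)} ∪
      {P | Tight 0 (cell n) P ∧ cell n ∈ P ∧ ¬ 2 ≤ degree P (cell n)} := by
    ext P
    simp only [Set.mem_ofPred_eq, Set.mem_union]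
    tauto
  rw [cornerCount, hsplit, Set.ncard_union_eq ?_ (finite_tight_and _ _ _) (finite_tight_and _ _ _),
    hookCount, ncard_eq_sum (A := {P | Tight 0 (cell n) P ∧ cell n ∈ P ∧ ¬ 2 ≤ degree P (cell n)})
      (finite_tight_and _ _ _) Finset.univ (fun i P => cell n - Pi.single i 1 ∈ P)]
  · simp only [Set.mem_ofPred_eq, cornerCount_step]
  · rintro P ⟨ht, hm, hd⟩
    have hex : ∃ d ∈ P, d ≠ cell n := by
      obtain ⟨i, hi⟩ : ∃ i, n i ≠ 0 := by
        by_contra! h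
        exact h0 (Finsupp.ext h)
      obtain ⟨d, hd, e⟩ := ht.1.touches_lo i
      refine ⟨d, hd, ?_⟩
      rintro rfl
      simp [cell] at e
      exact hi e
    obtain ⟨d, hdP, hne⟩ := hex
    obtain ⟨j, ⟨h1, -⟩ | ⟨h1, h2⟩⟩ := ht.geodesic _ hm d hdP hne.symm
    · have := ht.1.le_hi hdP j
      omega
    · refine ⟨j, Finset.mem_univ j, h2, fun k _ hk => ?_⟩
      by_contra hkj
      exact hd ((two_le_degree_hi ht.1.subset).mpr ⟨k, j, hkj, hk, h2⟩)
  · rw [Set.disjoint_left]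
    rintro P ⟨-, -, h⟩ ⟨-, -, h'⟩
    exact h' h

theorem IsStair.snoc {p q : Cell} {S : Finset Cell} (i : Fin 3)
    (h : IsStair p (q - Pi.single i 1) S) : IsStair p q (insert q S) := by
  obtain ⟨n, f, h0, hn, hs, rfl⟩ := h
  refine ⟨n + 1, fun m => if m = n + 1 then q else f m, ?_, by simp, ?_, ?_⟩
  · simpa using h0
  · intro m hm
    rcases Nat.lt_succ_iff_lt_or_eq.mp hm with hm | rfl
    · obtain ⟨j, hj⟩ := hs m hm
      refine ⟨j, ?_⟩
      simp only
      rw [if_neg (by omega), if_neg (by omega), hj]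
    · refine ⟨i, ?_⟩
      simp [hn]
  · rw [Finset.range_add_one (n := n + 1), Finset.image_insert, if_pos rfl]
    congr 1
    refine Finset.image_congr fun m hm => ?_
    simp only [Finset.coe_range, Set.mem_Iio] at hm
    rw [if_neg (by omega)]

theorem IsStair.exists_erase {p q : Cell} {S : Finset Cell} (h : IsStair p q S) (hne : p ≠ q) :
    ∃ i, IsStair p (q - Pi.single i 1) (S.erase q) := by
  obtain ⟨n, f, h0, hn, hs, rfl⟩ := h
  rcases Nat.eq_zero_or_pos n with rfl | hpos
  · exact absurd (h0.symm.trans hn) hne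
  obtain ⟨n, rfl⟩ : ∃ m, n = m + 1 := ⟨n - 1, by omega⟩
  obtain ⟨i, hi⟩ := hs n (Nat.lt_succ_self n)
  have hst : IsStair p (q - Pi.single i 1) ((Finset.range (n + 1)).image f) := by
    refine ⟨n, f, h0, ?_, fun m hm => hs m (by omega), rfl⟩
    rw [← hn, hi]
    simp
  refine ⟨i, ?_⟩
  convert hst using 1
  rw [Finset.range_add_one (n := n + 1), Finset.image_insert, hn, Finset.erase_insert]
  intro hq
  have := (hst.mem.2.2 q hq).2 i
  simp at this

theorem finite_stair (p q : Cell) : {S | IsStair p q S}.Finite :=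
  finite_of_subset_Icc p q fun _ hS c hc => hS.mem.2.2 c hc

/-- A stair is counted as a set of cells, so its last step has to be read off from the set. This is
possible because all cells except the last are below the last but one, which excludes the other
lower neighbours of the end. -/
theorem stairCount_eq (n : Fin 3 →₀ ℕ) : stairCount n = (if n = 0 then 1 else 0) +
    ∑ i, if n i = 0 then 0 else stairCount (n - Finsupp.single i 1) := by
  by_cases h0 : n = 0
  · subst h0
    have : {S | IsStair 0 (cell 0) S} = {{0}} := by
      ext S
      simp only [cell_zero, Set.mem_ofPred_eq, Set.mem_singleton_iff]
      constructor
      · intro h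
        obtain ⟨h1, -, h2⟩ := h.mem
        exact Finset.eq_singleton_iff_unique_mem.mpr
          ⟨h1, fun d hd => le_antisymm (h2 d hd).2 (h2 d hd).1⟩
      · rintro rfl
        exact IsStair.refl 0
    rw [stairCount, this]
    simp
  rw [if_neg h0, zero_add, stairCount, ncard_eq_sum (finite_stair _ _) Finset.univ
      (fun i P => cell n - Pi.single i 1 ∈ P)]
  · refine Finset.sum_congr rfl fun i _ => ?_
    have hne0 : (0 : Cell) ≠ cell n := fun h => h0 (cell_injective (h.symm.trans cell_zero.symm))
    have huniq : ∀ i j (S : Finset Cell), IsStair 0 (cell n - Pi.single j 1) (S.erase (cell n)) →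
        cell n - Pi.single i 1 ∈ S → i = j := by
      intro i j S hS hm
      by_contra hij
      have hm' : cell n - Pi.single i 1 ∈ S.erase (cell n) := by
        refine Finset.mem_erase.mpr ⟨fun h => ?_, hm⟩
        have := congrFun h i
        simp at this
      have := (hS.mem.2.2 _ hm').2 j
      simp [Ne.symm hij] at this
    split_ifs with hn
    · rw [Set.ncard_eq_zero ((finite_stair _ _).subset fun S h => h.1),
        Set.eq_empty_iff_forall_notMem]
      rintro S ⟨hS, hm⟩
      have := (hS.mem.2.2 _ hm).1 i
      simp [cell, hn] at this
    · rw [stairCount, cell_sub_single hn]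
      refine ncard_eq_of_inverse (fun P => P.erase (cell n)) (fun Q => insert (cell n) Q)
        ?_ ?_ ?_ ?_
      · rintro S ⟨hS, hm⟩
        obtain ⟨j, hj⟩ := hS.exists_erase hne0
        obtain rfl := huniq i j S hj hm
        exact hj
      · intro S hS
        exact ⟨IsStair.snoc i hS, Finset.mem_insert_of_mem hS.mem.2.1⟩
      · rintro S ⟨hS, -⟩
        exact Finset.insert_erase hS.mem.2.1
      · intro S hS
        refine Finset.erase_insert fun h => ?_
        have := (hS.mem.2.2 _ h).2 i
        simp at this
  · intro S hS
    have hne0 : (0 : Cell) ≠ cell n := fun h => h0 (cell_injective (h.symm.trans cell_zero.symm))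
    obtain ⟨j, hj⟩ := hS.exists_erase hne0
    refine ⟨j, Finset.mem_univ j, Finset.mem_of_mem_erase hj.mem.2.1, fun i _ hi => ?_⟩
    by_contra hij
    have hm' : cell n - Pi.single i 1 ∈ S.erase (cell n) := by
      refine Finset.mem_erase.mpr ⟨fun h => ?_, hi⟩
      have := congrFun h i
      simp at this
    have := (hj.mem.2.2 _ hm').2 j
    simp [Ne.symm hij] at this

/-! ### The number of hooks of each kind -/

theorem ncard_mirror {A B : Set (Finset Cell)} (τ : Cell) (ε : Fin 3 → Bool)
    (h : ∀ P, P ∈ A ↔ mirrorSet τ ε P ∈ B) : A.ncard = B.ncard := by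
  refine ncard_eq_of_inverse (mirrorSet τ ε) (mirrorSet τ ε) (fun P hP => (h P).mp hP)
    (fun P hP => ?_) (fun P _ => mirrorSet_mirrorSet τ ε P) (fun P _ => mirrorSet_mirrorSet τ ε P)
  rw [h, mirrorSet_mirrorSet]
  exact hP

theorem lo_mem_iff (lo hi : Cell) (P : Finset Cell) :
    hi - lo ∈ mirrorSet hi allTrue P ↔ lo ∈ P := by
  rw [mem_mirrorSet, mirror_allTrue, sub_sub_cancel]

theorem tight_mirrorSet_hi (lo hi : Cell) (P : Finset Cell) :
    Tight 0 (hi - lo) (mirrorSet hi allTrue P) ↔ Tight lo hi P := by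
  rw [← tight_mirrorSet_allTrue (τ := hi) (lo := lo) (hi := hi), sub_self]

theorem degree_mirrorSet_hi (lo hi : Cell) (P : Finset Cell) :
    degree (mirrorSet hi allTrue P) (hi - lo) = degree P lo := by
  rw [← mirror_allTrue, degree_mirrorSet]

theorem ncard_corner_lo {lo hi : Cell} {r : Fin 3 →₀ ℕ} (h : hi - lo = cell r) :
    {R | Tight lo hi R ∧ lo ∈ R}.ncard = cornerCount r := by
  refine ncard_mirror hi allTrue fun P => ?_
  simp only [Set.mem_ofPred_eq, ← h, tight_mirrorSet_hi, lo_mem_iff]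

theorem ncard_hook_lo {lo hi : Cell} {r : Fin 3 →₀ ℕ} (h : hi - lo = cell r) :
    {R | Tight lo hi R ∧ lo ∈ R ∧ 2 ≤ degree R lo}.ncard = hookCount r := by
  refine ncard_mirror hi allTrue fun P => ?_
  simp only [Set.mem_ofPred_eq, ← h, tight_mirrorSet_hi, lo_mem_iff, degree_mirrorSet_hi]

theorem ncard_isCornerPoly (n : Fin 3 →₀ ℕ) :
    {P | IsCornerPoly 0 (cell n) 0 P}.ncard = cornerCount n := by
  rw [← ncard_corner_lo (sub_zero (cell n))]
  simp only [isCornerPoly_iff, isVertex_lo, true_and]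

theorem finite_isCornerPoly (lo hi v : Cell) : {P | IsCornerPoly lo hi v P}.Finite :=
  (finite_tight lo hi).subset fun _ hP => (isCornerPoly_iff.mp hP).2.1

/-- A reflection moves the corner to the first cell. Tripods and hooks of degree two are told apart
by the degree, and both need all sides at least two, unlike 2D hooks. -/
theorem hookCount_eq (n : Fin 3 →₀ ℕ) : hookCount n =
    {P | IsTripod 0 (cell n) 0 P}.ncard + {P | IsDegTwo 0 (cell n) 0 P}.ncard +
      {P | IsTwoDHook 0 (cell n) 0 P}.ncard := by
  have hle := cell_nonneg n
  have e : {P | Tight 0 (cell n) P ∧ 0 ∈ P ∧ 2 ≤ degree P 0} =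
      {P | IsTripod 0 (cell n) 0 P} ∪ {P | IsDegTwo 0 (cell n) 0 P} ∪
        {P | IsTwoDHook 0 (cell n) 0 P} := by
    ext P
    have := isHook_iff (P := P) (v := 0) hle
    simp only [isVertex_lo, true_and, IsHook] at this
    simp only [Set.mem_ofPred_eq, Set.mem_union, or_assoc]
    exact this.symm
  have f1 : {P | IsTripod 0 (cell n) 0 P}.Finite :=
    (finite_isCornerPoly 0 (cell n) 0).subset fun P hP => hP.1
  have f2 : {P | IsDegTwo 0 (cell n) 0 P}.Finite :=
    (finite_isCornerPoly 0 (cell n) 0).subset fun P hP => hP.2.1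
  have f3 : {P | IsTwoDHook 0 (cell n) 0 P}.Finite :=
    (finite_isCornerPoly 0 (cell n) 0).subset fun P hP => (IsTwoDHook.isCornerPoly hle hP).1
  rw [← ncard_hook_lo (sub_zero (cell n)), e, Set.ncard_union_eq ?_ (f1.union f2) f3,
    Set.ncard_union_eq ?_ f1 f2]
  · rw [Set.disjoint_left]
    intro P h1 h2
    have h1 := h1.2
    have h2 := h2.2.2
    omega
  · rw [Set.disjoint_left]
    rintro P h1 ⟨-, a, ha, -⟩
    have key : ∀ i, 0 < cell n i := by
      rcases h1 with h1 | h1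
      · intro i
        have ht := (isCornerPoly_iff.mp h1.1).2.1
        exact lt_of_inward_mem ht.1.subset (isVertex_lo _ _)
          ((degree_eq_three_iff ht.1.subset (isVertex_lo _ _)).mp h1.2 i)
      · exact h1.1
    exact absurd ha (key a).ne

/-- For each pair of directions every cell agrees with the corner in one of the two coordinates, so
it differs from the corner in at most one coordinate. -/
theorem isTripod_iff {n : Fin 3 →₀ ℕ} {P : Finset Cell} :
    IsTripod 0 (cell n) 0 P ↔ (∀ i, n i ≠ 0) ∧ P = cross 0 (cell n) 0 := by
  have h0 : (0 : Cell) ∈ Set.Icc 0 (cell n) := ⟨le_rfl, cell_nonneg n⟩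
  rw [IsTripod, isCornerPoly_iff]
  constructor
  · rintro ⟨⟨hv, ht, hm⟩, hd⟩
    have h3 := (degree_eq_three_iff ht.1.subset hv).mp hd
    have hn : ∀ i, n i ≠ 0 := by
      intro i hi
      have : (0 : Cell) i < cell n i := lt_of_inward_mem ht.1.subset hv (h3 i)
      simp [cell, hi] at this
    refine ⟨hn, CrossCentral.eq_cross ht ⟨hm, fun d hd => ?_⟩⟩
    have h01 := ht.laminar.corner ht.1.subset hv hm (show (0 : Fin 3) ≠ 1 by decide) (h3 0) (h3 1) hd
    have h02 := ht.laminar.corner ht.1.subset hv hm (show (0 : Fin 3) ≠ 2 by decide) (h3 0) (h3 2) hd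
    have h12 := ht.laminar.corner ht.1.subset hv hm (show (1 : Fin 3) ≠ 2 by decide) (h3 1) (h3 2) hd
    simp only [Fin.exists_fin_succ, Fin.forall_fin_succ]
    simp
    simp at h01 h02 h12
    tauto
  · rintro ⟨hn, rfl⟩
    have ht := tight_cross' h0
    refine ⟨⟨isVertex_lo _ _, ht, (crossCentral_cross h0).1⟩, ?_⟩
    refine (degree_eq_three_iff ht.1.subset (isVertex_lo _ _)).mpr fun i => ?_
    rw [inward_lo]
    refine (mem_cross h0).mpr ⟨⟨fun j => ?_, fun j => ?_⟩, i, fun j hj => by simp [hj]⟩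
    · by_cases hj : j = i
      · subst hj; simp
      · simp [hj]
    · have := hn j
      by_cases hj : j = i
      · subst hj; simp [cell]; omega
      · simp [hj, cell]

theorem ncard_isTripod (n : Fin 3 →₀ ℕ) :
    {P | IsTripod 0 (cell n) 0 P}.ncard = if ∀ i, n i ≠ 0 then 1 else 0 := by
  simp only [isTripod_iff]
  split_ifs with h <;> simp [h]

theorem isTwoDHook_zero_iff {n : Fin 3 →₀ ℕ} {a i j : Fin 3} (hai : a ≠ i) (haj : a ≠ j)
    (hij : i ≠ j) {P : Finset Cell} (ha : n a = 0) : IsTwoDHook 0 (cell n) 0 P ↔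
      n i ≠ 0 ∧ n j ≠ 0 ∧ P = row 0 (cell n) 0 i ∪ row 0 (cell n) 0 j := by
  rw [isTwoDHook_iff (cell_nonneg n)]
  have hz : ∀ k, (0 : Cell) k = cell n k ↔ n k = 0 := fun k => by simp [cell]; omega
  have hp : ∀ k, (0 : Cell) k < cell n k ↔ n k ≠ 0 := fun k => by simp [cell]; omega
  simp only [hz, hp, isVertex_lo, true_and]
  constructor
  · rintro ⟨a', i', j', h1, h2, h3, h4, h5, h6, rfl⟩
    have : i' ≠ a := by rintro rfl; exact h5 ha
    have : j' ≠ a := by rintro rfl; exact h6 ha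
    have : (i' = i ∧ j' = j) ∨ (i' = j ∧ j' = i) := by omega
    rcases this with ⟨rfl, rfl⟩ | ⟨rfl, rfl⟩
    · exact ⟨h5, h6, rfl⟩
    · exact ⟨h6, h5, Finset.union_comm _ _⟩
  · rintro ⟨h1, h2, rfl⟩
    exact ⟨a, i, j, hai, haj, hij, ha, h1, h2, rfl⟩

theorem ncard_isTwoDHook_of_zero {n : Fin 3 →₀ ℕ} {a i j : Fin 3} (hai : a ≠ i) (haj : a ≠ j)
    (hij : i ≠ j) (ha : n a = 0) : {P | IsTwoDHook 0 (cell n) 0 P}.ncard =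
      if n i ≠ 0 ∧ n j ≠ 0 then 1 else 0 := by
  simp only [isTwoDHook_zero_iff hai haj hij ha]
  split_ifs with h
  · simp [h.1, h.2]
  · have : ∀ P : Finset Cell, ¬(n i ≠ 0 ∧ n j ≠ 0 ∧ P = row 0 (cell n) 0 i ∪ row 0 (cell n) 0 j) :=
      fun P hP => h ⟨hP.1, hP.2.1⟩
    simp [this]

theorem ncard_isTwoDHook_of_ne_zero {n : Fin 3 →₀ ℕ} (h : ∀ i, n i ≠ 0) :
    {P | IsTwoDHook 0 (cell n) 0 P}.ncard = 0 := by
  have : ∀ P, ¬ IsTwoDHook 0 (cell n) 0 P := by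
    rintro P ⟨-, a, ha, -⟩
    simp [cell] at ha
    exact h a (by exact_mod_cast ha.symm)
  simp [this]

theorem ncard_isTwoDHook (n : Fin 3 →₀ ℕ) : {P | IsTwoDHook 0 (cell n) 0 P}.ncard =
    (if n 0 = 0 ∧ n 1 ≠ 0 ∧ n 2 ≠ 0 then 1 else 0) + (if n 1 = 0 ∧ n 0 ≠ 0 ∧ n 2 ≠ 0 then 1 else 0) +
      (if n 2 = 0 ∧ n 0 ≠ 0 ∧ n 1 ≠ 0 then 1 else 0) := by
  by_cases h0 : n 0 = 0
  · rw [ncard_isTwoDHook_of_zero (i := 1) (j := 2) (by decide) (by decide) (by decide) h0]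
    simp [h0]
  by_cases h1 : n 1 = 0
  · rw [ncard_isTwoDHook_of_zero (i := 0) (j := 2) (by decide) (by decide) (by decide) h1]
    simp [h0, h1]
  by_cases h2 : n 2 = 0
  · rw [ncard_isTwoDHook_of_zero (i := 0) (j := 1) (by decide) (by decide) (by decide) h2]
    simp [h0, h1, h2]
  · rw [ncard_isTwoDHook_of_ne_zero]
    · simp [h0, h1, h2]
    · intro i
      fin_cases i <;> assumption

theorem isDegTwo_false {n : Fin 3 →₀ ℕ} {a : Fin 3} (ha : n a = 0) (P : Finset Cell) :
    ¬ IsDegTwo 0 (cell n) 0 P := by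
  rintro ⟨h, -⟩
  have := h a
  simp [cell, ha] at this

/-- The number of hooks in a flat prism. -/
theorem hookCount_flat {n : Fin 3 →₀ ℕ} {a i j : Fin 3} (hai : a ≠ i) (haj : a ≠ j) (hij : i ≠ j)
    (ha : n a = 0) : hookCount n = if n i ≠ 0 ∧ n j ≠ 0 then 1 else 0 := by
  rw [hookCount_eq, ncard_isTripod, if_neg (fun h => h a ha), ncard_isTwoDHook_of_zero hai haj hij ha]
  simp [isDegTwo_false ha]

theorem cell_erase (n : Fin 3 →₀ ℕ) (a : Fin 3) :
    cell (n.erase a) = Function.update (cell n) a 0 := by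
  funext i
  by_cases h : i = a
  · subst h; simp [cell]
  · simp [cell, h]

/-! ### Corner-polyominoes with a corner of degree two -/

section DegTwo

variable {n : Fin 3 →₀ ℕ} {a : Fin 3} {P : Finset Cell}

/-- `P` consists of the row through the first cell in direction `a` and of a part in the plane
perpendicular to it. -/
def RowAndPlane (a : Fin 3) (P : Finset Cell) : Prop :=
  Pi.single a 1 ∈ P ∧ ∀ d ∈ P, d a = 0 ∨ ∀ i, i ≠ a → d i = 0

/-- Let the corner have neighbours in directions `i` and `j`, so that each cell vanishes in `i` or
in `j`. If neither direction carried an isolated row, there would be cells off the third plane both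
with positive `i` and with positive `j`; with the corner and its neighbour in direction `i` they
fill four quadrants. If two directions carried isolated rows, a cell reaching the far face in the
third direction would force a third neighbour. -/
theorem exists_rowAndPlane (hP : IsDegTwo 0 (cell n) 0 P) :
    ∃ a, RowAndPlane a P ∧ ∀ b, RowAndPlane b P → b = a := by
  obtain ⟨hn, hc, hd⟩ := hP
  obtain ⟨hv, ht, hm⟩ := isCornerPoly_iff.mp hc
  have hsub := ht.1.subset
  obtain ⟨i, j, hij, hi, hj⟩ := (two_le_degree_lo hsub).mp hd.ge
  rw [zero_add] at hi hj
  obtain ⟨k, hki, hkj⟩ : ∃ k, k ≠ i ∧ k ≠ j := by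
    clear * - hij
    revert i j
    decide
  have corner : ∀ d ∈ P, d i = 0 ∨ d j = 0 := fun d hd =>
    ht.laminar.corner hsub hv hm hij (by rwa [inward_lo, zero_add]) (by rwa [inward_lo, zero_add]) hd
  have pos : ∀ d ∈ P, ∀ l, 0 ≤ d l := fun d hd l => ht.1.lo_le hd l
  have hex : ∃ a, RowAndPlane a P := by
    by_contra! hno
    have h1 : ∃ d ∈ P, 0 < d i ∧ 0 < d k := by
      by_contra! hcon
      refine hno i ⟨hi, fun d hd => or_iff_not_imp_left.mpr fun hdi l hl => ?_⟩
      have : l = j ∨ l = k := by omega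
      rcases this with h | h
      · rw [h]; exact (corner d hd).resolve_left hdi
      · have := hcon d hd (by have := pos d hd i; omega)
        have := pos d hd k
        rw [h]; omega
    have h2 : ∃ d ∈ P, 0 < d j ∧ 0 < d k := by
      by_contra! hcon
      refine hno j ⟨hj, fun d hd => or_iff_not_imp_left.mpr fun hdj l hl => ?_⟩
      have : l = i ∨ l = k := by omega
      rcases this with h | h
      · rw [h]; exact (corner d hd).resolve_right hdj
      · have := hcon d hd (by have := pos d hd j; omega)
        have := pos d hd k
        rw [h]; omega
    obtain ⟨d, hd, d1, d2⟩ := h1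
    obtain ⟨d', hd', d1', d2'⟩ := h2
    have := corner d' hd'
    exact ht.laminar i k hki.symm 0 0 0 hm d' hd' _ hi d hd le_rfl le_rfl (by omega) d2' (by simp)
      (by simp [hki]) d1 d2
  obtain ⟨a, ha⟩ := hex
  refine ⟨a, ha, fun b hb => ?_⟩
  by_contra hba
  obtain ⟨c, hca, hcb, hall⟩ : ∃ c, c ≠ a ∧ c ≠ b ∧ ∀ l : Fin 3, l = a ∨ l = b ∨ l = c := by
    clear * - hba
    revert a b
    decide
  obtain ⟨d, hdP, e⟩ := ht.1.touches_hi c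
  have hn' : 0 < cell n c := hn c
  have da := (ha.2 d hdP).resolve_right fun h => by have := h c hca; omega
  have db := (hb.2 d hdP).resolve_right fun h => by have := h c hcb; omega
  obtain ⟨l, hl, hle⟩ := lt_of_ne_of_le (c := 0) (d := d) (fun l => pos d hdP l)
    (by rintro rfl; simp at e; omega) ht.geodesic hm hdP
  rw [zero_add] at hl hle
  have hl1 : 1 ≤ d l := by simpa using hle l
  have : degree P 0 = 3 := (degree_eq_three_iff hsub hv).mpr fun m => by
    rw [inward_lo, zero_add]
    rcases hall m with rfl | rfl | rfl
    · exact ha.1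
    · exact hb.1
    · rcases hall l with rfl | rfl | rfl
      · omega
      · omega
      · exact hl
  omega

/-- Cutting off the row leaves a corner-polyomino of the plane. All of them occur except the two
full rows, which would complete the corner to degree three; this exception is the `+ 1`. -/
theorem ncard_rowAndPlane (hn : ∀ i, n i ≠ 0) (a : Fin 3) :
    {P | IsDegTwo 0 (cell n) 0 P ∧ RowAndPlane a P}.ncard + 1 = cornerCount (n.erase a) := by
  obtain ⟨i, j, hai, haj, hij⟩ := exists_other_two a
  set m := n.erase a with hm
  have hle := cell_nonneg n
  have hma : cell m a = 0 := by simp [hm, cell]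
  have hmo : ∀ l, l ≠ a → cell m l = cell n l := fun l hl => by simp [hm, cell, hl]
  have hpos : ∀ l, 0 < cell n l := fun l => by have := hn l; simp [cell]; omega
  have h0m : (0 : Cell) ∈ Set.Icc 0 (cell m) := ⟨le_rfl, cell_nonneg m⟩
  have h0n : (0 : Cell) ∈ Set.Icc 0 (cell n) := ⟨le_rfl, hle⟩
  have hslice : sliceHi (cell n) a 0 = cell m := by rw [hm, cell_erase]; rfl
  have hflat : Tight 0 (cell m) (row 0 (cell m) 0 i ∪ row 0 (cell m) 0 j) :=
    tight_flat h0m hai haj hij hma.symm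
  have hflatm : row 0 (cell m) 0 i ∪ row 0 (cell m) 0 j ∈ {Q | Tight 0 (cell m) Q ∧ 0 ∈ Q} :=
    ⟨hflat, Finset.mem_union_left _ (self_mem_row h0m i)⟩
  rw [← ncard_corner_lo (sub_zero (cell m)),
    ← Set.ncard_sdiff_singleton_add_one hflatm (finite_tight_and _ _ _)]
  congr 1
  have hrow : ∀ d, d ∈ row 0 (cell n) 0 a ↔ 0 ≤ d a ∧ d a ≤ cell n a ∧ ∀ l, l ≠ a → d l = 0 :=
    fun d => mem_row
  have two : ∀ P, IsDegTwo 0 (cell n) 0 P ∧ RowAndPlane a P → TwoCentral a P 0 := by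
    rintro P ⟨⟨-, hc, -⟩, -, hP⟩
    obtain ⟨hv, ht, h0⟩ := isCornerPoly_iff.mp hc
    refine ⟨h0, fun d hd => ?_⟩
    rcases hP d hd with h | h
    · exact Or.inr ⟨h, Or.inr (ht.1.subset d hd).1⟩
    · exact Or.inl h
  refine ncard_eq_of_inverse (fun P => part P 0 (cell m)) (fun Q => Q ∪ row 0 (cell n) 0 a)
    ?_ ?_ ?_ ?_
  · rintro P hP
    have htwo := two P hP
    obtain ⟨⟨-, hc, hd⟩, ha, -⟩ := hP
    obtain ⟨hv, ht, h0⟩ := isCornerPoly_iff.mp hc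
    have h2 := (htwo.tight ht).2.1
    rw [hslice] at h2
    refine ⟨⟨h2, mem_part.mpr ⟨h0, le_rfl, cell_nonneg m⟩⟩, fun heq => ?_⟩
    have heq : part P 0 (cell m) = row 0 (cell m) 0 i ∪ row 0 (cell m) 0 j := heq
    have inP : ∀ l, l ≠ a → Pi.single l 1 ∈ row 0 (cell m) 0 l := fun l hl =>
      mem_row.mpr ⟨by simp, by rw [hmo l hl]; simp; have := hpos l; omega, fun k hk => by simp [hk]⟩
    have : degree P 0 = 3 := (degree_eq_three_iff ht.1.subset hv).mpr fun l => by
      rw [inward_lo, zero_add]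
      have : l = a ∨ l = i ∨ l = j := by omega
      rcases this with rfl | rfl | rfl
      · exact ha
      · exact (mem_part.mp (heq ▸ Finset.mem_union_left _ (inP _ hai.symm))).1
      · exact (mem_part.mp (heq ▸ Finset.mem_union_right _ (inP _ haj.symm))).1
    omega
  · rintro Q ⟨⟨ht, h0⟩, hne⟩
    have hQa : ∀ d ∈ Q, d a = 0 := fun d hd => by
      have h1 := ht.1.lo_le hd a
      have h2 := ht.1.le_hi hd a
      rw [hma] at h2
      exact le_antisymm h2 h1
    have htP : Tight 0 (cell n) (Q ∪ row 0 (cell n) 0 a) := by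
      refine ht.union (tight_row hle a) h0 (self_mem_row h0n a) fun l => ?_
      have := hpos l
      by_cases hl : l = a
      · subst hl
        rw [hma]
        simp only [Function.update_self, Pi.zero_apply]
        omega
      · rw [hmo l hl]
        simp only [Function.update_of_ne hl, Pi.zero_apply]
        omega
    have ha : Pi.single a 1 ∈ row 0 (cell n) 0 a :=
      mem_row.mpr ⟨by simp, by simp; have := hpos a; omega, fun k hk => by simp [hk]⟩
    have hmem0 : (0 : Cell) ∈ Q ∪ row 0 (cell n) 0 a := Finset.mem_union_left _ h0
    have hunit : ∀ l, l ≠ a → (Pi.single l 1 ∈ Q ∪ row 0 (cell n) 0 a ↔ Pi.single l 1 ∈ Q) := by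
      intro l hl
      rw [Finset.mem_union, hrow]
      refine or_iff_left fun h => ?_
      have := h.2.2 l hl
      simp at this
    refine ⟨⟨hpos, isCornerPoly_iff.mpr ⟨isVertex_lo _ _, htP, hmem0⟩, ?_⟩,
      Finset.mem_union_right _ ha, fun d hd => ?_⟩
    · have hge : 2 ≤ degree (Q ∪ row 0 (cell n) 0 a) 0 := by
        rw [two_le_degree_lo htP.1.subset]
        obtain ⟨d, hd, e⟩ := ht.1.touches_hi i
        rw [hmo i hai.symm] at e
        obtain ⟨l, hl, -⟩ := lt_of_ne_of_le (c := 0) (d := d) (ht.1.subset d hd).1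
          (by rintro rfl; have := hpos i; simp at e; omega) ht.geodesic h0 hd
        refine ⟨a, l, ?_, by rw [zero_add]; exact Finset.mem_union_right _ ha,
          Finset.mem_union_left _ hl⟩
        rintro rfl
        have := hQa _ hl
        simp at this
      have hne3 : degree (Q ∪ row 0 (cell n) 0 a) 0 ≠ 3 := by
        intro h3
        rw [degree_eq_three_iff htP.1.subset (isVertex_lo _ _)] at h3
        refine hne (ht.eq_rows_of_flat (isVertex_lo _ _) h0 hai haj hij hma.symm ?_ ?_)
        · have := h3 i
          rw [inward_lo, zero_add] at this ⊢
          exact (hunit i hai.symm).mp this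
        · have := h3 j
          rw [inward_lo, zero_add] at this ⊢
          exact (hunit j haj.symm).mp this
      have := degree_le_three htP.1.subset (isVertex_lo _ _)
      omega
    · rcases Finset.mem_union.mp hd with h | h
      · exact Or.inl (hQa d h)
      · exact Or.inr ((hrow d).mp h).2.2
  · intro P hP
    have htwo := two P hP
    obtain ⟨⟨-, hc, hd⟩, ha, hP⟩ := hP
    obtain ⟨hv, ht, h0⟩ := isCornerPoly_iff.mp hc
    have hsub := (htwo.tight ht).2.2
    ext d
    rw [Finset.mem_union, mem_part]
    constructor
    · rintro (h | h)
      · exact h.1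
      · exact hsub h
    · intro hd
      have hb := ht.1.subset d hd
      rcases hP d hd with h | h
      · refine Or.inl ⟨hd, hb.1, fun l => ?_⟩
        by_cases hl : l = a
        · subst hl; rw [hma, h]
        · rw [hmo l hl]; exact hb.2 l
      · exact Or.inr ((hrow d).mpr ⟨hb.1 a, hb.2 a, h⟩)
  · rintro Q ⟨⟨ht, h0⟩, hne⟩
    ext d
    rw [mem_part, Finset.mem_union]
    constructor
    · rintro ⟨h | h, h1, h2⟩
      · exact h
      · have : d = 0 := by
          funext l
          by_cases hl : l = a
          · subst hl
            have h3 : d l ≤ cell m l := h2 l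
            have h4 : (0 : Cell) l ≤ d l := h1 l
            rw [hma] at h3
            exact le_antisymm h3 h4
          · exact ((hrow d).mp h).2.2 l hl
        rw [this]
        exact h0
    · intro h
      exact ⟨Or.inl h, ht.1.subset d h⟩

theorem ncard_isDegTwo (hn : ∀ i, n i ≠ 0) : {P | IsDegTwo 0 (cell n) 0 P}.ncard + 3 =
    ∑ a, cornerCount (n.erase a) := by
  have hfin : {P | IsDegTwo 0 (cell n) 0 P}.Finite :=
    (finite_isCornerPoly 0 (cell n) 0).subset fun P hP => hP.2.1
  rw [ncard_eq_sum hfin Finset.univ RowAndPlane]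
  · simp only [← ncard_rowAndPlane hn, Finset.sum_add_distrib, Set.mem_ofPred_eq]
    simp
  · intro P hP
    obtain ⟨a, ha, hu⟩ := exists_rowAndPlane hP
    exact ⟨a, Finset.mem_univ a, ha, fun b _ hb => hu b hb⟩

end DegTwo

/-! ### The number of diagonal polyominoes along one diagonal -/

/-- `c` is the end of `P` at the last cell `T`, or two cells of `P` follow it. -/
def IsLast (T : Cell) (P : Finset Cell) (c : Cell) : Prop :=
  c = T ∨ ∃ i j, i ≠ j ∧ c + Pi.single i 1 ∈ P ∧ c + Pi.single j 1 ∈ P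

/-- A central cell strictly above `c` must exceed `c` in both directions `i` and `j`; together with
`c` and the two cells that follow it, all four quadrants would be filled. -/
theorem Central.eq_of_isLast_of_le {lo T c c' : Cell} {P : Finset Cell} (ht : Tight lo T P)
    (hc : Central P c) (hl : IsLast T P c) (hc' : Central P c') (hle : c ≤ c') : c = c' := by
  rcases hl with rfl | ⟨i, j, hij, hi, hj⟩
  · exact le_antisymm hle (ht.1.subset c' hc'.1).2
  by_contra hne
  have key : ∀ i, c + Pi.single i 1 ∈ P → c i < c' i := by
    intro i hi
    by_contra! hlt
    have : c' ≤ c := by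
      rcases hc'.2 _ hi with h | h
      · have : (c + Pi.single i 1 : Cell) i ≤ c' i := h i
        simp at this
        omega
      · intro k
        by_cases hk : k = i
        · subst hk; exact hlt
        · have : c' k ≤ (c + Pi.single i 1 : Cell) k := h k
          simpa [hk] using this
    exact hne (le_antisymm hle this)
  exact ht.laminar i j hij (c i) (c j) c hc.1 _ hj _ hi c' hc'.1 le_rfl le_rfl (by simp [hij])
    (by simp) (by simp) (by simp [hij.symm]) (key i hi) (key j hj)

theorem Central.eq_of_isLast {lo T c c' : Cell} {P : Finset Cell} (ht : Tight lo T P)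
    (hc : Central P c) (hl : IsLast T P c) (hc' : Central P c') (hl' : IsLast T P c') : c = c' := by
  rcases hc.2 c' hc'.1 with h | h
  · exact (Central.eq_of_isLast_of_le ht hc' hl' hc h).symm
  · exact Central.eq_of_isLast_of_le ht hc hl hc' h

/-- The last summand stands for the absent hook: when the stair reaches the end, only the end cell
remains above `c`. -/
theorem ncard_upper {c T : Cell} {r : Fin 3 →₀ ℕ} (h : T - c = cell r) :
    {R | Tight c T R ∧ c ∈ R ∧ (c = T ∨ 2 ≤ degree R c)}.ncard =
      hookCount r + if r = 0 then 1 else 0 := by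
  by_cases hr : r = 0
  · have hc : c = T := by
      rw [hr, cell_zero, sub_eq_zero] at h
      exact h.symm
    subst hc
    simp only [true_or, and_true]
    rw [ncard_corner_lo (h.trans (by rw [hr])), if_pos hr, hr, cornerCount_zero,
      hookCount_eq_zero (show (0 : Fin 3) ≠ 1 by decide) rfl rfl]
  · have hc : c ≠ T := by
      rintro rfl
      rw [sub_self, ← cell_zero] at h
      exact hr (cell_injective h.symm)
    simp only [hc, false_or]
    rw [ncard_hook_lo h, if_neg hr, add_zero]

theorem isLast_iff {lo c T : Cell} {P : Finset Cell} (ht : Tight lo T P) :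
    IsLast T P c ↔ c = T ∨ 2 ≤ degree (part P c T) c := by
  rw [IsLast, two_le_degree_lo fun d hd => (mem_part.mp hd).2]
  have : ∀ i, c + Pi.single i 1 ∈ part P c T ↔ c + Pi.single i 1 ∈ P := fun i => by
    rw [mem_part]
    exact ⟨fun h => h.1, fun h => ⟨h, le_add_of_nonneg_right (Pi.single_nonneg.mpr zero_le_one),
      (ht.1.subset _ h).2⟩⟩
  simp only [this]

theorem part_union_lower {lo c T : Cell} {A B : Finset Cell} (hA : Tight lo c A) (hc : c ∈ A)
    (hB : Tight c T B) : part (A ∪ B) lo c = A := by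
  ext d
  rw [mem_part, Finset.mem_union]
  constructor
  · rintro ⟨h | h, h1, h2⟩
    · exact h
    · exact le_antisymm h2 (hB.1.subset d h).1 ▸ hc
  · exact fun h => ⟨Or.inl h, hA.1.subset d h⟩

theorem part_union_upper {lo c T : Cell} {A B : Finset Cell} (hA : Tight lo c A)
    (hB : Tight c T B) (hc : c ∈ B) : part (A ∪ B) c T = B := by
  ext d
  rw [mem_part, Finset.mem_union]
  constructor
  · rintro ⟨h | h, h1, h2⟩
    · exact le_antisymm h1 (hA.1.subset d h).2 ▸ hc
    · exact h
  · exact fun h => ⟨Or.inr h, hB.1.subset d h⟩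

theorem Tight.append {lo c T : Cell} {A B : Finset Cell} (hA : Tight lo c A) (hcA : c ∈ A)
    (hB : Tight c T B) (hcB : c ∈ B) : Tight lo T (A ∪ B) ∧ Central (A ∪ B) c := by
  refine ⟨hA.union hB hcA hcB fun i => ?_, Finset.mem_union_left _ hcA, fun d hd => ?_⟩
  · have h1 : lo i ≤ c i := hA.1.le i
    have h2 : c i ≤ T i := hB.1.le i
    omega
  · rcases Finset.mem_union.mp hd with h | h
    · exact Or.inl (hA.1.subset d h).2
    · exact Or.inr (hB.1.subset d h).1

/-- Cut at the last central cell, which is unique. The part below it is an arbitrary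
corner-polyomino, already containing the stair and the first hook; the part above is independently a
hook or a single cell. -/
theorem ncard_central (n : Fin 3 →₀ ℕ) : {P | Tight 0 (cell n) P ∧ ∃ c, Central P c}.ncard =
    ∑ p ∈ Finset.HasAntidiagonal.antidiagonal n,
      cornerCount p.1 * (hookCount p.2 + if p.2 = 0 then 1 else 0) := by
  rw [ncard_eq_sum (finite_tight_and _ _ _) (Finset.HasAntidiagonal.antidiagonal n)
    (fun p P => Central P (cell p.1) ∧ IsLast (cell n) P (cell p.1))]
  · refine Finset.sum_congr rfl fun p hp => ?_
    rw [Finset.HasAntidiagonal.mem_antidiagonal] at hp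
    have hr : cell n - cell p.1 = cell p.2 := by
      rw [← hp, cell_add, add_sub_cancel_left]
    rw [cornerCount, ← ncard_upper hr, ← Set.ncard_prod]
    refine ncard_eq_of_inverse (fun P => (part P 0 (cell p.1), part P (cell p.1) (cell n)))
      (fun Q => Q.1 ∪ Q.2) ?_ ?_ ?_ ?_
    · rintro P ⟨⟨ht, -⟩, hc, hl⟩
      obtain ⟨h1, h2⟩ := Central.tight ht hc
      have hb := ht.1.subset _ hc.1
      exact ⟨⟨h1, mem_part.mpr ⟨hc.1, hb.1, le_rfl⟩⟩, h2, mem_part.mpr ⟨hc.1, le_rfl, hb.2⟩,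
        (isLast_iff ht).mp hl⟩
    · rintro ⟨A, B⟩ ⟨⟨hA, hcA⟩, hB, hcB, hd⟩
      obtain ⟨ht, hc⟩ := hA.append hcA hB hcB
      refine ⟨⟨ht, _, hc⟩, hc, (isLast_iff ht).mpr ?_⟩
      simp only
      rw [part_union_upper hA hB hcB]
      exact hd
    · rintro P ⟨⟨ht, -⟩, hc, hl⟩
      ext d
      rw [Finset.mem_union, mem_part, mem_part]
      constructor
      · rintro (h | h) <;> exact h.1
      · intro hd
        have hb := ht.1.subset d hd
        exact (hc.2 d hd).imp (fun h => ⟨hd, hb.1, h⟩) (fun h => ⟨hd, h, hb.2⟩)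
    · rintro ⟨A, B⟩ ⟨⟨hA, hcA⟩, hB, hcB, hd⟩
      exact Prod.ext (part_union_lower hA hcA hB) (part_union_upper hA hB hcB)
  · rintro P ⟨ht, c, hc⟩
    obtain ⟨q, hq, -, hl, -⟩ := Central.exists_up ht hc
    have hb := ht.1.subset q hq.1
    obtain ⟨m, rfl⟩ := exists_cell hb.1
    obtain ⟨r, hr⟩ := exists_cell (sub_nonneg.mpr hb.2)
    have hmr : m + r = n := cell_injective (by rw [cell_add, hr, add_sub_cancel])
    refine ⟨(m, r), Finset.HasAntidiagonal.mem_antidiagonal.mpr hmr, ⟨hq, hl⟩, ?_⟩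
    rintro ⟨m', r'⟩ hp ⟨h1, h2⟩
    have e : m' = m := cell_injective (Central.eq_of_isLast ht h1 h2 hq hl)
    rw [Finset.HasAntidiagonal.mem_antidiagonal] at hp
    simp only at hp
    rw [e, ← hmr] at hp
    exact Prod.ext e (add_left_cancel hp)

/-! ### The number of generic forms and of crosses -/

/-- Reflecting the coordinate `a` alone moves the slice to height zero, so its height does not
matter. -/
theorem ncard_sliceLo (q : Fin 3 →₀ ℕ) (a : Fin 3) :
    {L | Tight (sliceLo a (cell q)) (cell q) L ∧ cell q ∈ L}.ncard = cornerCount (q.erase a) := by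
  refine ncard_mirror (cell q) (fun i => decide (i = a)) fun P => ?_
  have e : mirror (cell q) (fun i => decide (i = a)) (cell (q.erase a)) = cell q := by
    funext i
    by_cases h : i = a
    · subst h; simp [mirror, cell]
    · simp [mirror, cell, h]
  rw [Set.mem_ofPred_eq, Set.mem_ofPred_eq, mem_mirrorSet, e, tight_mirrorSet_iff]
  intro i
  by_cases h : i = a
  · subst h; simp [cell]
  · simp [cell, h]

theorem TwoCentral.pillar {T c : Cell} {a : Fin 3} {P : Finset Cell} (ht : Tight 0 T P)
    (h : TwoCentral a P c) : Pillar T a P c :=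
  ⟨h.1, fun d hd hne => (h.2 d hd).resolve_right fun h' => hne h'.1, (h.tight ht).2.2⟩

theorem twoCentral_union {T c : Cell} {a : Fin 3} {L U : Finset Cell} (hcT : c ∈ Set.Icc 0 T)
    (hL : Tight (sliceLo a c) c L) (hcL : c ∈ L) (hU : Tight c (sliceHi T a c) U) (hcU : c ∈ U) :
    Tight 0 T (L ∪ U ∪ row 0 T c a) ∧ TwoCentral a (L ∪ U ∪ row 0 T c a) c := by
  obtain ⟨hLU, hc⟩ := hL.append hcL hU hcU
  refine ⟨hLU.union (tight_row (hcT.1.trans hcT.2) a) hc.1 (self_mem_row hcT a) fun i => ?_,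
    Finset.mem_union_left _ hc.1, fun d hd => ?_⟩
  · have h1 : 0 ≤ c i := hcT.1 i
    have h2 : c i ≤ T i := hcT.2 i
    by_cases hi : i = a
    · subst hi
      simp only [Function.update_self, Pi.zero_apply]
      omega
    · simp only [Function.update_of_ne hi, Pi.zero_apply]
      omega
  · rcases Finset.mem_union.mp hd with h | h
    · have h1 := hLU.1.lo_le h a
      have h2 := hLU.1.le_hi h a
      simp only [Function.update_self] at h1 h2
      exact Or.inr ⟨by omega, hc.2 d h⟩
    · exact Or.inl (mem_row.mp h).2.2

/-- The pair `p` fixes the centre, after which the two slice parts are chosen independently and the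
pillar is forced. `Pillar.eq` makes the centre unique, which is why a second side of length at least
two is needed. -/
theorem ncard_twoCentral {n : Fin 3 →₀ ℕ} {a : Fin 3} (ha : n a ≠ 0)
    (hi : ∃ i, a ≠ i ∧ n i ≠ 0) : {P | Tight 0 (cell n) P ∧ ∃ c, TwoCentral a P c}.ncard =
      ∑ p ∈ Finset.HasAntidiagonal.antidiagonal n,
        cornerCount (p.1.erase a) * cornerCount (p.2.erase a) := by
  rw [ncard_eq_sum (finite_tight_and _ _ _) (Finset.HasAntidiagonal.antidiagonal n)
    (fun p P => TwoCentral a P (cell p.1))]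
  · refine Finset.sum_congr rfl fun p hp => ?_
    rw [Finset.HasAntidiagonal.mem_antidiagonal] at hp
    have hr : sliceHi (cell n) a (cell p.1) - cell p.1 = cell (p.2.erase a) := by
      rw [← hp]
      funext i
      by_cases h : i = a
      · subst h; simp [cell]
      · simp [cell, h]
    have hcT : cell p.1 ∈ Set.Icc 0 (cell n) := by
      refine ⟨cell_nonneg _, ?_⟩
      rw [← hp, cell_add]
      exact le_add_of_nonneg_right (cell_nonneg _)
    rw [← ncard_sliceLo, ← ncard_corner_lo hr, ← Set.ncard_prod]
    refine ncard_eq_of_inverse (fun P => (part P (sliceLo a (cell p.1)) (cell p.1),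
      part P (cell p.1) (sliceHi (cell n) a (cell p.1))))
      (fun Q => Q.1 ∪ Q.2 ∪ row 0 (cell n) (cell p.1) a) ?_ ?_ ?_ ?_
    · rintro P ⟨⟨ht, -⟩, hc⟩
      obtain ⟨h1, h2, -⟩ := hc.tight ht
      exact ⟨⟨h1, (mem_part_sliceLo ht.1.subset).mpr ⟨hc.1, rfl, le_rfl⟩⟩, h2,
        (mem_part_sliceHi ht.1.subset).mpr ⟨hc.1, rfl, le_rfl⟩⟩
    · rintro ⟨L, U⟩ ⟨⟨hL, hcL⟩, hU, hcU⟩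
      obtain ⟨h1, h2⟩ := twoCentral_union hcT hL hcL hU hcU
      exact ⟨⟨h1, _, h2⟩, h2⟩
    · rintro P ⟨⟨ht, -⟩, hc⟩
      exact (hc.eq_union ht).symm
    · rintro ⟨L, U⟩ ⟨⟨hL, hcL⟩, hU, hcU⟩
      have hsub := (twoCentral_union hcT hL hcL hU hcU).1.1.subset
      have hLa : ∀ d ∈ L, d a = cell p.1 a := fun d hd => by
        have h1 := hL.1.lo_le hd a
        have h2 := hL.1.le_hi hd a
        simp only [Function.update_self] at h1
        omega
      have hUa : ∀ d ∈ U, d a = cell p.1 a := fun d hd => by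
        have h1 := hU.1.lo_le hd a
        have h2 := hU.1.le_hi hd a
        simp only [Function.update_self] at h2
        omega
      have hV : ∀ d ∈ row 0 (cell n) (cell p.1) a, d a = cell p.1 a → d = cell p.1 := by
        intro d hd h
        funext i
        by_cases hi : i = a
        · rw [hi, h]
        · exact (mem_row.mp hd).2.2 i hi
      refine Prod.ext ?_ ?_
      · ext d
        simp only
        rw [mem_part_sliceLo hsub, Finset.mem_union, Finset.mem_union]
        constructor
        · rintro ⟨(h | h) | h, h1, h2⟩
          · exact h
          · exact le_antisymm h2 (hU.1.subset d h).1 ▸ hcL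
          · exact hV d h h1 ▸ hcL
        · exact fun h => ⟨Or.inl (Or.inl h), hLa d h, (hL.1.subset d h).2⟩
      · ext d
        simp only
        rw [mem_part_sliceHi hsub, Finset.mem_union, Finset.mem_union]
        constructor
        · rintro ⟨(h | h) | h, h1, h2⟩
          · exact le_antisymm h2 (hL.1.subset d h).2 ▸ hcU
          · exact h
          · exact hV d h h1 ▸ hcU
        · exact fun h => ⟨Or.inl (Or.inr h), hUa d h, (hU.1.subset d h).1⟩
  · rintro P ⟨ht, c, hc⟩
    have hb := ht.1.subset c hc.1
    obtain ⟨m, rfl⟩ := exists_cell hb.1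
    obtain ⟨r, hr⟩ := exists_cell (sub_nonneg.mpr hb.2)
    have hmr : m + r = n := cell_injective (by rw [cell_add, hr, add_sub_cancel])
    refine ⟨(m, r), Finset.HasAntidiagonal.mem_antidiagonal.mpr hmr, hc, ?_⟩
    rintro ⟨m', r'⟩ hp h1
    have pos : ∀ i, n i ≠ 0 → 0 < cell n i := fun i h => by simp only [cell]; omega
    have e : m' = m := cell_injective ((h1.pillar ht).eq ht (pos a ha)
      (hi.imp fun i h => ⟨h.1, pos i h.2⟩) (hc.pillar ht))
    rw [Finset.HasAntidiagonal.mem_antidiagonal] at hp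
    simp only at hp
    rw [e, ← hmr] at hp
    exact Prod.ext e (add_left_cancel hp)

/-- Every cell of the prism is the centre of one cross, and the pillar in direction 0 determines the
centre. -/
theorem ncard_crossCentral {n : Fin 3 →₀ ℕ} (hn : ∀ i, n i ≠ 0) :
    {P | Tight 0 (cell n) P ∧ ∃ c, CrossCentral P c}.ncard = ∏ i, (n i + 1) := by
  have e : {P | Tight 0 (cell n) P ∧ ∃ c, CrossCentral P c} =
      cross 0 (cell n) '' (Finset.Icc 0 (cell n) : Finset Cell) := by
    ext P
    rw [Set.mem_ofPred_eq, Set.mem_image]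
    constructor
    · rintro ⟨ht, c, hc⟩
      exact ⟨c, Finset.mem_coe.mpr (Finset.mem_Icc.mpr (ht.1.subset c hc.1)),
        (hc.eq_cross ht).symm⟩
    · rintro ⟨c, hc, rfl⟩
      have hc : c ∈ Set.Icc 0 (cell n) := Finset.mem_Icc.mp (Finset.mem_coe.mp hc)
      exact ⟨tight_cross' hc, c, crossCentral_cross hc⟩
  have pos : ∀ i, 0 < cell n i := fun i => by have := hn i; simp only [cell]; omega
  rw [e, Set.InjOn.ncard_image, Set.ncard_coe_finset, Pi.card_Icc]
  · refine Finset.prod_congr rfl fun i _ => ?_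
    simp [cell]
  · intro c hc c' hc' h
    have hc : c ∈ Set.Icc 0 (cell n) := Finset.mem_Icc.mp (Finset.mem_coe.mp hc)
    have hc' : c' ∈ Set.Icc 0 (cell n) := Finset.mem_Icc.mp (Finset.mem_coe.mp hc')
    have ht := tight_cross' hc
    have h1 := (crossCentral_cross hc).centralAlong
    have h2 := (crossCentral_cross hc').centralAlong
    rw [← h] at h2
    exact (pillar_of_centralAlong ht (a := 0) (h1 allFalse) (h1 _)).eq ht (pos 0)
      ⟨1, by decide, pos 1⟩ (pillar_of_centralAlong ht (h2 allFalse) (h2 _))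

/-! ### Summation over all minimal polyominoes -/

theorem ncard_isDiagonalAlong (s : Fin 3 → ℕ) (ε : Fin 3 → Bool) :
    {P | IsDiagonalAlong s ε P}.ncard = {P | Tight 0 (top s) P ∧ ∃ c, Central P c}.ncard := by
  refine ncard_mirror (top s) ε fun P => ?_
  rw [Set.mem_ofPred_eq, Set.mem_ofPred_eq, ← isMainDiagonal_iff]
  rfl

theorem ncard_isTwoDiagAlong (s : Fin 3 → ℕ) (a : Fin 3) (ε : Fin 3 → Bool) :
    {P | IsTwoDiagAlong s a ε P}.ncard =
      {P | Tight 0 (top s) P ∧ ∃ c, TwoCentral a P c}.ncard := by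
  refine ncard_mirror (top s) ε fun P => ?_
  rw [Set.mem_ofPred_eq, Set.mem_ofPred_eq, ← isMainTwoDiag_iff]
  rfl

/-- This is `isDiagonal_count` summed over the finitely many minimal polyominoes. By reflection all
four diagonals contribute equally, as do the two opposite edges of each axis, which explains the
factors four and two. -/
theorem ncard_isDiagonal {s : Fin 3 → ℕ} (hs : ∀ i, 2 ≤ s i) :
    {P | IsDiagonal s P}.ncard + 2 * ∑ a, {P | IsTwoDiagAlong s a allFalse P}.ncard =
      4 * {P | IsDiagonalAlong s allFalse P}.ncard + 3 * {P | IsCross s P}.ncard := by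
  classical
  set M := (finite_tight 0 (top s)).toFinset with hM
  have sum_ind : ∀ A : Finset Cell → Prop, (∀ P, A P → Tight 0 (top s) P) →
      {P | A P}.ncard = ∑ P ∈ M, ind (A P) := by
    intro A hA
    have : {P | A P} = ((M.filter A : Finset (Finset Cell)) : Set (Finset Cell)) := by
      ext P
      simp only [Set.mem_ofPred_eq, Finset.coe_filter, hM, Set.Finite.mem_toFinset]
      exact ⟨fun h => ⟨hA P h, h⟩, fun h => h.2⟩
    rw [this, Set.ncard_coe_finset, Finset.card_filter]
    refine Finset.sum_congr rfl fun P _ => ?_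
    rw [ind]
  have d : ∀ ε, {P | IsDiagonalAlong s ε P}.ncard = ∑ P ∈ M, ind (IsDiagonalAlong s ε P) :=
    fun ε => sum_ind _ fun P h => (isDiagonalAlong_iff.mp h).1
  have t : ∀ a ε, {P | IsTwoDiagAlong s a ε P}.ncard = ∑ P ∈ M, ind (IsTwoDiagAlong s a ε P) :=
    fun a ε => sum_ind _ fun P h => (isTwoDiagAlong_iff.mp h).1
  have key := Finset.sum_congr (rfl : M = M) fun P _ => isDiagonal_count hs P
  simp only [Finset.sum_add_distrib, ← Finset.mul_sum, ← d, ← t] at key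
  rw [← sum_ind _ fun P h => (isCross_iff.mp h).2.1,
    ← sum_ind _ fun P ⟨ε, h⟩ => (isDiagonalAlong_iff.mp h).1] at key
  rw [Fin.sum_univ_three]
  simp only [ncard_isDiagonalAlong, ncard_isTwoDiagAlong] at key ⊢
  omega

/-! ### Power series of families of polyominoes -/

open MvPowerSeries in
theorem coeff_X_mul_eq (i : Fin 3) (f : MvPowerSeries (Fin 3) ℚ) (n : Fin 3 →₀ ℕ) :
    coeff n (X i * f) = if n i = 0 then 0 else coeff (n - Finsupp.single i 1) f := by
  rw [X_def, coeff_monomial_mul, one_mul]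
  by_cases h : n i = 0
  · rw [if_pos h, if_neg]
    intro h'
    have := h' i
    simp [h] at this
  · rw [if_neg h, if_pos]
    exact Finsupp.single_le_iff.mpr (Nat.one_le_iff_ne_zero.mpr h)

/-- The exponent of `xyz`. -/
noncomputable def ones : Fin 3 →₀ ℕ := Finsupp.equivFunOnFinite.symm fun _ => 1

@[simp] theorem ones_apply (i : Fin 3) : ones i = 1 := rfl

/-- The power series `xyz`. -/
noncomputable def xyz : MvPowerSeries (Fin 3) ℚ :=
  MvPowerSeries.X 0 * MvPowerSeries.X 1 * MvPowerSeries.X 2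

theorem xyz_eq : xyz = MvPowerSeries.monomial ones 1 := by
  rw [xyz, MvPowerSeries.X_def, MvPowerSeries.X_def, MvPowerSeries.X_def,
    MvPowerSeries.monomial_mul_monomial, MvPowerSeries.monomial_mul_monomial, one_mul, one_mul]
  have : Finsupp.single 0 1 + Finsupp.single 1 1 + Finsupp.single 2 1 = ones := by
    ext i
    fin_cases i <;> simp
  rw [this]

theorem coeff_xyz_mul_add (f : MvPowerSeries (Fin 3) ℚ) (n : Fin 3 →₀ ℕ) :
    MvPowerSeries.coeff (n + ones) (xyz * f) = MvPowerSeries.coeff n f := by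
  rw [xyz_eq, MvPowerSeries.coeff_monomial_mul, if_pos le_add_self, one_mul, add_tsub_cancel_right]

theorem coeff_xyz_mul_eq_zero (f : MvPowerSeries (Fin 3) ℚ) {n : Fin 3 →₀ ℕ} {i : Fin 3}
    (h : n i = 0) : MvPowerSeries.coeff n (xyz * f) = 0 := by
  rw [xyz_eq, MvPowerSeries.coeff_monomial_mul, if_neg]
  intro h'
  have := h' i
  simp [h] at this

theorem exists_eq_add_ones (n : Fin 3 →₀ ℕ) : (∃ i, n i = 0) ∨ ∃ m, n = m + ones := by
  by_cases h : ∃ i, n i = 0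
  · exact Or.inl h
  · push Not at h
    refine Or.inr ⟨n - ones, ?_⟩
    ext i
    have := h i
    simp
    omega

/-- The sides of the prism of cells `[0, cell n]`. -/
def sides (n : Fin 3 →₀ ℕ) : Fin 3 → ℕ := fun i => n i + 1

theorem top_sides (n : Fin 3 →₀ ℕ) : top (sides n) = cell n := by
  funext i
  simp [top, sides, cell]

/-- The generating function of a family, divided by `xyz`. -/
noncomputable def shifted (F : (Fin 3 → ℕ) → Set (Finset Cell)) : MvPowerSeries (Fin 3) ℚ :=
  fun n => ((F (sides n)).ncard : ℚ)

theorem coeff_shifted (F : (Fin 3 → ℕ) → Set (Finset Cell)) (n : Fin 3 →₀ ℕ) :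
    MvPowerSeries.coeff n (shifted F) = ((F (sides n)).ncard : ℚ) := rfl

/-- A side of length zero makes a coordinate of `top s` equal to -1, so only positive sides
contribute. After division by xyz the exponent `n` belongs to the box `[0, cell n]`. -/
theorem series_eq_xyz_mul {F : (Fin 3 → ℕ) → Set (Finset Cell)}
    (hF : ∀ s P, P ∈ F s → 0 ≤ top s) : series F = xyz * shifted F := by
  ext n
  have h1 : MvPowerSeries.coeff n (series F) = ((F n).ncard : ℚ) := rfl
  rcases exists_eq_add_ones n with ⟨i, hi⟩ | ⟨m, rfl⟩
  · have : F n = ∅ := by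
      rw [Set.eq_empty_iff_forall_notMem]
      intro P hP
      have := hF _ P hP i
      simp [top, hi] at this
    rw [h1, this, coeff_xyz_mul_eq_zero _ hi, Set.ncard_empty, Nat.cast_zero]
  · rw [h1, coeff_xyz_mul_add]
    rfl

theorem Inscribed.nonneg {lo hi : Cell} {P : Finset Cell} (h : Inscribed lo hi P) : lo ≤ hi := by
  obtain ⟨c, hc, -⟩ := h.touches_lo 0
  exact (h.subset c hc).1.trans (h.subset c hc).2

theorem series_isStair : series (fun s => {P | IsStair 0 (top s) P}) =
    xyz * shifted fun s => {P | IsStair 0 (top s) P} :=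
  series_eq_xyz_mul fun s P (h : IsStair 0 (top s) P) => (h.mem.2.2 _ h.mem.2.1).1

theorem series_isTripod : series (fun s => {P | IsTripod 0 (top s) 0 P}) =
    xyz * shifted fun s => {P | IsTripod 0 (top s) 0 P} :=
  series_eq_xyz_mul fun _ _ h => h.1.2.1.1.nonneg

theorem series_isDegTwo : series (fun s => {P | IsDegTwo 0 (top s) 0 P}) =
    xyz * shifted fun s => {P | IsDegTwo 0 (top s) 0 P} :=
  series_eq_xyz_mul fun _ _ h => h.2.1.2.1.1.nonneg

theorem series_isTwoDHook : series (fun s => {P | IsTwoDHook 0 (top s) 0 P}) =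
    xyz * shifted fun s => {P | IsTwoDHook 0 (top s) 0 P} := by
  refine series_eq_xyz_mul fun s P ⟨_, a, ha, h, _⟩ i => ?_
  by_cases hi : i = a
  · exact (hi ▸ ha).le
  · exact (h i hi).le

theorem series_flatCorner (a : Fin 3) :
    series (fun s => {P | s a = 1 ∧ IsCornerPoly 0 (top s) 0 P}) =
      xyz * shifted fun s => {P | s a = 1 ∧ IsCornerPoly 0 (top s) 0 P} :=
  series_eq_xyz_mul fun _ _ h => h.2.2.1.1.nonneg

theorem series_isDiagonalAlong (ε : Fin 3 → Bool) :
    series (fun s => {P | IsDiagonalAlong s ε P}) =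
      xyz * shifted fun s => {P | IsDiagonalAlong s ε P} :=
  series_eq_xyz_mul fun _ _ h => (isDiagonalAlong_iff.mp h).1.1.nonneg

theorem series_isDiagonal : series (fun s => {P | IsDiagonal s P}) =
    xyz * shifted fun s => {P | IsDiagonal s P} :=
  series_eq_xyz_mul fun _ _ ⟨_, h⟩ => (isDiagonalAlong_iff.mp h).1.1.nonneg

theorem series_isTwoDiagAlong (a : Fin 3) (ε : Fin 3 → Bool) :
    series (fun s => {P | IsTwoDiagAlong s a ε P}) =
      xyz * shifted fun s => {P | IsTwoDiagAlong s a ε P} :=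
  series_eq_xyz_mul fun _ _ h => (isTwoDiagAlong_iff.mp h).1.1.nonneg

theorem series_isCross : series (fun s => {P | IsCross s P}) =
    xyz * shifted fun s => {P | IsCross s P} :=
  series_eq_xyz_mul fun _ _ h => h.2.1.1.nonneg

/-- The power series with coefficients `∏ i, g i (n i)`. -/
noncomputable def sep (g : Fin 3 → ℕ → ℚ) : MvPowerSeries (Fin 3) ℚ := fun n => ∏ i, g i (n i)

theorem coeff_sep (g : Fin 3 → ℕ → ℚ) (n : Fin 3 →₀ ℕ) :
    MvPowerSeries.coeff n (sep g) = ∏ i, g i (n i) := rfl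

/-- The coefficients of `(a + b t) g(t)`. -/
def linMul (a b : ℚ) (g : ℕ → ℚ) : ℕ → ℚ
  | 0 => a * g 0
  | m + 1 => a * g (m + 1) + b * g m

/-- A factor that is linear in one variable affects only one factor of the coefficients, so
identities between series in product form become identities between sequences. -/
theorem linear_mul_sep (a b : ℚ) (i : Fin 3) (g : Fin 3 → ℕ → ℚ) :
    (MvPowerSeries.C a + MvPowerSeries.C b * MvPowerSeries.X i) * sep g =
      sep (Function.update g i (linMul a b (g i))) := by
  ext n
  rw [add_mul, mul_assoc, map_add, MvPowerSeries.coeff_C_mul, MvPowerSeries.coeff_C_mul,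
    coeff_X_mul_eq, coeff_sep, coeff_sep, coeff_sep, ← Finset.mul_prod_erase _ _ (Finset.mem_univ i),
    ← Finset.mul_prod_erase _ (fun j => Function.update g i _ j (n j)) (Finset.mem_univ i),
    ← Finset.mul_prod_erase _ (fun j => g j ((n - Finsupp.single i 1 : Fin 3 →₀ ℕ) j))
      (Finset.mem_univ i)]
  have h1 : ∏ j ∈ Finset.univ.erase i, Function.update g i (linMul a b (g i)) j (n j) =
      ∏ j ∈ Finset.univ.erase i, g j (n j) :=
    Finset.prod_congr rfl fun j hj => by rw [Function.update_of_ne (Finset.ne_of_mem_erase hj)]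
  have h2 : ∏ j ∈ Finset.univ.erase i, g j ((n - Finsupp.single i 1 : Fin 3 →₀ ℕ) j) =
      ∏ j ∈ Finset.univ.erase i, g j (n j) :=
    Finset.prod_congr rfl fun j hj => by
      simp [Finsupp.single_eq_of_ne (Finset.ne_of_mem_erase hj)]
  rw [h1, h2, Function.update_self]
  cases h : n i with
  | zero => simp [linMul]; ring
  | succ m => simp [linMul, h]; ring

theorem one_sub_X_mul_sep (i : Fin 3) (g : Fin 3 → ℕ → ℚ) :
    (1 - MvPowerSeries.X i) * sep g = sep (Function.update g i (linMul 1 (-1) (g i))) := by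
  rw [← linear_mul_sep]
  simp [sub_eq_add_neg]

theorem two_sub_X_mul_sep (i : Fin 3) (g : Fin 3 → ℕ → ℚ) :
    (2 - MvPowerSeries.X i) * sep g = sep (Function.update g i (linMul 2 (-1) (g i))) := by
  rw [← linear_mul_sep, map_ofNat, map_neg, map_one, neg_one_mul, ← sub_eq_add_neg]

theorem X_mul_sep (i : Fin 3) (g : Fin 3 → ℕ → ℚ) :
    MvPowerSeries.X i * sep g = sep (Function.update g i (linMul 0 1 (g i))) := by
  rw [← linear_mul_sep]
  simp

theorem one_eq_sep : (1 : MvPowerSeries (Fin 3) ℚ) = sep fun _ m => if m = 0 then 1 else 0 := by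
  ext n
  rw [MvPowerSeries.coeff_one, coeff_sep]
  by_cases h : n = 0
  · simp [h]
  · obtain ⟨i, hi⟩ := Finsupp.ne_iff.mp h
    rw [if_neg h, Finset.prod_eq_zero (Finset.mem_univ i)]
    exact if_neg hi

/-! ### Polynomial identities for the series -/

open MvPowerSeries

/-- The series of the corner counts. -/
noncomputable def cornerSeries : MvPowerSeries (Fin 3) ℚ := fun n => (cornerCount n : ℚ)

/-- The series of the hook counts. -/
noncomputable def hookSeries : MvPowerSeries (Fin 3) ℚ := fun n => (hookCount n : ℚ)

/-- The part of the corner series in which the variable `X a` does not occur. -/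
noncomputable def flatSeries (a : Fin 3) : MvPowerSeries (Fin 3) ℚ :=
  fun n => if n a = 0 then (cornerCount n : ℚ) else 0

/-- The series whose coefficients forget the exponent of `X a`. -/
noncomputable def sliceSeries (a : Fin 3) : MvPowerSeries (Fin 3) ℚ :=
  fun n => (cornerCount (n.erase a) : ℚ)

theorem coeff_cornerSeries (n : Fin 3 →₀ ℕ) : coeff n cornerSeries = (cornerCount n : ℚ) := rfl

theorem coeff_hookSeries (n : Fin 3 →₀ ℕ) : coeff n hookSeries = (hookCount n : ℚ) := rfl

theorem coeff_flatSeries (a : Fin 3) (n : Fin 3 →₀ ℕ) :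
    coeff n (flatSeries a) = if n a = 0 then (cornerCount n : ℚ) else 0 := rfl

theorem coeff_sliceSeries (a : Fin 3) (n : Fin 3 →₀ ℕ) :
    coeff n (sliceSeries a) = (cornerCount (n.erase a) : ℚ) := rfl

theorem coeff_one_sub_sum_mul (f : MvPowerSeries (Fin 3) ℚ) (n : Fin 3 →₀ ℕ) :
    coeff n ((1 - X 0 - X 1 - X 2) * f) =
      coeff n f - ∑ i, if n i = 0 then 0 else coeff (n - Finsupp.single i 1) f := by
  rw [sub_mul, sub_mul, sub_mul, one_mul, map_sub, map_sub, map_sub, coeff_X_mul_eq,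
    coeff_X_mul_eq, coeff_X_mul_eq, Fin.sum_univ_three]
  ring

theorem stair_identity :
    (1 - X 0 - X 1 - X 2) * shifted (fun s => {P | IsStair 0 (top s) P}) = 1 := by
  ext n
  have h : ∀ m, coeff m (shifted fun s => {P | IsStair 0 (top s) P}) = (stairCount m : ℚ) :=
    fun m => by rw [coeff_shifted, top_sides]; rfl
  rw [coeff_one_sub_sum_mul, coeff_one]
  simp only [h]
  rw [stairCount_eq n]
  push_cast
  ring

theorem cornerSeries_identity : (1 - X 0 - X 1 - X 2) * cornerSeries = 1 + hookSeries := by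
  ext n
  rw [coeff_one_sub_sum_mul, map_add, coeff_one]
  simp only [coeff_cornerSeries, coeff_hookSeries]
  rw [cornerCount_eq n]
  push_cast
  ring

theorem coeff_shifted_isDiagonalAlong (ε : Fin 3 → Bool) (n : Fin 3 →₀ ℕ) :
    coeff n (shifted fun s => {P | IsDiagonalAlong s ε P}) =
      ({P | Tight 0 (cell n) P ∧ ∃ c, Central P c}.ncard : ℚ) := by
  rw [coeff_shifted, ncard_isDiagonalAlong, top_sides]

/-- The cut at the last central cell is a convolution; the constant one represents the absent second
hook. -/
theorem shifted_isDiagonalAlong (ε : Fin 3 → Bool) :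
    shifted (fun s => {P | IsDiagonalAlong s ε P}) = cornerSeries * (1 + hookSeries) := by
  ext n
  rw [coeff_shifted_isDiagonalAlong, ncard_central, coeff_mul]
  push_cast
  refine Finset.sum_congr rfl fun p _ => ?_
  rw [map_add, coeff_one, coeff_cornerSeries, coeff_hookSeries]
  ring

theorem hookSeries_eq : hookSeries = shifted (fun s => {P | IsTripod 0 (top s) 0 P}) +
    shifted (fun s => {P | IsDegTwo 0 (top s) 0 P}) +
    shifted (fun s => {P | IsTwoDHook 0 (top s) 0 P}) := by
  ext n
  rw [map_add, map_add, coeff_shifted, coeff_shifted, coeff_shifted, coeff_hookSeries,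
    hookCount_eq, top_sides]
  push_cast
  rfl

theorem prod_ite_one (p : Fin 3 → Prop) [DecidablePred p] :
    ∏ i, (if p i then (1 : ℚ) else 0) = if ∀ i, p i then 1 else 0 := by
  rw [Finset.prod_ite_zero]
  simp

theorem tripod_identity : (1 - X 0) * ((1 - X 1) * ((1 - X 2) *
    shifted (fun s => {P | IsTripod 0 (top s) 0 P}))) = X 0 * (X 1 * (X 2 * 1)) := by
  have : shifted (fun s => {P | IsTripod 0 (top s) 0 P}) =
      sep fun _ m => if m ≠ 0 then 1 else 0 := by
    ext n
    rw [coeff_shifted, top_sides, ncard_isTripod, coeff_sep, prod_ite_one]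
    split_ifs <;> simp
  rw [this, one_sub_X_mul_sep, one_sub_X_mul_sep, one_sub_X_mul_sep, one_eq_sep, X_mul_sep,
    X_mul_sep, X_mul_sep]
  congr 1
  funext i m
  fin_cases i <;> rcases m with _ | _ | m <;> simp [Function.update, linMul]

theorem cross_identity : (1 - X 0) * ((1 - X 0) * ((1 - X 1) * ((1 - X 1) *
    ((1 - X 2) * ((1 - X 2) * shifted (fun s => {P | IsCross s P})))))) =
      X 0 * ((2 - X 0) * (X 1 * ((2 - X 1) * (X 2 * ((2 - X 2) * 1))))) := by
  have : shifted (fun s => {P | IsCross s P}) =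
      sep fun _ m => if m ≠ 0 then (m + 1 : ℚ) else 0 := by
    ext n
    rw [coeff_shifted, coeff_sep]
    by_cases h : ∀ i, n i ≠ 0
    · have h1 : {P | IsCross (sides n) P} = {P | Tight 0 (cell n) P ∧ ∃ c, CrossCentral P c} := by
        ext P
        rw [Set.mem_ofPred_eq, Set.mem_ofPred_eq, isCross_iff, top_sides]
        refine and_iff_right fun i => ?_
        have := h i
        simp only [sides]
        omega
      rw [h1, ncard_crossCentral h]
      push_cast
      exact Finset.prod_congr rfl fun i _ => (if_pos (h i)).symm
    · push Not at h
      obtain ⟨i, hi⟩ := h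
      have h1 : {P | IsCross (sides n) P} = ∅ := by
        rw [Set.eq_empty_iff_forall_notMem]
        intro P hP
        have := hP.1 i
        simp [sides, hi] at this
      rw [h1, Set.ncard_empty, Nat.cast_zero, Finset.prod_eq_zero (Finset.mem_univ i)]
      exact if_neg (not_not.mpr hi)
  rw [this]
  simp only [one_sub_X_mul_sep]
  rw [one_eq_sep]
  simp only [two_sub_X_mul_sep, X_mul_sep]
  congr 1
  funext i m
  -- In each variable this is the identity (1 - t)² ∑_{m ≥ 1} (m + 1) tᵐ = t (2 - t), checked at the
  -- exponents 0, 1, 2 and beyond.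
  fin_cases i <;> rcases m with _ | _ | _ | m <;> simp [Function.update, linMul] <;> ring

/-- The series of the 2D hooks of thickness one in direction `a`. -/
noncomputable def flatHookSeries (a : Fin 3) : MvPowerSeries (Fin 3) ℚ :=
  sep fun i m => if (m = 0 ↔ i = a) then 1 else 0

theorem coeff_flatHookSeries {a i j : Fin 3} (hai : a ≠ i) (haj : a ≠ j) (hij : i ≠ j)
    (n : Fin 3 →₀ ℕ) :
    coeff n (flatHookSeries a) = if n a = 0 ∧ n i ≠ 0 ∧ n j ≠ 0 then 1 else 0 := by
  rw [flatHookSeries, coeff_sep, prod_ite_one]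
  simp only [forall_axes hai haj hij (p := fun k => n k = 0 ↔ k = a), iff_true, hai.symm, haj.symm,
    iff_false]

theorem shifted_isTwoDHook : shifted (fun s => {P | IsTwoDHook 0 (top s) 0 P}) =
    flatHookSeries 0 + flatHookSeries 1 + flatHookSeries 2 := by
  ext n
  rw [map_add, map_add, coeff_shifted, top_sides, ncard_isTwoDHook,
    coeff_flatHookSeries (i := 1) (j := 2) (by decide) (by decide) (by decide),
    coeff_flatHookSeries (i := 0) (j := 2) (by decide) (by decide) (by decide),
    coeff_flatHookSeries (i := 0) (j := 1) (by decide) (by decide) (by decide)]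
  push_cast
  rfl

theorem flatHookSeries_identity {a i j : Fin 3} (hai : a ≠ i) (haj : a ≠ j) (hij : i ≠ j) :
    (1 - X i) * ((1 - X j) * flatHookSeries a) = X i * (X j * 1) := by
  rw [flatHookSeries, one_sub_X_mul_sep, one_sub_X_mul_sep, one_eq_sep, X_mul_sep, X_mul_sep]
  congr 1
  funext k
  have : k = a ∨ k = i ∨ k = j := by omega
  rcases this with rfl | rfl | rfl <;> funext m <;> rcases m with _ | _ | m <;>
    simp [Function.update, linMul, *, Ne.symm]

theorem sum_axes {a i j : Fin 3} (hai : a ≠ i) (haj : a ≠ j) (hij : i ≠ j) {M : Type*}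
    [AddCommMonoid M] (f : Fin 3 → M) : ∑ k, f k = f a + f i + f j := by
  have : (Finset.univ : Finset (Fin 3)) = {a, i, j} := by
    ext k
    simp
    omega
  rw [this, Finset.sum_insert (by simp [hai, haj]), Finset.sum_pair hij, add_assoc]

/-- The recursion of `cornerCount_eq` restricted to exponents without `X a`: the term for direction
`a` vanishes, and the hooks that remain are the 2D hooks. -/
theorem flatSeries_identity {a i j : Fin 3} (hai : a ≠ i) (haj : a ≠ j) (hij : i ≠ j) :
    (1 - X i - X j) * flatSeries a = 1 + flatHookSeries a := by
  ext n
  rw [sub_mul, sub_mul, one_mul, map_sub, map_sub, map_add, coeff_X_mul_eq, coeff_X_mul_eq,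
    coeff_flatSeries, coeff_flatSeries, coeff_flatSeries, coeff_flatHookSeries hai haj hij, coeff_one]
  have hi : (n - Finsupp.single i 1 : Fin 3 →₀ ℕ) a = n a := by simp [hai]
  have hj : (n - Finsupp.single j 1 : Fin 3 →₀ ℕ) a = n a := by simp [haj]
  rw [hi, hj]
  by_cases h : n a = 0
  · have h1 := cornerCount_eq n
    rw [hookCount_flat hai haj hij h, sum_axes hai haj hij, if_pos h, zero_add] at h1
    simp only [h, true_and, if_true, h1]
    push_cast
    ring
  · have : n ≠ 0 := fun h0 => h (by simp [h0])
    simp [h, this]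

theorem sliceSeries_identity (a : Fin 3) : (1 - X a) * sliceSeries a = flatSeries a := by
  ext n
  rw [sub_mul, one_mul, map_sub, coeff_X_mul_eq, coeff_flatSeries, coeff_sliceSeries,
    coeff_sliceSeries]
  by_cases h : n a = 0
  · have : n.erase a = n := by
      ext k
      by_cases hk : k = a
      · subst hk; simp [h]
      · simp [hk]
    rw [if_pos h, if_pos h, this, sub_zero]
  · have : (n - Finsupp.single a 1).erase a = n.erase a := by
      ext k
      by_cases hk : k = a
      · subst hk; simp
      · simp [hk]
    rw [if_neg h, if_neg h, this, sub_self]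

/-- In a single row the recursion has only one term. This makes the formula for hooks of degree two
vanish in flat prisms. -/
theorem cornerCount_row {i j a : Fin 3} (hai : a ≠ i) (haj : a ≠ j) (hij : i ≠ j) :
    ∀ (m : ℕ) (n : Fin 3 →₀ ℕ), n a = m → n i = 0 → n j = 0 → cornerCount n = 1 := by
  intro m
  induction m with
  | zero =>
    intro n ha hi hj
    have : n = 0 := by
      ext k
      exact (forall_axes hai haj hij (p := fun k => n k = 0)).mpr ⟨ha, hi, hj⟩ k
    rw [this, cornerCount_zero]
  | succ m ih =>
    intro n ha hi hj
    have h0 : n ≠ 0 := fun h => by simp [h] at ha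
    rw [cornerCount_eq, hookCount_flat hai.symm hij haj hi, sum_axes hai haj hij,
      ih (n - Finsupp.single a 1) (by simp [ha]) (by simp [hi]) (by simp [hj])]
    simp [h0, hi, hj, ha]

/-- The series with all coefficients one. -/
noncomputable def fullSeries : MvPowerSeries (Fin 3) ℚ := sep fun _ _ => 1

theorem fullSeries_identity : (1 - X 0) * ((1 - X 1) * ((1 - X 2) * fullSeries)) = 1 := by
  rw [fullSeries, one_sub_X_mul_sep, one_sub_X_mul_sep, one_sub_X_mul_sep, one_eq_sep]
  congr 1
  funext i m
  fin_cases i <;> rcases m with _ | m <;> simp [Function.update, linMul]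

/-- Each direction of the isolated row contributes the flat corner-polyominoes perpendicular to it,
less one for the excluded pair of full rows; the factor `X a` says that the row has at least two
cells. -/
theorem shifted_isDegTwo : shifted (fun s => {P | IsDegTwo 0 (top s) 0 P}) =
    X 0 * (sliceSeries 0 - fullSeries) + X 1 * (sliceSeries 1 - fullSeries) +
      X 2 * (sliceSeries 2 - fullSeries) := by
  ext n
  have key : ∀ a, coeff n (X a * (sliceSeries a - fullSeries)) =
      if n a = 0 then 0 else (cornerCount (n.erase a) : ℚ) - 1 := by
    intro a
    have : (n - Finsupp.single a 1).erase a = n.erase a := by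
      ext k
      by_cases hk : k = a
      · subst hk; simp
      · simp [hk]
    rw [coeff_X_mul_eq, map_sub, coeff_sliceSeries, this, fullSeries, coeff_sep,
      Finset.prod_const_one]
  rw [map_add, map_add, key, key, key, coeff_shifted, top_sides]
  by_cases h : ∀ i, n i ≠ 0
  · have h1 := ncard_isDegTwo h
    rw [Fin.sum_univ_three] at h1
    have h2 := congrArg (Nat.cast (R := ℚ)) h1
    push_cast at h2
    rw [if_neg (h 0), if_neg (h 1), if_neg (h 2)]
    linarith
  · push Not at h
    obtain ⟨i, hi⟩ := h
    have h1 : {P | IsDegTwo 0 (cell n) 0 P} = ∅ :=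
      Set.eq_empty_iff_forall_notMem.mpr fun P hP => isDegTwo_false hi P hP
    -- With a second coordinate zero, erasing `a` leaves a single row, which has one
    -- corner-polyomino.
    have h2 : ∀ a, (if n a = 0 then 0 else (cornerCount (n.erase a) : ℚ) - 1) = 0 := by
      intro a
      by_cases ha : n a = 0
      · exact if_pos ha
      · have hai : a ≠ i := fun h => ha (h ▸ hi)
        obtain ⟨j, haj, hij⟩ : ∃ j, a ≠ j ∧ i ≠ j := by
          clear key h1 hi ha
          revert a i
          decide
        rw [if_neg ha, cornerCount_row haj.symm hij.symm hai _ _ rfl (by simp)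
          (by simp [hai.symm, hi])]
        simp
    rw [h1, h2, h2, h2]
    simp

theorem shifted_flatCorner (a : Fin 3) :
    shifted (fun s => {P | s a = 1 ∧ IsCornerPoly 0 (top s) 0 P}) = flatSeries a := by
  ext n
  rw [coeff_shifted, coeff_flatSeries, top_sides]
  by_cases h : n a = 0
  · simp [sides, h, ncard_isCornerPoly]
  · simp [sides, h]

/-- Since the coefficients of `sliceSeries a` forget the exponent of `X a`, the convolution runs
over the height of the centre as well as over its place in the slice. -/
theorem coeff_shifted_isTwoDiagAlong {a : Fin 3} (ε : Fin 3 → Bool) {n : Fin 3 →₀ ℕ}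
    (ha : n a ≠ 0) (hi : ∃ i, a ≠ i ∧ n i ≠ 0) :
    coeff n (shifted fun s => {P | IsTwoDiagAlong s a ε P}) = coeff n (sliceSeries a ^ 2) := by
  rw [coeff_shifted, ncard_isTwoDiagAlong, top_sides, ncard_twoCentral ha hi, sq, coeff_mul]
  push_cast
  rfl

theorem coeff_shifted_isDiagonal (ε : Fin 3 → Bool) {n : Fin 3 →₀ ℕ} (hn : ∀ i, n i ≠ 0) :
    coeff n (shifted fun s => {P | IsDiagonal s P}) =
      coeff n (4 * shifted (fun s => {P | IsDiagonalAlong s ε P}) -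
        2 * (sliceSeries 0 ^ 2 + sliceSeries 1 ^ 2 + sliceSeries 2 ^ 2) +
        3 * shifted fun s => {P | IsCross s P}) := by
  have h1 := ncard_isDiagonal (s := sides n) fun i =>
    Nat.succ_le_succ (Nat.one_le_iff_ne_zero.mpr (hn i))
  have hi : ∀ a : Fin 3, ∃ i, a ≠ i ∧ n i ≠ 0 := fun a => by
    obtain ⟨i, -, h, -⟩ := exists_other_two a
    exact ⟨i, h, hn i⟩
  have h2 := fun a => coeff_shifted_isTwoDiagAlong allFalse (hn a) (hi a)
  have hC : ∀ (k : ℕ) [k.AtLeastTwo] (f : MvPowerSeries (Fin 3) ℚ),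
      coeff n ((OfNat.ofNat k : MvPowerSeries (Fin 3) ℚ) * f) = (OfNat.ofNat k : ℚ) * coeff n f :=
    fun k _ f => by rw [← map_ofNat (C (σ := Fin 3) (R := ℚ)) k, coeff_C_mul]
  simp only [coeff_shifted] at h2
  rw [map_add, map_sub, hC, hC, hC, map_add, map_add, ← h2, ← h2, ← h2, coeff_shifted,
    coeff_shifted, coeff_shifted, ncard_isDiagonalAlong, ← ncard_isDiagonalAlong _ allFalse]
  rw [Fin.sum_univ_three] at h1
  have h3 := congrArg (Nat.cast (R := ℚ)) h1
  push_cast at h3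
  linarith

/-! ### Rational forms in the field of fractions -/

@[simp] theorem toGF_add (f g : MvPowerSeries (Fin 3) ℚ) : toGF (f + g) = toGF f + toGF g :=
  map_add _ _ _

@[simp] theorem toGF_sub (f g : MvPowerSeries (Fin 3) ℚ) : toGF (f - g) = toGF f - toGF g :=
  map_sub _ _ _

@[simp] theorem toGF_mul (f g : MvPowerSeries (Fin 3) ℚ) : toGF (f * g) = toGF f * toGF g :=
  map_mul _ _ _

@[simp] theorem toGF_pow (f : MvPowerSeries (Fin 3) ℚ) (k : ℕ) : toGF (f ^ k) = toGF f ^ k :=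
  map_pow _ _ _

@[simp] theorem toGF_one : toGF 1 = 1 := map_one _

@[simp] theorem toGF_ofNat (k : ℕ) [k.AtLeastTwo] : toGF ofNat(k) = ofNat(k) :=
  map_ofNat (algebraMap _ GF) k

@[simp] theorem toGF_X (i : Fin 3) : toGF (MvPowerSeries.X i) = var i := rfl

@[simp] theorem toGF_xyz : toGF xyz = var 0 * var 1 * var 2 := by
  simp [xyz]

theorem toGF_ne_zero {f : MvPowerSeries (Fin 3) ℚ} (hf : f ≠ 0) : toGF f ≠ 0 := fun h =>
  hf (IsFractionRing.injective (MvPowerSeries (Fin 3) ℚ) GF (h.trans (map_zero _).symm))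

theorem toGF_ne_zero_of_constantCoeff {f : MvPowerSeries (Fin 3) ℚ}
    (hf : MvPowerSeries.constantCoeff f = 1) : toGF f ≠ 0 :=
  toGF_ne_zero fun h => by simp [h] at hf

theorem var_ne_zero (i : Fin 3) : var i ≠ 0 := by
  refine toGF_ne_zero fun h => ?_
  have := congrArg (MvPowerSeries.coeff (Finsupp.single i 1)) h
  simp at this

theorem one_sub_var_ne_zero (i : Fin 3) : 1 - var i ≠ 0 := by
  have := toGF_ne_zero_of_constantCoeff (f := 1 - MvPowerSeries.X i) (by simp)
  simpa using this

theorem one_sub_var_sub_var_ne_zero (i j : Fin 3) : 1 - var i - var j ≠ 0 := by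
  have := toGF_ne_zero_of_constantCoeff (f := 1 - MvPowerSeries.X i - MvPowerSeries.X j) (by simp)
  simpa using this

theorem one_sub_vars_ne_zero : 1 - var 0 - var 1 - var 2 ≠ 0 := by
  have := toGF_ne_zero_of_constantCoeff
    (f := 1 - MvPowerSeries.X 0 - MvPowerSeries.X 1 - MvPowerSeries.X 2) (by simp)
  simpa using this

theorem stair_eq : Stair = var 0 * var 1 * var 2 / (1 - var 0 - var 1 - var 2) := by
  have h := congrArg toGF stair_identity
  simp only [toGF_mul, toGF_sub, toGF_one, toGF_X] at h
  rw [Stair, series_isStair, toGF_mul, toGF_xyz, eq_div_iff one_sub_vars_ne_zero, mul_assoc,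
    mul_comm (toGF _), h, mul_one]

theorem tripod_eq : Tripod = var 0 ^ 2 * var 1 ^ 2 * var 2 ^ 2 /
    ((1 - var 0) * (1 - var 1) * (1 - var 2)) := by
  have h := congrArg toGF tripod_identity
  simp only [toGF_mul, toGF_sub, toGF_one, toGF_X] at h
  rw [Tripod, series_isTripod, toGF_mul, toGF_xyz, eq_div_iff (by simp [one_sub_var_ne_zero])]
  linear_combination var 0 * var 1 * var 2 * h

theorem cross_eq : Cross = var 0 ^ 2 * (2 - var 0) * var 1 ^ 2 * (2 - var 1) * var 2 ^ 2 *
    (2 - var 2) / ((1 - var 0) ^ 2 * (1 - var 1) ^ 2 * (1 - var 2) ^ 2) := by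
  have h := congrArg toGF cross_identity
  simp only [toGF_mul, toGF_sub, toGF_one, toGF_X, toGF_ofNat] at h
  rw [Cross, series_isCross, toGF_mul, toGF_xyz, eq_div_iff (by simp [one_sub_var_ne_zero])]
  linear_combination var 0 * var 1 * var 2 * h

theorem toGF_flatHookSeries {a i j : Fin 3} (hai : a ≠ i) (haj : a ≠ j) (hij : i ≠ j) :
    toGF (flatHookSeries a) = var i * var j / ((1 - var i) * (1 - var j)) := by
  have h := congrArg toGF (flatHookSeries_identity hai haj hij)
  simp only [toGF_mul, toGF_sub, toGF_one, toGF_X] at h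
  rw [eq_div_iff (by simp [one_sub_var_ne_zero])]
  linear_combination h

theorem toGF_fullSeries :
    toGF fullSeries = 1 / ((1 - var 0) * (1 - var 1) * (1 - var 2)) := by
  have h := congrArg toGF fullSeries_identity
  simp only [toGF_mul, toGF_sub, toGF_one, toGF_X] at h
  rw [eq_div_iff (by simp [one_sub_var_ne_zero])]
  linear_combination h

/-- The partial fractions rest on (1 - s)(1 - t) = (1 - s - t) + st, where s and t are the two
variables involved. -/
theorem toGF_flatSeries {a i j : Fin 3} (hai : a ≠ i) (haj : a ≠ j) (hij : i ≠ j) :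
    toGF (flatSeries a) = 2 / (1 - var i - var j) - 1 / ((1 - var i) * (1 - var j)) := by
  have h := congrArg toGF (flatSeries_identity hai haj hij)
  simp only [toGF_mul, toGF_sub, toGF_add, toGF_one, toGF_X, toGF_flatHookSeries hai haj hij] at h
  have h0 := one_sub_var_sub_var_ne_zero i j
  have h1 := one_sub_var_ne_zero i
  have h2 := one_sub_var_ne_zero j
  refine mul_left_cancel₀ h0 (h.trans ?_)
  field_simp
  ring

theorem toGF_sliceSeries {a i j : Fin 3} (hai : a ≠ i) (haj : a ≠ j) (hij : i ≠ j) :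
    toGF (sliceSeries a) =
      (2 / (1 - var i - var j) - 1 / ((1 - var i) * (1 - var j))) / (1 - var a) := by
  have h := congrArg toGF (sliceSeries_identity a)
  simp only [toGF_mul, toGF_sub, toGF_one, toGF_X, toGF_flatSeries hai haj hij] at h
  rw [eq_div_iff (one_sub_var_ne_zero a)]
  linear_combination h

theorem vars_eq {a i j : Fin 3} (hai : a ≠ i) (haj : a ≠ j) (hij : i ≠ j) :
    var 0 * var 1 * var 2 = var a * var i * var j := by
  have : (Finset.univ : Finset (Fin 3)) = {a, i, j} := by
    ext k
    simp
    omega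
  rw [← Fin.prod_univ_three, this, Finset.prod_insert (by simp [hai, haj]), Finset.prod_pair hij,
    mul_assoc]

theorem twoDHook_eq : TwoDHook =
    var 0 ^ 2 * var 1 ^ 2 * var 2 / ((1 - var 0) * (1 - var 1)) +
      var 0 ^ 2 * var 1 * var 2 ^ 2 / ((1 - var 0) * (1 - var 2)) +
      var 0 * var 1 ^ 2 * var 2 ^ 2 / ((1 - var 2) * (1 - var 1)) := by
  rw [TwoDHook, series_isTwoDHook, shifted_isTwoDHook]
  simp only [toGF_mul, toGF_add, toGF_xyz]
  rw [toGF_flatHookSeries (i := 1) (j := 2) (by decide) (by decide) (by decide),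
    toGF_flatHookSeries (i := 0) (j := 2) (by decide) (by decide) (by decide),
    toGF_flatHookSeries (i := 0) (j := 1) (by decide) (by decide) (by decide)]
  ring

theorem deg2_eq : Deg2 =
    (2 * var 1 * var 2 / (1 - var 1 - var 2) - 2 * var 1 * var 2 / ((1 - var 1) * (1 - var 2))) *
        (var 0 ^ 2 / (1 - var 0)) +
      (2 * var 0 * var 2 / (1 - var 0 - var 2) - 2 * var 0 * var 2 / ((1 - var 0) * (1 - var 2))) *
        (var 1 ^ 2 / (1 - var 1)) +
      (2 * var 0 * var 1 / (1 - var 0 - var 1) - 2 * var 0 * var 1 / ((1 - var 0) * (1 - var 1))) *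
        (var 2 ^ 2 / (1 - var 2)) := by
  rw [Deg2, series_isDegTwo, shifted_isDegTwo]
  simp only [toGF_mul, toGF_add, toGF_sub, toGF_xyz, toGF_X, toGF_fullSeries]
  rw [toGF_sliceSeries (i := 1) (j := 2) (by decide) (by decide) (by decide),
    toGF_sliceSeries (i := 0) (j := 2) (by decide) (by decide) (by decide),
    toGF_sliceSeries (i := 0) (j := 1) (by decide) (by decide) (by decide)]
  -- No relation between the denominators is needed, so they may be treated as independent atoms.
  generalize 1 - var 1 - var 2 = p, 1 - var 0 - var 2 = q, 1 - var 0 - var 1 = r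
  generalize 1 - var 0 = u, 1 - var 1 = v, 1 - var 2 = w
  ring

theorem flatCorner_eq {a i j : Fin 3} (hai : a ≠ i) (haj : a ≠ j) (hij : i ≠ j) :
    FlatCorner a = var a * cornerGF i j := by
  rw [FlatCorner, series_flatCorner, shifted_flatCorner, toGF_mul, toGF_xyz,
    toGF_flatSeries hai haj hij, vars_eq hai haj hij, cornerGF]
  ring

theorem toGF_cornerSeries :
    toGF cornerSeries = (1 + toGF hookSeries) / (1 - var 0 - var 1 - var 2) := by
  have h := congrArg toGF cornerSeries_identity
  simp only [toGF_mul, toGF_sub, toGF_add, toGF_one, toGF_X] at h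
  rw [eq_div_iff one_sub_vars_ne_zero, mul_comm, h]

theorem hooks_eq : Tripod + Deg2 + TwoDHook = var 0 * var 1 * var 2 * toGF hookSeries := by
  rw [Tripod, Deg2, TwoDHook, series_isTripod, series_isDegTwo, series_isTwoDHook, hookSeries_eq]
  simp only [toGF_mul, toGF_add, toGF_xyz]
  ring

/-- The square arises because the corner series, which holds the stair and the first hook, itself
contains the factor 1 + H, and the second hook contributes another. -/
theorem oneDiag_eq (ε : Fin 3 → Bool) : OneDiag ε =
    Stair * (1 + (Tripod + Deg2 + TwoDHook) / (var 0 * var 1 * var 2)) ^ 2 := by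
  rw [hooks_eq, mul_div_cancel_left₀ _ (by simp [var_ne_zero]), stair_eq, OneDiag,
    series_isDiagonalAlong, shifted_isDiagonalAlong]
  simp only [toGF_mul, toGF_add, toGF_one, toGF_xyz, toGF_cornerSeries]
  ring

theorem twoDiagGF_eq {a i j : Fin 3} (hai : a ≠ i) (haj : a ≠ j) (hij : i ≠ j) :
    toGF (xyz * sliceSeries a ^ 2) = twoDiagGF a i j := by
  have h1 := var_ne_zero i
  have h2 := var_ne_zero j
  have h : cornerGF i j =
      var i * var j * (2 / (1 - var i - var j) - 1 / ((1 - var i) * (1 - var j))) := by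
    rw [cornerGF]
    ring
  rw [toGF_mul, toGF_pow, toGF_xyz, toGF_sliceSeries hai haj hij, vars_eq hai haj hij, twoDiagGF, h]
  generalize 2 / (1 - var i - var j) - 1 / ((1 - var i) * (1 - var j)) = F
  field_simp

theorem twoDiag_agreeOn (ε : Fin 3 → Bool) {a i j : Fin 3} (hai : a ≠ i) (haj : a ≠ j)
    (hij : i ≠ j) : AgreeOn {n | 2 ≤ n a ∧ (2 ≤ n i ∨ 2 ≤ n j)}
      (series fun s => {P | IsTwoDiagAlong s a ε P}) (twoDiagGF a i j) := by
  refine ⟨_, twoDiagGF_eq hai haj hij, fun n hn => ?_⟩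
  rw [series_isTwoDiagAlong]
  rcases exists_eq_add_ones n with ⟨k, hk⟩ | ⟨m, rfl⟩
  · rw [coeff_xyz_mul_eq_zero _ hk, coeff_xyz_mul_eq_zero _ hk]
  · rw [coeff_xyz_mul_add, coeff_xyz_mul_add]
    obtain ⟨ha, h⟩ := hn
    simp only [Finsupp.add_apply, ones_apply] at ha h
    refine coeff_shifted_isTwoDiagAlong ε (by omega) ?_
    rcases h with h | h
    · exact ⟨i, hai, by omega⟩
    · exact ⟨j, haj, by omega⟩

theorem diagonal_agreeOn (ε : Fin 3 → Bool) :
    AgreeOn {n | ∀ i, 2 ≤ n i} (series fun s => {P | IsDiagonal s P})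
      (4 * OneDiag ε - 2 * (twoDiagGF 0 1 2 + twoDiagGF 1 0 2 + twoDiagGF 2 0 1) + 3 * Cross) := by
  refine ⟨xyz * (4 * shifted (fun s => {P | IsDiagonalAlong s ε P}) -
    2 * (sliceSeries 0 ^ 2 + sliceSeries 1 ^ 2 + sliceSeries 2 ^ 2) +
    3 * shifted fun s => {P | IsCross s P}), ?_, fun n hn => ?_⟩
  · rw [OneDiag, Cross, series_isDiagonalAlong, series_isCross,
      ← twoDiagGF_eq (a := 0) (by decide) (by decide) (by decide),
      ← twoDiagGF_eq (a := 1) (by decide) (by decide) (by decide),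
      ← twoDiagGF_eq (a := 2) (by decide) (by decide) (by decide)]
    simp only [toGF_mul, toGF_add, toGF_sub, toGF_pow, toGF_ofNat]
    ring
  · rw [series_isDiagonal]
    rcases exists_eq_add_ones n with ⟨k, hk⟩ | ⟨m, rfl⟩
    · rw [coeff_xyz_mul_eq_zero _ hk, coeff_xyz_mul_eq_zero _ hk]
    · rw [coeff_xyz_mul_add, coeff_xyz_mul_add]
      refine coeff_shifted_isDiagonal ε fun i => ?_
      have := hn i
      simp only [Finsupp.add_apply, ones_apply] at this
      omega

end Polycube

theorem mainTheorem5 (x y z : GF) (hx : x = var 0) (hy : y = var 1) (hz : z = var 2) :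
    -- the components and their rational forms
    Stair = x * y * z / (1 - x - y - z) ∧
    Tripod = x ^ 2 * y ^ 2 * z ^ 2 / ((1 - x) * (1 - y) * (1 - z)) ∧
    TwoDHook = x ^ 2 * y ^ 2 * z / ((1 - x) * (1 - y)) + x ^ 2 * y * z ^ 2 / ((1 - x) * (1 - z)) +
      x * y ^ 2 * z ^ 2 / ((1 - z) * (1 - y)) ∧
    Deg2 =
      (2 * y * z / (1 - y - z) - 2 * y * z / ((1 - y) * (1 - z))) * (x ^ 2 / (1 - x)) +
      (2 * x * z / (1 - x - z) - 2 * x * z / ((1 - x) * (1 - z))) * (y ^ 2 / (1 - y)) +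
      (2 * x * y / (1 - x - y) - 2 * x * y / ((1 - x) * (1 - y))) * (z ^ 2 / (1 - z)) ∧
    (∀ a i j : Fin 3, a ≠ i → a ≠ j → i ≠ j → FlatCorner a = var a * cornerGF i j) ∧
    Cross = x ^ 2 * (2 - x) * y ^ 2 * (2 - y) * z ^ 2 * (2 - z) /
      ((1 - x) ^ 2 * (1 - y) ^ 2 * (1 - z) ^ 2) ∧
    -- diagonal polyominoes along one given diagonal
    (∀ ε, OneDiag ε = Stair * (1 + (Tripod + Deg2 + TwoDHook) / (x * y * z)) ^ 2) ∧
    -- the generic form of a polyomino on two diagonals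
    (∀ s a ε P, IsTwoDiagAlong s a ε P →
      IsDiagonalAlong s ε P ∧ IsDiagonalAlong s (Polycube.flip a ε) P) ∧
    (∀ ε, ∀ a i j : Fin 3, a ≠ i → a ≠ j → i ≠ j →
      AgreeOn {n | 2 ≤ n a ∧ (2 ≤ n i ∨ 2 ≤ n j)} (series fun s => {P | IsTwoDiagAlong s a ε P})
        (twoDiagGF a i j)) ∧
    -- crosses lie on all four diagonals
    (∀ s P, IsCross s P → ∀ ε, IsDiagonalAlong s ε P) ∧
    -- all diagonal polyominoes, in prisms with all sides at least two
    (∀ ε, AgreeOn {n | ∀ i, 2 ≤ n i} (series fun s => {P | IsDiagonal s P})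
      (4 * OneDiag ε - 2 * (twoDiagGF 0 1 2 + twoDiagGF 1 0 2 + twoDiagGF 2 0 1) +
        3 * Cross)) := by
  subst hx hy hz
  exact ⟨stair_eq, tripod_eq, twoDHook_eq, deg2_eq, fun _ _ _ => flatCorner_eq, cross_eq,
    oneDiag_eq, fun _ _ _ _ h => h.isDiagonalAlong, fun ε _ _ _ => twoDiag_agreeOn ε,
    fun _ _ h => h.isDiagonalAlong, diagonal_agreeOn⟩
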